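/- For $g\in L^2(\mathbb R)$ let $\partial_k g$ be its distributional derivative, and put $\|g\|_{L^\infty}=\infty$, $\|\partial_k g\|_{L^2}=\infty$ when the quantity is not finite (with the conventions $1/0=\infty$ and $\infty\cdot 0=0$ on the right-hand sides below). (i) Let $\widehat f(k)=(2\pi)^{-1/2}\int_{\mathbb R}e^{-ikx}f(x)\,dx$ be the Fourier transform on $L^2(\mathbb R)$. There is an absolute constant $C$ such that, for all $f\in L^2(\mathbb R)$ and all $t\ge 0$, $$\|e^{-it\partial_x^2}f\|_{L^\infty}\le C\Big(\frac1{\sqrt t}\,\|\widehat f\|_{L^\infty}+\frac1{t^{3/4}}\,\|\partial_k\widehat f\|_{L^2}\Big).$$ (ii) Let $V:\mathbb R\to\mathbb R$ satisfy $V\in L^1_1$, i.e. $\int_{\mathbb R}\sqrt{1+x^2}\,|V(x)|\,dx<\infty$, and let $L_V=-\partial_x^2+V$ be the corresponding self-adjoint operator on $L^2(\mathbb R)$, with its maximal domain. Assume that $L_V$ has no bound states, i.e. no $L^2$ eigenvalues. For $k\in\mathbb R$ let $f_\pm(\cdot,k)$ be the Jost solutions: $(-\partial_x^2+V)f_\pm=k^2f_\pm$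 on $\mathbb R$, with $f_+(x,k)\sim e^{ikx}$ as $x\to+\infty$ and $f_-(x,k)\sim e^{-ikx}$ as $x\to-\infty$. For $k\neq0$ let the transmission coefficient $T(k)$ and the reflection coefficient $R_-(k)$ be determined by $T(k)f_+(x,k)=f_-(x,-k)+R_-(k)f_-(x,k)$ for all $x$. Put $$\psi(x,k)=\frac1{\sqrt{2\pi}}\begin{cases}T(k)f_+(x,k),&k\ge 0,\\ T(-k)f_-(x,-k),&k<0\end{cases}$$ (the point $k=0$ is irrelevant), and let $\widetilde f(k)=\int_{\mathbb R}\overline{\psi(x,k)}\,f(x)\,dx$ be the distorted Fourier transform of $f\in L^2(\mathbb R)$, the integral being understood as the $L^2(dk)$-limit of $\int_{-R}^{R}$ as $R\to\infty$. Then there is a constant $C=C(V)$ such that, for all $f\in L^2(\mathbb R)$ and all $t\ge 0$, $$\|e^{itL_V}f\|_{L^\infty}\le C\Big(\frac1{\sqrt t}\,\|\widetilde f\|_{L^\infty}+\frac1{t^{3/4}}\,\|\partial_k\widetilde f\|_{L^2}\Big).$$ -/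

import Mathlib

open MeasureTheory Filter Topology Set
open scoped ENNReal NNReal FourierTransform ContDiff

noncomputable section

/-- The complex Hilbert space `L²(ℝ)`. -/
abbrev L2R : Type := Lp ℂ 2 (volume : Measure ℝ)

/-- `V ∈ L¹₁`, i.e. `⟨x⟩ V ∈ L¹(ℝ)` with `⟨x⟩ = √(1 + x²)`. -/
def MemL11 (V : ℝ → ℝ) : Prop :=
  Integrable (fun x : ℝ => Real.sqrt (1 + x ^ 2) * V x) volume

/-- `-u'' + V u = h` on `ℝ` in the Carathéodory sense: `u` is differentiable with a locally
absolutely continuous derivative `v`, and `v' = V u - h` almost everywhere (written in integrated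
form). It is used for `V ∈ L¹` and `h` locally integrable only. -/
def SolvesSchrodinger (V : ℝ → ℝ) (u h : ℝ → ℂ) : Prop :=
  ∃ v : ℝ → ℂ, (∀ x, HasDerivAt u (v x) x) ∧
    ∀ a b : ℝ, v b - v a = ∫ x in a..b, ((V x : ℂ) * u x - h x)

/-- The graph of the self-adjoint operator `L_V = -∂ₓ² + V` on `L²(ℝ)` (maximal domain, which for
real `V ∈ L¹` is the domain of self-adjointness): `f ∈ D(L_V)` and `L_V f = h`. -/
def SchrodingerGraph (V : ℝ → ℝ) (f h : L2R) : Prop :=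
  ∃ u : ℝ → ℂ, (f : ℝ → ℂ) =ᵐ[volume] u ∧ SolvesSchrodinger V u h

/-- `L_V` has no bound states, i.e. no eigenvalues on `L²(ℝ)`. -/
def HasNoBoundStates (V : ℝ → ℝ) : Prop :=
  ∀ (E : ℝ) (f : L2R), SchrodingerGraph V f ((E : ℂ) • f) → f = 0

/-- `U t = e^{i t L_V}`: `U` is the strongly continuous one-parameter group of unitary operators
on `L²(ℝ)` whose infinitesimal generator is exactly `i L_V`. By Stone's theorem there is one and
only one such `U` when `L_V` is self-adjoint. -/
structure IsSchrodingerGroup (V : ℝ → ℝ) (U : ℝ → (L2R ≃ₗᵢ[ℂ] L2R)) : Prop where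
  map_add : ∀ (s t : ℝ) (f : L2R), U (s + t) f = U s (U t f)
  continuous : ∀ f : L2R, Continuous fun t => U t f
  generator : ∀ f h : L2R,
    HasDerivAt (fun t : ℝ => U t f) (Complex.I • h) 0 ↔ SchrodingerGraph V f h

/-- The requirements that single out the Jost solution `f₊(·, k)`:
`-f'' + V f = k² f` on `ℝ` and `f(x) ∼ e^{ikx}` as `x → +∞`. -/
def IsJostPlus (V : ℝ → ℝ) (k : ℝ) (f : ℝ → ℂ) : Prop :=
  SolvesSchrodinger V f (fun x => (k : ℂ) ^ 2 * f x) ∧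
    Asymptotics.IsEquivalent atTop f (fun x : ℝ => Complex.exp (Complex.I * k * x))

/-- The requirements that single out the Jost solution `f₋(·, k)`:
`-f'' + V f = k² f` on `ℝ` and `f(x) ∼ e^{-ikx}` as `x → -∞`. -/
def IsJostMinus (V : ℝ → ℝ) (k : ℝ) (f : ℝ → ℂ) : Prop :=
  SolvesSchrodinger V f (fun x => (k : ℂ) ^ 2 * f x) ∧
    Asymptotics.IsEquivalent atBot f (fun x : ℝ => Complex.exp (-(Complex.I * k * x)))

/-- The Jost solution `x ↦ f₊(x, k)`. -/
def jostPlus (V : ℝ → ℝ) (k : ℝ) : ℝ → ℂ := Classical.epsilon (IsJostPlus V k)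

/-- The Jost solution `x ↦ f₋(x, k)`. -/
def jostMinus (V : ℝ → ℝ) (k : ℝ) : ℝ → ℂ := Classical.epsilon (IsJostMinus V k)

/-- The transmission coefficient `T(k)`: together with the reflection coefficient `R = R₋(k)` it is
determined, for `k ≠ 0`, by `T(k) f₊(x, k) = f₋(x, -k) + R₋(k) f₋(x, k)` for all `x`.
(The value at the single point `k = 0` plays no role.) -/
def transmission (V : ℝ → ℝ) (k : ℝ) : ℂ :=
  Classical.epsilon fun T : ℂ => ∃ R : ℂ, ∀ x : ℝ,
    T * jostPlus V k x = jostMinus V (-k) x + R * jostMinus V k x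

/-- The generalized eigenfunctions `ψ(x, k)`. -/
def psi (V : ℝ → ℝ) (x k : ℝ) : ℂ :=
  ((Real.sqrt (2 * Real.pi) : ℝ) : ℂ)⁻¹ *
    if 0 ≤ k then transmission V k * jostPlus V k x
    else transmission V (-k) * jostMinus V (-k) x

/-- The integral `∫ conj ψ(x, k) φ(x) dx` (for `φ ∈ L¹`). -/
def distortedFourierIntegral (V : ℝ → ℝ) (φ : ℝ → ℂ) (k : ℝ) : ℂ :=
  ∫ x, (starRingEnd ℂ) (psi V x k) * φ x

/-- `g` is the distorted Fourier transform of `f ∈ L²`: the truncated integrals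
`∫_{|x| ≤ R} conj ψ(x, k) f(x) dx` converge to `g` in `L²(dk)` as `R → ∞`. -/
def IsDistortedFourier (V : ℝ → ℝ) (f g : L2R) : Prop :=
  Tendsto (fun R : ℝ => eLpNorm
      (fun k => distortedFourierIntegral V ((Icc (-R) R).indicator f) k - g k) 2 volume)
    atTop (𝓝 0)

/-- The distorted Fourier transform on `L²(ℝ)`. -/
def distortedFourier (V : ℝ → ℝ) (f : L2R) : L2R :=
  Classical.epsilon (IsDistortedFourier V f)

/-- The flat Fourier transform on `L²(ℝ)` with the normalization
`(2π)^{-1/2} ∫ e^{-ikx} f(x) dx`, obtained by rescaling Mathlib's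
`𝓕 f (ξ) = ∫ e^{-2πiξx} f(x) dx`. -/
def flatFourier (f : L2R) (k : ℝ) : ℂ :=
  ((Real.sqrt (2 * Real.pi) : ℝ) : ℂ)⁻¹ * (𝓕 f : L2R) (k / (2 * Real.pi))

/-- `g'` is the weak (distributional) derivative of `g` on `ℝ`. -/
def HasWeakDeriv (g g' : ℝ → ℂ) : Prop :=
  LocallyIntegrable g volume ∧ LocallyIntegrable g' volume ∧
    ∀ φ : ℝ → ℂ, ContDiff ℝ ∞ φ → HasCompactSupport φ →
      ∫ k, g k * deriv φ k = -∫ k, g' k * φ k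

/-- `t^{-1/2} ‖g‖_{L^∞} + t^{-3/4} ‖g'‖_{L²}`, with values in `[0, ∞]`. -/
def dispersiveBound (t : ℝ) (g g' : ℝ → ℂ) : ℝ≥0∞ :=
  ENNReal.ofReal t ^ (-(1 / 2) : ℝ) * eLpNorm g ∞ volume +
    ENNReal.ofReal t ^ (-(3 / 4) : ℝ) * eLpNorm g' 2 volume

end

/-! Put `τ = t^{-1/2}`. In the distorted Fourier representation `⟨h, e^{itL_V} f⟩ = ∫ e^{itk²} conj
h̃(k) f̃(k) dk`. By Fubini and the duality of `L¹` and `L^∞`, the theorem reduces to bounding `∫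
ψ(x,k) e^{itk²} f̃(k) dk` by `C (τ ‖f̃‖_∞ + τ^{3/2} ‖f̃'‖_2)` uniformly in `x`
(`norm_integral_psi_le`).

On each half-line in `k`, `ψ(x,k)` is a sum of at most two terms `b(k) e^{iξk}`, where `ξ` depends
on `x` and `b` is a symbol: bounded, with `|b'| ≤ A/k`, uniformly in `x` (`IsSymbol`). The phase
`tk² + ξk` has one stationary point `k₀`. Within distance `τ` of `k₀` and of `0` the trivial bound
costs `τ ‖f̃‖_∞`. Elsewhere one integration by parts suffices: the factors `1/(k |k - k₀|)` and
`|f̃'| / |k - k₀|` are split by Young's inequality (`norm_oscillatory_integral_le`).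

The symbol bounds are where `V ∈ L¹₁` enters. The function `m₊ = e^{-ikx} f₊` solves a Volterra
equation with kernel `∫₀^{y-x} e^{2iks} ds`. After multiplication by `k` this kernel is a difference
of bounded exponentials, so `k ∂_k` costs one power of `y - x`, that is, the first moment of `V`; a
bare `∂_k` would cost the second moment (`norm_mul_norm_jostM_sub_le`). The transmission coefficient
is `-2ik/W` with `W` the Wronskian of `f₊` and `f₋`, and conservation of flux gives `|W| ≥ 2|k|` on
the real line. If `W(0) ≠ 0`, `T` is a symbol by direct estimates. If `W(0) = 0`, the zero-energy
Jost solution is bounded at both ends; expressing `W` through Wronskians with it gives `W = ik H`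
with `H` a symbol and `|H| ≥ 2` on the real line away from zero (`exists_jostW_eq_of_zero`,
`low_energy`). Far to the left, where `m₊` may grow, `T f₊` is replaced by `conj f₋ + R f₋`.

The representation formula is derived from the group itself. Its Laplace transform is the resolvent,
with explicit kernel `f₊ f₋ / W`. Absence of eigenvalues together with unitarity gives `W ≠ 0` in
the open upper half-plane, and then `|W| ≥ c|k|` on the closed one, so the kernel has boundary
values with a singularity no worse than `1/|k|`. Its imaginary part on the real axis is the spectral
density (`im_green_eq`), and Stone's formula averaged against Gaussians yields Bessel's inequality
and the evolution formula (`IsSchrodingerGroup.spectral_gaussian`,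
`IsSchrodingerGroup.inner_eq_integral`).

Part (i) is the case `V = 0`, where `m₊ = 1`, `W = -2ik`, and the two Fourier transforms agree
(`flatFourier_ae_eq`). -/

/-! ### Absolutely continuous functions with values in `ℂ` -/

/-- `F` is locally absolutely continuous on `ℝ` with almost everywhere derivative `f`. -/
def IsPrimitive (F f : ℝ → ℂ) : Prop :=
  (∀ a b : ℝ, IntervalIntegrable f volume a b) ∧ ∀ a b : ℝ, F b - F a = ∫ x in a..b, f x

/-- Serves to pass from real to complex values: the increments of `∫ f` are dominated by those of `∫
‖f‖`, which is known to be absolutely continuous. -/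
theorem absolutelyContinuousOnInterval_of_dist_le {f : ℝ → ℂ} {g : ℝ → ℝ} {a b : ℝ}
    (hg : AbsolutelyContinuousOnInterval g a b)
    (h : ∀ x ∈ uIcc a b, ∀ y ∈ uIcc a b, dist (f x) (f y) ≤ dist (g x) (g y)) :
    AbsolutelyContinuousOnInterval f a b := by
  rw [absolutelyContinuousOnInterval_iff] at hg ⊢
  intro ε hε
  obtain ⟨δ, hδ, H⟩ := hg ε hε
  refine ⟨δ, hδ, fun E hE hE2 => lt_of_le_of_lt (Finset.sum_le_sum fun i hi => ?_) (H E hE hE2)⟩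
  exact h _ (hE.1 i hi).1 _ (hE.1 i hi).2

theorem absolutelyContinuousOnInterval_integral {f : ℝ → ℂ} {a b : ℝ}
    (hf : IntervalIntegrable f volume a b) :
    AbsolutelyContinuousOnInterval (fun x => ∫ t in a..x, f t) a b := by
  refine absolutelyContinuousOnInterval_of_dist_le
    (hf.norm.absolutelyContinuousOnInterval_intervalIntegral (c := a) (by simp)) ?_
  intro x hx y hy
  have hs : ∀ z ∈ uIcc a b, IntervalIntegrable f volume a z := fun z hz =>
    hf.mono_set (uIcc_subset_uIcc (by simp) hz)
  rw [dist_eq_norm, Real.dist_eq,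
    intervalIntegral.integral_interval_sub_left (hs x hx) (hs y hy),
    intervalIntegral.integral_interval_sub_left (hs x hx).norm (hs y hy).norm]
  exact intervalIntegral.norm_integral_le_abs_integral_norm

/-- The difference between `F` and the indefinite integral of `f` is absolutely continuous with
derivative zero almost everywhere, hence constant. -/
theorem integral_eq_sub_of_ae_hasDerivAt {F f : ℝ → ℂ} {a b : ℝ}
    (hF : AbsolutelyContinuousOnInterval F a b) (hf : IntervalIntegrable f volume a b)
    (hd : ∀ᵐ x, x ∈ uIcc a b → HasDerivAt F (f x) x) :
    ∫ x in a..b, f x = F b - F a := by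
  have hG := absolutelyContinuousOnInterval_integral hf
  obtain ⟨C, hC⟩ := (hF.sub hG).const_of_ae_hasDerivAt_zero (by
    filter_upwards [hd, hf.ae_hasDerivAt_integral] with x h1 h2 hx
    simpa using (h1 hx).sub (h2 hx a (by simp)))
  have h1 := hC a (by simp)
  have h2 := hC b (by simp)
  simp only [Pi.sub_apply, intervalIntegral.integral_same, sub_zero] at h1 h2
  rw [h1, ← h2]; ring

namespace IsPrimitive

variable {F f G g : ℝ → ℂ}

theorem sub_eq (h : IsPrimitive F f) (a b : ℝ) : F b - F a = ∫ x in a..b, f x := h.2 a b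

theorem eq_add (h : IsPrimitive F f) (a : ℝ) : F = fun x => F a + ∫ t in a..x, f t := by
  ext x; rw [← h.2 a x]; ring

theorem absolutelyContinuous (h : IsPrimitive F f) (a b : ℝ) :
    AbsolutelyContinuousOnInterval F a b := by
  refine absolutelyContinuousOnInterval_of_dist_le
    ((h.1 a b).norm.absolutelyContinuousOnInterval_intervalIntegral (c := a) (by simp)) ?_
  intro x hx y hy
  rw [dist_eq_norm, Real.dist_eq, h.2 y x,
    intervalIntegral.integral_interval_sub_left (h.1 _ _).norm (h.1 _ _).norm]
  exact intervalIntegral.norm_integral_le_abs_integral_norm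

theorem continuous (h : IsPrimitive F f) : Continuous F := by
  rw [h.eq_add 0]
  exact continuous_const.add (intervalIntegral.continuous_primitive h.1 0)

theorem locallyIntegrable (h : IsPrimitive F f) : LocallyIntegrable f volume := by
  intro x
  refine ⟨Icc (x - 1) (x + 1), Icc_mem_nhds (by linarith) (by linarith), ?_⟩
  rw [integrableOn_Icc_iff_integrableOn_Ioc]
  exact (intervalIntegrable_iff_integrableOn_Ioc_of_le (by linarith)).1 (h.1 _ _)

theorem ae_hasDerivAt (h : IsPrimitive F f) : ∀ᵐ x, HasDerivAt F (f x) x := by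
  filter_upwards [_root_.LocallyIntegrable.ae_hasDerivAt_integral h.locallyIntegrable] with x hx
  rw [h.eq_add 0]
  exact (hx 0).const_add _

/-- Integration by parts at the regularity of Carathéodory solutions. The Wronskian identities, the
removal of exponential factors and variation of constants all rest on it. -/
theorem mul (hF : IsPrimitive F f) (hG : IsPrimitive G g) :
    IsPrimitive (fun x => F x * G x) (fun x => f x * G x + F x * g x) := by
  have hi : ∀ a b, IntervalIntegrable (fun x => f x * G x + F x * g x) volume a b := fun a b =>
    ((hF.1 a b).mul_continuousOn hG.continuous.continuousOn).add
      ((hG.1 a b).continuousOn_mul hF.continuous.continuousOn)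
  refine ⟨hi, fun a b => ?_⟩
  rw [integral_eq_sub_of_ae_hasDerivAt (F := fun x => F x * G x) _ (hi a b)]
  · filter_upwards [hF.ae_hasDerivAt, hG.ae_hasDerivAt] with x h1 h2 _
    exact h1.mul h2
  · exact (hF.absolutelyContinuous a b).smul (hG.absolutelyContinuous a b)

theorem add (hF : IsPrimitive F f) (hG : IsPrimitive G g) :
    IsPrimitive (fun x => F x + G x) (fun x => f x + g x) := by
  refine ⟨fun a b => (hF.1 a b).add (hG.1 a b), fun a b => ?_⟩
  rw [intervalIntegral.integral_add (hF.1 a b) (hG.1 a b), ← hF.2, ← hG.2]; ring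

theorem const_mul (hF : IsPrimitive F f) (c : ℂ) :
    IsPrimitive (fun x => c * F x) (fun x => c * f x) := by
  refine ⟨fun a b => (hF.1 a b).const_mul c, fun a b => ?_⟩
  rw [intervalIntegral.integral_const_mul, ← hF.2]; ring

theorem sub (hF : IsPrimitive F f) (hG : IsPrimitive G g) :
    IsPrimitive (fun x => F x - G x) (fun x => f x - g x) := by
  refine ⟨fun a b => (hF.1 a b).sub (hG.1 a b), fun a b => ?_⟩
  rw [intervalIntegral.integral_sub (hF.1 a b) (hG.1 a b), ← hF.2, ← hG.2]; ring

theorem congr (hF : IsPrimitive F f) (h : f =ᵐ[volume] g) : IsPrimitive F g := by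
  refine ⟨fun a b => (hF.1 a b).congr_ae (ae_restrict_of_ae h), fun a b => ?_⟩
  rw [hF.2]
  exact intervalIntegral.integral_congr_ae (h.mono fun x hx _ => hx)

theorem of_hasDerivAt (h : ∀ x, HasDerivAt F (f x) x) (hf : Continuous f) : IsPrimitive F f :=
  ⟨fun a b => hf.intervalIntegrable a b, fun a b =>
    (intervalIntegral.integral_eq_sub_of_hasDerivAt (fun x _ => h x)
      (hf.intervalIntegrable a b)).symm⟩

theorem eq_of_zero (h : IsPrimitive F fun _ => 0) (a b : ℝ) : F a = F b := by
  have := h.2 b a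
  simp only [intervalIntegral.integral_zero] at this
  exact sub_eq_zero.1 this

theorem conj (hF : IsPrimitive F f) :
    IsPrimitive (fun x => starRingEnd ℂ (F x)) (fun x => starRingEnd ℂ (f x)) := by
  refine ⟨fun a b => ?_, fun a b => ?_⟩
  · have := hF.1 a b
    rw [intervalIntegrable_iff] at this ⊢
    exact (Complex.conjCLE.toContinuousLinearMap.integrable_comp this)
  · rw [← map_sub, hF.2, intervalIntegral, intervalIntegral, map_sub, integral_conj, integral_conj]

theorem comp_neg (hF : IsPrimitive F f) :
    IsPrimitive (fun x => F (-x)) (fun x => -f (-x)) := by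
  refine ⟨fun a b => ?_, fun a b => ?_⟩
  · have := (hF.1 (-a) (-b)).comp_mul_left (c := -1)
    simp only [neg_mul, one_mul, div_neg, div_one, neg_neg] at this
    exact this.neg
  · rw [hF.2, intervalIntegral.integral_neg, intervalIntegral.integral_comp_neg,
      intervalIntegral.integral_symm]

end IsPrimitive

/-! ### The weight of the Volterra equation -/

/-- The weight `1 + x₋`. -/
noncomputable def negWeight (x : ℝ) : ℝ := 1 + max (-x) 0

theorem one_le_negWeight (x : ℝ) : 1 ≤ negWeight x := by
  unfold negWeight; linarith [le_max_right (-x) 0]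

theorem negWeight_pos (x : ℝ) : 0 < negWeight x := lt_of_lt_of_le one_pos (one_le_negWeight x)

theorem continuous_negWeight : Continuous negWeight := by unfold negWeight; fun_prop

theorem negWeight_anti {x y : ℝ} (h : x ≤ y) : negWeight y ≤ negWeight x := by
  unfold negWeight; gcongr

/-- The kernel grows like `y - x` and the solution like `negWeight y`; together they cost a single
factor `1 + |y|` once the weight at `x` is taken out. This is why the first moment of `V` is enough.
-/
theorem sub_mul_negWeight_le {x y : ℝ} (h : x ≤ y) :
    (y - x) * negWeight y ≤ negWeight x * (1 + |y|) := by
  unfold negWeight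
  rcases le_total 0 x with hx | hx
  · have hy : 0 ≤ y := hx.trans h
    rw [max_eq_right (by linarith), max_eq_right (by linarith), abs_of_nonneg hy]; nlinarith
  · rw [max_eq_left (by linarith : 0 ≤ -x)]
    rcases le_total 0 y with hy | hy
    · rw [max_eq_right (by linarith), abs_of_nonneg hy]; nlinarith
    · rw [max_eq_left (by linarith), abs_of_nonpos hy]; nlinarith

section Potential

variable {V : ℝ → ℝ}

theorem MemL11.aestronglyMeasurable (hV : MemL11 V) : AEStronglyMeasurable V volume := by
  have h : V = fun x => (Real.sqrt (1 + x ^ 2))⁻¹ * (Real.sqrt (1 + x ^ 2) * V x) := by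
    ext x
    have : 0 < Real.sqrt (1 + x ^ 2) := Real.sqrt_pos.2 (by positivity)
    field_simp
  rw [h]
  refine AEStronglyMeasurable.mul ?_ (Integrable.aestronglyMeasurable hV)
  exact (by fun_prop : Measurable fun x : ℝ => (Real.sqrt (1 + x ^ 2))⁻¹).aestronglyMeasurable

theorem MemL11.integrable_weight (hV : MemL11 V) :
    Integrable (fun y => (1 + |y|) * |V y|) volume := by
  refine (hV.norm.const_mul 2).mono'
    ((by fun_prop : Continuous fun y : ℝ => 1 + |y|).aestronglyMeasurable.mul
      hV.aestronglyMeasurable.norm) (Eventually.of_forall fun y => ?_)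
  have h1 : (1 + |y|) ≤ 2 * Real.sqrt (1 + y ^ 2) := by
    have : 1 ≤ Real.sqrt (1 + y ^ 2) := Real.one_le_sqrt.2 (by nlinarith [sq_nonneg y])
    have : |y| ≤ Real.sqrt (1 + y ^ 2) := Real.abs_le_sqrt (by linarith)
    linarith
  rw [Real.norm_eq_abs, abs_of_nonneg (by positivity), norm_mul, Real.norm_eq_abs, Real.norm_eq_abs,
    abs_of_nonneg (Real.sqrt_nonneg _), ← mul_assoc]
  gcongr

theorem MemL11.integrable (hV : MemL11 V) : Integrable V volume := by
  refine hV.integrable_weight.mono' hV.aestronglyMeasurable (Eventually.of_forall fun y => ?_)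
  rw [Real.norm_eq_abs]
  nlinarith [abs_nonneg y, abs_nonneg (V y)]

theorem MemL11.comp_neg (hV : MemL11 V) : MemL11 fun x => V (-x) := by
  have := Integrable.comp_neg hV
  simpa [MemL11] using this

/-- The exponential constant of the Volterra estimates. -/
noncomputable def volterraConst (V : ℝ → ℝ) : ℝ := Real.exp (2 * ∫ y, (1 + |y|) * |V y|)

/-- The weight for which the Volterra operator has norm at most `1 / 2`. -/
noncomputable def volterraWeight (V : ℝ → ℝ) (x : ℝ) : ℝ :=
  negWeight x * Real.exp (2 * ∫ y in Ioi x, (1 + |y|) * |V y|)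

theorem volterraConst_pos (V : ℝ → ℝ) : 0 < volterraConst V := Real.exp_pos _

theorem negWeight_le_volterraWeight (V : ℝ → ℝ) (x : ℝ) : negWeight x ≤ volterraWeight V x := by
  have : 1 ≤ Real.exp (2 * ∫ y in Ioi x, (1 + |y|) * |V y|) :=
    Real.one_le_exp (mul_nonneg zero_le_two (integral_nonneg fun y => by positivity))
  unfold volterraWeight
  nlinarith [negWeight_pos x]

theorem volterraWeight_pos (V : ℝ → ℝ) (x : ℝ) : 0 < volterraWeight V x :=
  (negWeight_pos x).trans_le (negWeight_le_volterraWeight V x)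

theorem volterraWeight_le (hV : MemL11 V) (x : ℝ) :
    volterraWeight V x ≤ volterraConst V * negWeight x := by
  unfold volterraWeight volterraConst
  rw [mul_comm]
  refine mul_le_mul_of_nonneg_right (Real.exp_le_exp.2 ?_) (negWeight_pos x).le
  refine mul_le_mul_of_nonneg_left ?_ zero_le_two
  exact setIntegral_le_integral hV.integrable_weight (Eventually.of_forall fun y => by positivity)

theorem integral_Ioi_eq_sub {g : ℝ → ℝ} (hg : Integrable g) (x : ℝ) :
    ∫ y in Ioi x, g y = (∫ y in Ioi 0, g y) - ∫ y in (0 : ℝ)..x, g y := by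
  rw [← intervalIntegral.integral_Ioi_sub_Ioi' hg.integrableOn hg.integrableOn]; ring

/-- With `q` the tail of `g`, the integrand is almost everywhere the derivative of `-e^{2q}/2`. That
function is monotone, and the integral of the derivative of a monotone function is at most its
increment. -/
theorem integral_mul_exp_tail_le {g : ℝ → ℝ} (hg : Integrable g) (h0 : ∀ x, 0 ≤ g x) (x : ℝ) :
    IntegrableOn (fun y => g y * Real.exp (2 * ∫ t in Ioi y, g t)) (Ioi x) ∧
    ∫ y in Ioi x, g y * Real.exp (2 * ∫ t in Ioi y, g t) ≤
      1 / 2 * Real.exp (2 * ∫ t in Ioi x, g t) := by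
  set q : ℝ → ℝ := fun y => ∫ t in Ioi y, g t with hq
  have hq' : q = fun y => (∫ y in Ioi 0, g y) - ∫ y in (0 : ℝ)..y, g y :=
    funext fun y => integral_Ioi_eq_sub hg y
  have hqc : Continuous q := by
    rw [hq']
    exact continuous_const.sub (intervalIntegral.continuous_primitive
      (fun a b => hg.intervalIntegrable) 0)
  have hanti : Antitone q := fun a b hab =>
    setIntegral_mono_set hg.integrableOn (Eventually.of_forall h0)
      (Ioi_subset_Ioi hab).eventuallyLE
  have hd : ∀ᵐ y, HasDerivAt q (-g y) y := by
    filter_upwards [_root_.LocallyIntegrable.ae_hasDerivAt_integral hg.locallyIntegrable] with y hy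
    rw [hq']
    exact (hy 0).const_sub _
  have hint : Integrable (fun y => g y * Real.exp (2 * ∫ t in Ioi y, g t)) := by
    refine (hg.mul_const (Real.exp (2 * ∫ t, g t))).mono'
      (hg.aestronglyMeasurable.mul (by fun_prop : Continuous fun y =>
        Real.exp (2 * q y)).aestronglyMeasurable) (Eventually.of_forall fun y => ?_)
    rw [Real.norm_eq_abs, abs_of_nonneg (mul_nonneg (h0 y) (Real.exp_pos _).le)]
    refine mul_le_mul_of_nonneg_left (Real.exp_le_exp.2 ?_) (h0 y)
    exact mul_le_mul_of_nonneg_left (setIntegral_le_integral hg (Eventually.of_forall h0))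
      zero_le_two
  refine ⟨hint.integrableOn, ?_⟩
  have hlim := intervalIntegral_tendsto_integral_Ioi x hint.integrableOn tendsto_id
  refine le_of_tendsto hlim ?_
  filter_upwards [eventually_ge_atTop x] with b hb
  have hmono : Monotone fun y => -Real.exp (2 * q y) := fun a b hab =>
    neg_le_neg (Real.exp_le_exp.2 (mul_le_mul_of_nonneg_left (hanti hab) zero_le_two))
  have h1 := (hmono.monotoneOn (uIcc x b)).intervalIntegral_deriv_mem_uIcc
  have h2 : ∫ y in x..b, deriv (fun y => -Real.exp (2 * q y)) y =
      ∫ y in x..b, 2 * (g y * Real.exp (2 * q y)) := by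
    refine intervalIntegral.integral_congr_ae (hd.mono fun y hy _ => ?_)
    exact ((hy.const_mul 2).exp.fun_neg).deriv.trans (by ring)
  rw [h2, intervalIntegral.integral_const_mul, uIcc_of_le (sub_nonneg.2 (hmono hb))] at h1
  have h3 := h1.2
  have h4 := Real.exp_pos (2 * q b)
  simp only [id]
  linarith

theorem continuous_volterraWeight (hV : MemL11 V) : Continuous (volterraWeight V) := by
  unfold volterraWeight
  have h : (fun x => ∫ y in Ioi x, (1 + |y|) * |V y|) =
      fun x => (∫ y in Ioi 0, (1 + |y|) * |V y|) - ∫ y in (0 : ℝ)..x, (1 + |y|) * |V y| :=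
    funext fun y => integral_Ioi_eq_sub hV.integrable_weight y
  have hc : Continuous fun x => ∫ y in Ioi x, (1 + |y|) * |V y| := by
    rw [h]
    exact continuous_const.sub (intervalIntegral.continuous_primitive
      (fun a b => hV.integrable_weight.intervalIntegrable) 0)
  exact continuous_negWeight.mul (Real.continuous_exp.comp (hc.const_mul 2))

/-- The exponential of the tail absorbs the size of `∫ (1 + |y|) |V y|`, so the factor `1 / 2` holds
without any smallness of `V`, and a contraction argument can replace the Neumann series. -/
theorem integral_sub_mul_volterraWeight_le (hV : MemL11 V) (x : ℝ) :
    IntegrableOn (fun y => (y - x) * |V y| * volterraWeight V y) (Ioi x) ∧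
    ∫ y in Ioi x, (y - x) * |V y| * volterraWeight V y ≤ 1 / 2 * volterraWeight V x := by
  obtain ⟨h1, h2⟩ := integral_mul_exp_tail_le hV.integrable_weight (fun y => by positivity) x
  have hb : ∀ y ∈ Ioi x, (y - x) * |V y| * volterraWeight V y ≤ negWeight x *
      ((1 + |y|) * |V y| * Real.exp (2 * ∫ t in Ioi y, (1 + |t|) * |V t|)) := fun y hy => by
    have := sub_mul_negWeight_le (le_of_lt hy)
    have h3 : 0 ≤ |V y| * Real.exp (2 * ∫ t in Ioi y, (1 + |t|) * |V t|) := by positivity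
    unfold volterraWeight
    nlinarith
  have h0 : ∀ y ∈ Ioi x, 0 ≤ (y - x) * |V y| * volterraWeight V y := fun y hy =>
    mul_nonneg (mul_nonneg (sub_nonneg.2 (le_of_lt hy)) (abs_nonneg _)) (volterraWeight_pos V y).le
  have hi : IntegrableOn (fun y => (y - x) * |V y| * volterraWeight V y) (Ioi x) := by
    refine Integrable.mono' (h1.const_mul (negWeight x)) ?_ ?_
    · exact (((by fun_prop : Continuous fun y : ℝ => y - x).aestronglyMeasurable.mul
        hV.aestronglyMeasurable.norm).mul
        (continuous_volterraWeight hV).aestronglyMeasurable).restrict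
    · refine (ae_restrict_mem measurableSet_Ioi).mono fun y hy => ?_
      rw [Real.norm_eq_abs, abs_of_nonneg (h0 y hy)]
      exact hb y hy
  refine ⟨hi, (setIntegral_mono_on hi (h1.const_mul _) measurableSet_Ioi hb).trans ?_⟩
  rw [integral_const_mul]
  unfold volterraWeight
  nlinarith [negWeight_pos x]

/-- A Gronwall inequality for the Volterra kernel `(y - x) |V y|`. -/
theorem volterra_gronwall (hV : MemL11 V) {a B c : ℝ} (hc : 0 ≤ c) {d : ℝ → ℂ}
    (hB : ∀ x, a ≤ x → ‖d x‖ ≤ B * negWeight x)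
    (hd : ∀ x, a ≤ x → ‖d x‖ ≤ c * negWeight x + ∫ y in Ioi x, (y - x) * |V y| * ‖d y‖) :
    ∀ x, a ≤ x → ‖d x‖ ≤ 2 * c * volterraConst V * negWeight x := by
  have hB0 : 0 ≤ B := by
    have := (norm_nonneg _).trans (hB a le_rfl)
    exact nonneg_of_mul_nonneg_left this (negWeight_pos a)
  -- Each use of the inequality halves the a priori constant `B` and reproduces `2 * c`, since `c +
  -- (2 * c) / 2 = 2 * c`. The limit `n → ∞` removes `B`.
  have key : ∀ n : ℕ, ∀ x, a ≤ x → ‖d x‖ ≤ (2 * c + B * (1 / 2) ^ n) * volterraWeight V x := by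
    intro n
    induction n with
    | zero =>
      intro x hx
      have h1 := hB x hx
      have h2 := negWeight_le_volterraWeight V x
      have h3 := negWeight_pos x
      simp only [pow_zero, mul_one]
      nlinarith
    | succ n ih =>
      intro x hx
      obtain ⟨h1, h2⟩ := integral_sub_mul_volterraWeight_le hV x
      have hS : 0 ≤ 2 * c + B * (1 / 2) ^ n := by positivity
      have h3 : ∫ y in Ioi x, (y - x) * |V y| * ‖d y‖ ≤
          ∫ y in Ioi x, (2 * c + B * (1 / 2) ^ n) * ((y - x) * |V y| * volterraWeight V y) := by
        refine integral_mono_of_nonneg ?_ (h1.const_mul _) ?_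
        · refine (ae_restrict_mem measurableSet_Ioi).mono fun y hy => ?_
          exact mul_nonneg (mul_nonneg (sub_nonneg.2 (le_of_lt hy)) (abs_nonneg _)) (norm_nonneg _)
        · refine (ae_restrict_mem measurableSet_Ioi).mono fun y hy => ?_
          have h4 := ih y (hx.trans (le_of_lt hy))
          have h5 : 0 ≤ (y - x) * |V y| :=
            mul_nonneg (sub_nonneg.2 (le_of_lt hy)) (abs_nonneg _)
          calc (y - x) * |V y| * ‖d y‖
              ≤ (y - x) * |V y| * ((2 * c + B * (1 / 2) ^ n) * volterraWeight V y) := by gcongr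
            _ = _ := by ring
      rw [integral_const_mul] at h3
      have h6 := hd x hx
      have h7 := negWeight_le_volterraWeight V x
      have h8 := mul_le_mul_of_nonneg_left h2 hS
      have h9 := mul_le_mul_of_nonneg_left h7 hc
      rw [pow_succ]
      nlinarith
  intro x hx
  have hlim : Tendsto (fun n : ℕ => (2 * c + B * (1 / 2 : ℝ) ^ n) * volterraWeight V x) atTop
      (𝓝 ((2 * c + B * 0) * volterraWeight V x)) :=
    ((tendsto_pow_atTop_nhds_zero_of_lt_one (by norm_num) (by norm_num)).const_mul B
      |>.const_add _).mul_const _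
  have h1 := ge_of_tendsto' hlim fun n => key n x hx
  have h2 := mul_le_mul_of_nonneg_left (volterraWeight_le hV x) (by linarith : 0 ≤ 2 * c)
  nlinarith

end Potential

/-! ### The kernel -/

/-- The Volterra kernel `∫₀ʳ e^{2iks} ds`. -/
noncomputable def volterraKernel (k : ℂ) (r : ℝ) : ℂ :=
  ∫ s in (0 : ℝ)..r, Complex.exp (2 * Complex.I * k * s)

section Kernel

open Complex

theorem norm_cexp_two_I_mul_le {k : ℂ} (hk : 0 ≤ k.im) {r : ℝ} (hr : 0 ≤ r) :
    ‖cexp (2 * I * k * r)‖ ≤ 1 := by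
  rw [Complex.norm_exp]
  refine Real.exp_le_one_iff.2 ?_
  have : (2 * I * k * r).re = -(2 * k.im * r) := by simp
  rw [this]
  have := mul_nonneg hk hr
  linarith

theorem norm_exp_sub_exp_le {a b : ℂ} (ha : a.re ≤ 0) (hb : b.re ≤ 0) :
    ‖cexp a - cexp b‖ ≤ ‖a - b‖ := by
  have hs : Convex ℝ {z : ℂ | z.re ≤ 0} := convex_halfSpace_re_le 0
  have := hs.norm_image_sub_le_of_norm_hasDerivWithin_le (f := cexp) (f' := cexp) (C := 1)
    (x := b) (y := a)
    (fun x _ => (Complex.hasDerivAt_exp x).hasDerivWithinAt)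
    (fun x hx => by rw [Complex.norm_exp]; exact Real.exp_le_one_iff.2 hx) hb ha
  simpa using this

theorem norm_cexp_sub_le {k k' : ℂ} (hk : 0 ≤ k.im) (hk' : 0 ≤ k'.im) {r : ℝ} (hr : 0 ≤ r) :
    ‖cexp (2 * I * k * r) - cexp (2 * I * k' * r)‖ ≤ 2 * r * ‖k - k'‖ := by
  have h : ∀ k : ℂ, 0 ≤ k.im → (2 * I * k * r).re ≤ 0 := fun k hk => by
    have : (2 * I * k * r).re = -(2 * k.im * r) := by simp
    rw [this]
    have := mul_nonneg hk hr
    linarith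
  refine (norm_exp_sub_exp_le (h k hk) (h k' hk')).trans (le_of_eq ?_)
  rw [← sub_mul, ← mul_sub, norm_mul, norm_mul, norm_mul]
  simp [abs_of_nonneg hr]
  ring

theorem hasDerivAt_volterraKernel (k : ℂ) (r : ℝ) :
    HasDerivAt (volterraKernel k) (cexp (2 * I * k * r)) r := by
  have hc : Continuous fun s : ℝ => cexp (2 * I * k * s) := by fun_prop
  exact intervalIntegral.integral_hasDerivAt_right (hc.intervalIntegrable _ _)
    (hc.stronglyMeasurableAtFilter _ _) hc.continuousAt

theorem continuous_volterraKernel (k : ℂ) : Continuous (volterraKernel k) :=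
  continuous_iff_continuousAt.2 fun r => (hasDerivAt_volterraKernel k r).continuousAt

theorem volterraKernel_zero (k : ℂ) : volterraKernel k 0 = 0 := by simp [volterraKernel]

theorem norm_volterraKernel_sub_le {k : ℂ} (hk : 0 ≤ k.im) {r r' : ℝ} (hr : 0 ≤ r) (hr' : 0 ≤ r') :
    ‖volterraKernel k r - volterraKernel k r'‖ ≤ |r - r'| := by
  have hc : Continuous fun s : ℝ => cexp (2 * I * k * s) := by fun_prop
  rw [volterraKernel, volterraKernel, intervalIntegral.integral_interval_sub_left
    (hc.intervalIntegrable _ _) (hc.intervalIntegrable _ _)]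
  refine (intervalIntegral.norm_integral_le_of_norm_le_const (C := 1) fun s hs => ?_).trans
    (by simp)
  refine norm_cexp_two_I_mul_le hk ?_
  rcases le_total r r' with h | h
  · rw [uIoc_of_ge h] at hs; exact hr.trans hs.1.le
  · rw [uIoc_of_le h] at hs; exact hr'.trans hs.1.le

theorem norm_volterraKernel_le {k : ℂ} (hk : 0 ≤ k.im) {r : ℝ} (hr : 0 ≤ r) :
    ‖volterraKernel k r‖ ≤ r := by
  have := norm_volterraKernel_sub_le hk hr le_rfl
  rwa [volterraKernel_zero, sub_zero, sub_zero, abs_of_nonneg hr] at this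

theorem mul_volterraKernel (k : ℂ) (r : ℝ) :
    2 * I * k * volterraKernel k r = cexp (2 * I * k * r) - 1 := by
  have h := intervalIntegral.integral_eq_sub_of_hasDerivAt (a := 0) (b := r)
    (f := fun s : ℝ => cexp (2 * I * k * s)) (f' := fun s => 2 * I * k * cexp (2 * I * k * s))
    (fun s _ => by
      have := ((hasDerivAt_id (s : ℂ)).const_mul (2 * I * k)).cexp.comp_ofReal
      simpa [mul_comm] using this)
    (by apply Continuous.intervalIntegrable; fun_prop)
  rw [intervalIntegral.integral_const_mul] at h
  simpa [volterraKernel] using h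

theorem norm_mul_norm_volterraKernel_le {k : ℂ} (hk : 0 ≤ k.im) {r : ℝ} (hr : 0 ≤ r) :
    ‖k‖ * ‖volterraKernel k r‖ ≤ 1 := by
  have h := congrArg norm (mul_volterraKernel k r)
  have h2 := norm_sub_le (cexp (2 * I * k * r)) 1
  have h3 := norm_cexp_two_I_mul_le hk hr
  simp only [norm_mul, Complex.norm_I, RCLike.norm_ofNat, norm_one] at h h2
  linarith

/-- By `mul_volterraKernel` the factor `k` turns the kernel into an exponential, whose dependence on
`k` costs one power of `r`. Without that factor, `norm_volterraKernel_sub_le_sq` costs `r ^ 2`,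
which is not integrable against a general `V ∈ L¹₁`. -/
theorem norm_mul_volterraKernel_sub_le {k k' : ℂ} (hk : 0 ≤ k.im) (hk' : 0 ≤ k'.im) {r : ℝ}
    (hr : 0 ≤ r) :
    ‖k‖ * ‖volterraKernel k r - volterraKernel k' r‖ ≤ 2 * ‖k - k'‖ * r := by
  have h : 2 * I * (k * (volterraKernel k r - volterraKernel k' r)) =
      (cexp (2 * I * k * r) - cexp (2 * I * k' * r)) - 2 * I * ((k - k') * volterraKernel k' r) := by
    linear_combination mul_volterraKernel k r - mul_volterraKernel k' r
  have h1 := congrArg norm h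
  have h2 := norm_sub_le (cexp (2 * I * k * r) - cexp (2 * I * k' * r))
    (2 * I * ((k - k') * volterraKernel k' r))
  have h3 := norm_cexp_sub_le hk hk' hr
  have h4 := mul_le_mul_of_nonneg_left (norm_volterraKernel_le hk' hr) (norm_nonneg (k - k'))
  simp only [norm_mul, Complex.norm_I, RCLike.norm_ofNat] at h1 h2
  nlinarith

theorem norm_volterraKernel_sub_le_sq {k k' : ℂ} (hk : 0 ≤ k.im) (hk' : 0 ≤ k'.im) {r : ℝ}
    (hr : 0 ≤ r) :
    ‖volterraKernel k r - volterraKernel k' r‖ ≤ 2 * ‖k - k'‖ * r ^ 2 := by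
  have hc : ∀ k : ℂ, Continuous fun s : ℝ => cexp (2 * I * k * s) := fun k => by fun_prop
  rw [volterraKernel, volterraKernel, ← intervalIntegral.integral_sub
    ((hc k).intervalIntegrable _ _) ((hc k').intervalIntegrable _ _)]
  refine (intervalIntegral.norm_integral_le_of_norm_le_const (C := 2 * r * ‖k - k'‖)
    fun s hs => ?_).trans (le_of_eq ?_)
  · rw [uIoc_of_le hr] at hs
    refine (norm_cexp_sub_le hk hk' hs.1.le).trans ?_
    have := hs.2
    gcongr
  · rw [sub_zero, abs_of_nonneg hr]; ring

end Kernel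

/-! ### The Volterra equation for the Jost solutions -/

section Volterra

open Complex

variable {V : ℝ → ℝ}

theorem integrableOn_mul_of_norm_le (hV : MemL11 V) {u : ℝ → ℂ} (hu : Continuous u) {C : ℝ}
    (hC : ∀ x, ‖u x‖ ≤ C * negWeight x) (x : ℝ) : IntegrableOn (fun y => (V y : ℂ) * u y) (Ioi x) := by
  have hC0 : 0 ≤ C := nonneg_of_mul_nonneg_left ((norm_nonneg _).trans (hC 0)) (negWeight_pos 0)
  refine Integrable.mono' (hV.integrable.norm.mul_const (C * negWeight x)).integrableOn
    ((continuous_ofReal.comp_aestronglyMeasurable hV.aestronglyMeasurable).mul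
      hu.aestronglyMeasurable).restrict ?_
  refine (ae_restrict_mem measurableSet_Ioi).mono fun y hy => ?_
  rw [norm_mul, Complex.norm_real]
  gcongr
  exact (hC y).trans (mul_le_mul_of_nonneg_left (negWeight_anti (le_of_lt hy)) hC0)

theorem integrableOn_exp_mul (hV : MemL11 V) {u : ℝ → ℂ} (hu : Continuous u) {C : ℝ}
    (hC : ∀ x, ‖u x‖ ≤ C * negWeight x) {k : ℂ} (hk : 0 ≤ k.im) (x : ℝ) :
    IntegrableOn (fun y => cexp (2 * I * k * (y - x : ℝ)) * ((V y : ℂ) * u y)) (Ioi x) := by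
  refine Integrable.bdd_mul (c := 1) (integrableOn_mul_of_norm_le hV hu hC x)
    (by fun_prop : Continuous fun y : ℝ => cexp (2 * I * k * (y - x : ℝ))).aestronglyMeasurable ?_
  refine (ae_restrict_mem measurableSet_Ioi).mono fun y hy => ?_
  exact norm_cexp_two_I_mul_le hk (sub_nonneg.2 (le_of_lt hy))

theorem norm_kernel_mul_le {u : ℝ → ℂ} {C : ℝ} (hC : ∀ x, ‖u x‖ ≤ C * negWeight x) {K : ℂ} {x y : ℝ}
    (hy : x ≤ y) {c : ℝ} (hK : ‖K‖ ≤ c * (y - x)) (hc : 0 ≤ c) :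
    ‖K * ((V y : ℂ) * u y)‖ ≤ c * C * negWeight x * ((1 + |y|) * |V y|) := by
  have hC0 : 0 ≤ C := nonneg_of_mul_nonneg_left ((norm_nonneg _).trans (hC 0)) (negWeight_pos 0)
  rw [norm_mul, norm_mul, Complex.norm_real, Real.norm_eq_abs]
  calc ‖K‖ * (|V y| * ‖u y‖) ≤ c * (y - x) * (|V y| * (C * negWeight y)) := by
        have := mul_nonneg hc (sub_nonneg.2 hy)
        have := (negWeight_pos y).le
        gcongr
        exact hC y
    _ = c * C * |V y| * ((y - x) * negWeight y) := by ring
    _ ≤ c * C * |V y| * (negWeight x * (1 + |y|)) := by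
        exact mul_le_mul_of_nonneg_left (sub_mul_negWeight_le hy) (by positivity)
    _ = _ := by ring

theorem integrableOn_kernel_mul (hV : MemL11 V) {u : ℝ → ℂ} (hu : Continuous u) {C : ℝ}
    (hC : ∀ x, ‖u x‖ ≤ C * negWeight x) {K : ℝ → ℂ} (hK : Continuous K) {c : ℝ} (hc : 0 ≤ c)
    (hKc : ∀ r, 0 ≤ r → ‖K r‖ ≤ c * r) (x : ℝ) :
    IntegrableOn (fun y => K (y - x) * ((V y : ℂ) * u y)) (Ioi x) ∧
    ‖∫ y in Ioi x, K (y - x) * ((V y : ℂ) * u y)‖ ≤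
      c * C * negWeight x * ∫ y, (1 + |y|) * |V y| := by
  have hC0 : 0 ≤ C := nonneg_of_mul_nonneg_left ((norm_nonneg _).trans (hC 0)) (negWeight_pos 0)
  have hb : ∀ y ∈ Ioi x, ‖K (y - x) * ((V y : ℂ) * u y)‖ ≤
      c * C * negWeight x * ((1 + |y|) * |V y|) := fun y hy =>
    norm_kernel_mul_le hC (le_of_lt hy) (hKc _ (sub_nonneg.2 (le_of_lt hy))) hc
  have hi := hV.integrable_weight.const_mul (c * C * negWeight x)
  have hx := (negWeight_pos x).le
  refine ⟨?_, ?_⟩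
  · refine Integrable.mono' hi.integrableOn ?_
      ((ae_restrict_mem measurableSet_Ioi).mono hb)
    exact ((hK.comp (continuous_sub_right x)).aestronglyMeasurable.mul
      ((continuous_ofReal.comp_aestronglyMeasurable hV.aestronglyMeasurable).mul
      hu.aestronglyMeasurable)).restrict
  · refine (norm_integral_le_of_norm_le hi.integrableOn
      ((ae_restrict_mem measurableSet_Ioi).mono hb)).trans ?_
    rw [← integral_const_mul]
    exact setIntegral_le_integral hi (Eventually.of_forall fun y => by positivity)

theorem norm_setIntegral_kernel_le {K : ℝ → ℂ} {c : ℝ} (hK : ∀ r, 0 ≤ r → ‖K r‖ ≤ c * r)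
    {u : ℝ → ℂ} {x : ℝ} (hi : IntegrableOn (fun y => (y - x) * |V y| * ‖u y‖) (Ioi x)) :
    ‖∫ y in Ioi x, K (y - x) * ((V y : ℂ) * u y)‖ ≤
      c * ∫ y in Ioi x, (y - x) * |V y| * ‖u y‖ := by
  rw [← integral_const_mul]
  refine norm_integral_le_of_norm_le (hi.const_mul c)
    ((ae_restrict_mem measurableSet_Ioi).mono fun y hy => ?_)
  rw [norm_mul, norm_mul, Complex.norm_real, Real.norm_eq_abs]
  have := mul_le_mul_of_nonneg_right (hK (y - x) (sub_nonneg.2 (le_of_lt hy)))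
    (by positivity : 0 ≤ |V y| * ‖u y‖)
  linarith

theorem integrableOn_sub_mul_norm (hV : MemL11 V) {u : ℝ → ℂ} (hu : Continuous u) {C : ℝ}
    (hC : ∀ x, ‖u x‖ ≤ C * negWeight x) (x : ℝ) :
    IntegrableOn (fun y => (y - x) * |V y| * ‖u y‖) (Ioi x) := by
  have h := (integrableOn_kernel_mul hV hu hC (K := fun r => (r : ℂ)) (by fun_prop) zero_le_one
    (fun r hr => by simp [abs_of_nonneg hr]) x).1.norm
  refine h.congr ((ae_restrict_mem measurableSet_Ioi).mono fun y hy => ?_)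
  simp only [norm_mul, Complex.norm_real, Real.norm_eq_abs]
  rw [abs_of_nonneg (sub_nonneg.2 (le_of_lt hy)), mul_assoc]

/-- The kernel vanishes at `0`, so its extension by zero to negative arguments is 1-Lipschitz on all
of `ℝ`. The moving domain `(x, ∞)` may thus be replaced by the fixed one `(x₀ - 1, ∞)`, and
differentiation under the integral applies with Lipschitz majorant `|V u|`; no boundary term arises.
-/
theorem hasDerivAt_volterra (hV : MemL11 V) {u : ℝ → ℂ} (hu : Continuous u) {C : ℝ}
    (hC : ∀ x, ‖u x‖ ≤ C * negWeight x) {k : ℂ} (hk : 0 ≤ k.im) (x₀ : ℝ) :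
    HasDerivAt (fun x => ∫ y in Ioi x, volterraKernel k (y - x) * ((V y : ℂ) * u y))
      (-∫ y in Ioi x₀, cexp (2 * I * k * (y - x₀ : ℝ)) * ((V y : ℂ) * u y)) x₀ := by
  set K : ℝ → ℂ := fun r => volterraKernel k (max r 0) with hK
  have hKc : Continuous K := (continuous_volterraKernel k).comp (by fun_prop)
  have hKl : ∀ r r', ‖K r - K r'‖ ≤ |r - r'| := fun r r' =>
    (norm_volterraKernel_sub_le hk (le_max_right _ _) (le_max_right _ _)).trans
      (abs_max_sub_max_le_abs _ _ _)
  have hVu : AEStronglyMeasurable (fun y => (V y : ℂ) * u y) volume :=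
    (continuous_ofReal.comp_aestronglyMeasurable hV.aestronglyMeasurable).mul
      hu.aestronglyMeasurable
  have hint := integrableOn_mul_of_norm_le hV hu hC (x₀ - 1)
  have heq : ∀ x ∈ Ioi (x₀ - 1),
      ∫ y in Ioi (x₀ - 1), K (y - x) * ((V y : ℂ) * u y) =
      ∫ y in Ioi x, volterraKernel k (y - x) * ((V y : ℂ) * u y) := fun x hx => by
    rw [setIntegral_eq_of_subset_of_forall_sdiff_eq_zero measurableSet_Ioi
      (Ioi_subset_Ioi (le_of_lt hx)) (fun y hy => ?_)]
    · refine setIntegral_congr_fun measurableSet_Ioi fun y hy => ?_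
      simp only [hK, max_eq_left (sub_nonneg.2 (mem_Ioi.1 hy).le)]
    · have : y - x ≤ 0 := by simpa using hy.2
      simp [hK, max_eq_right this, volterraKernel_zero]
  have hmain := (hasDerivAt_integral_of_dominated_loc_of_lip
    (μ := volume.restrict (Ioi (x₀ - 1)))
    (F := fun x y => K (y - x) * ((V y : ℂ) * u y))
    (F' := (Ioi x₀).indicator fun y => -(cexp (2 * I * k * (y - x₀ : ℝ)) * ((V y : ℂ) * u y)))
    (x₀ := x₀) (s := univ) (bound := fun y => ‖(V y : ℂ) * u y‖) univ_mem
    (Eventually.of_forall fun x =>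
      ((hKc.comp (continuous_sub_right x)).aestronglyMeasurable.mul hVu).restrict) ?_ ?_ ?_
    hint.norm ?_).2
  · refine HasDerivAt.congr_of_eventuallyEq ?_
      (f := fun x => ∫ y in Ioi (x₀ - 1), K (y - x) * ((V y : ℂ) * u y)) ?_
    · convert hmain using 1
      rw [setIntegral_indicator measurableSet_Ioi, ← integral_neg]
      congr 2
      ext y; simp only [mem_inter_iff, mem_Ioi]; constructor
      · intro h; exact ⟨by linarith, h⟩
      · exact fun h => h.2
    · filter_upwards [Ioi_mem_nhds (sub_one_lt x₀)] with x hx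
      exact (heq x hx).symm
  · have h1 := (integrableOn_kernel_mul hV hu hC hKc zero_le_one (fun r hr => by
      have := hKl r 0
      simpa [hK, volterraKernel_zero, abs_of_nonneg hr] using this) x₀).1
    refine IntegrableOn.of_forall_sdiff_eq_zero h1 measurableSet_Ioi fun y hy => ?_
    have : y - x₀ ≤ 0 := by simpa using hy.2
    simp [hK, max_eq_right this, volterraKernel_zero]
  · refine AEStronglyMeasurable.indicator ?_ measurableSet_Ioi
    exact (((by fun_prop : Continuous fun y : ℝ =>
      cexp (2 * I * k * (y - x₀ : ℝ))).aestronglyMeasurable.mul hVu).neg).restrict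
  · refine Eventually.of_forall fun y => LipschitzOnWith.of_dist_le_mul fun x _ x' _ => ?_
    rw [dist_eq_norm, ← sub_mul, norm_mul, dist_eq_norm, mul_comm]
    have := hKl (y - x) (y - x')
    simp only [Real.coe_nnabs, abs_norm]
    gcongr
    refine this.trans (le_of_eq ?_)
    rw [Real.norm_eq_abs, abs_sub_comm x x']; congr 1; ring
  · have : ∀ᵐ y : ℝ, y ≠ x₀ := by simp [ae_iff, measure_singleton]
    refine ae_restrict_of_ae (this.mono fun y hy => ?_)
    rcases lt_or_gt_of_ne hy with h | h
    · rw [indicator_of_notMem (by simpa using h.le)]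
      refine HasDerivAt.congr_of_eventuallyEq (hasDerivAt_const x₀ (0 : ℂ)) ?_
      filter_upwards [Ioi_mem_nhds h] with x hx
      have : y - x ≤ 0 := sub_nonpos.2 (le_of_lt hx)
      simp [hK, max_eq_right this, volterraKernel_zero]
    · rw [indicator_of_mem (by simpa using h)]
      have h1 : HasDerivAt (fun x : ℝ => volterraKernel k (y - x))
          (-cexp (2 * I * k * (y - x₀ : ℝ))) x₀ := by
        have h2 := (hasDerivAt_volterraKernel k (y - x₀)).scomp x₀
          ((hasDerivAt_id x₀).const_sub y)
        simpa [Function.comp_def] using h2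
      have h3 := h1.mul_const ((V y : ℂ) * u y)
      rw [neg_mul] at h3
      refine h3.congr_of_eventuallyEq ?_
      filter_upwards [Iio_mem_nhds h] with x hx
      simp only [hK, max_eq_left (sub_nonneg.2 (mem_Iio.1 hx).le)]

-- Writing `m = wt * n` with `n` bounded and continuous, the equation becomes a fixed point problem
-- for `n`, and the map is a contraction of ratio `1 / 2` by `integral_sub_mul_volterraWeight_le`.
open BoundedContinuousFunction in
theorem exists_volterra_solution (hV : MemL11 V) {k : ℂ} (hk : 0 ≤ k.im) :
    ∃ m : ℝ → ℂ, Continuous m ∧ (∃ C, ∀ x, ‖m x‖ ≤ C * negWeight x) ∧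
      ∀ x, m x = 1 + ∫ y in Ioi x, volterraKernel k (y - x) * ((V y : ℂ) * m y) := by
  set wt := volterraWeight V with hwt
  have hwt0 : ∀ x, 0 < wt x := volterraWeight_pos V
  have hwtc : Continuous wt := continuous_volterraWeight hV
  have hwC : ∀ x, (wt x : ℂ) ≠ 0 := fun x => ofReal_ne_zero.2 (hwt0 x).ne'
  have hu : ∀ n : ℝ →ᵇ ℂ, Continuous fun y => (wt y : ℂ) * n y := fun n =>
    (continuous_ofReal.comp hwtc).mul n.continuous
  have huC : ∀ n : ℝ →ᵇ ℂ, ∀ x, ‖(wt x : ℂ) * n x‖ ≤ ‖n‖ * volterraConst V * negWeight x := fun n x => by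
    rw [norm_mul, Complex.norm_real, Real.norm_eq_abs, abs_of_pos (hwt0 x)]
    have := mul_le_mul (volterraWeight_le hV x) (n.norm_coe_le_norm x) (norm_nonneg _)
      (mul_nonneg (volterraConst_pos V).le (negWeight_pos x).le)
    calc _ ≤ _ := this
      _ = _ := by ring
  set J : (ℝ →ᵇ ℂ) → ℝ → ℂ := fun n x =>
    ∫ y in Ioi x, volterraKernel k (y - x) * ((V y : ℂ) * ((wt y : ℂ) * n y)) with hJ
  have hJc : ∀ n, Continuous (J n) := fun n => continuous_iff_continuousAt.2 fun x =>
    (hasDerivAt_volterra hV (hu n) (huC n) hk x).continuousAt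
  have hkern : ∀ r : ℝ, 0 ≤ r → ‖volterraKernel k r‖ ≤ 1 * r := fun r hr => by
    rw [one_mul]; exact norm_volterraKernel_le hk hr
  have hJi := fun (n : ℝ →ᵇ ℂ) x => (integrableOn_kernel_mul hV (hu n) (huC n)
    (continuous_volterraKernel k) zero_le_one hkern x).1
  have hJb : ∀ n x, ‖J n x‖ ≤ 1 / 2 * ‖n‖ * wt x := fun n x => by
    refine (norm_setIntegral_kernel_le hkern
      (integrableOn_sub_mul_norm hV (hu n) (huC n) x)).trans ?_
    obtain ⟨h1, h2⟩ := integral_sub_mul_volterraWeight_le hV x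
    have h3 : ∫ y in Ioi x, (y - x) * |V y| * ‖(wt y : ℂ) * n y‖ ≤
        ∫ y in Ioi x, ‖n‖ * ((y - x) * |V y| * wt y) := by
      refine setIntegral_mono_on (integrableOn_sub_mul_norm hV (hu n) (huC n) x) (h1.const_mul _)
        measurableSet_Ioi fun y hy => ?_
      have h4 : 0 ≤ (y - x) * |V y| := mul_nonneg (sub_nonneg.2 (le_of_lt hy)) (abs_nonneg _)
      rw [norm_mul, Complex.norm_real, Real.norm_eq_abs, abs_of_pos (hwt0 y)]
      calc (y - x) * |V y| * (wt y * ‖n y‖) ≤ (y - x) * |V y| * (wt y * ‖n‖) := by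
            have := (hwt0 y).le
            gcongr
            exact n.norm_coe_le_norm y
        _ = _ := by ring
    rw [integral_const_mul] at h3
    have h5 := mul_le_mul_of_nonneg_left h2 (norm_nonneg n)
    linarith
  have hwt1 : ∀ x, 1 ≤ wt x := fun x =>
    (one_le_negWeight x).trans (negWeight_le_volterraWeight V x)
  set Φ : (ℝ →ᵇ ℂ) → (ℝ →ᵇ ℂ) := fun n => BoundedContinuousFunction.ofNormedAddCommGroup
    (fun x => (wt x : ℂ)⁻¹ * (1 + J n x))
    (((continuous_ofReal.comp hwtc).inv₀ hwC).mul (continuous_const.add (hJc n)))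
    (1 + 1 / 2 * ‖n‖) (fun x => by
      rw [norm_mul, norm_inv, Complex.norm_real, Real.norm_eq_abs, abs_of_pos (hwt0 x),
        inv_mul_le_iff₀ (hwt0 x)]
      refine (norm_add_le _ _).trans ?_
      rw [norm_one]
      nlinarith [hJb n x, hwt1 x]) with hΦ
  have hcontr : ContractingWith (1 / 2) Φ := by
    refine ⟨by norm_num, LipschitzWith.of_dist_le_mul fun n n' => ?_⟩
    rw [BoundedContinuousFunction.dist_le (by positivity)]
    intro x
    have h1 : Φ n x - Φ n' x = (wt x : ℂ)⁻¹ * J (n - n') x := by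
      have h2 : J (n - n') x = J n x - J n' x := by
        rw [hJ]
        simp only [BoundedContinuousFunction.coe_sub, Pi.sub_apply]
        rw [← integral_sub (hJi n x) (hJi n' x)]
        refine integral_congr_ae (Eventually.of_forall fun y => ?_)
        simp only; ring
      rw [h2]
      simp only [hΦ, BoundedContinuousFunction.coe_ofNormedAddCommGroup]
      ring
    rw [dist_eq_norm, h1, norm_mul, norm_inv, Complex.norm_real, Real.norm_eq_abs,
      abs_of_pos (hwt0 x), inv_mul_le_iff₀ (hwt0 x), dist_eq_norm]
    refine (hJb _ x).trans (le_of_eq ?_)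
    simp; ring
  set n := ContractingWith.fixedPoint Φ hcontr with hn
  have hfix : Φ n = n := hcontr.fixedPoint_isFixedPt
  refine ⟨fun y => (wt y : ℂ) * n y, hu n, ⟨_, huC n⟩, fun x => ?_⟩
  have h1 : n x = (wt x : ℂ)⁻¹ * (1 + J n x) := by
    conv_lhs => rw [← hfix]
    simp [hΦ]
  change (wt x : ℂ) * n x = 1 + J n x
  rw [h1, ← mul_assoc, mul_inv_cancel₀ (hwC x), one_mul]

/-- The function `m₊(x, k) = e^{-ikx} f₊(x, k)`, for `Im k ≥ 0`. -/
noncomputable def jostM (V : ℝ → ℝ) (k : ℂ) : ℝ → ℂ :=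
  Classical.epsilon fun m : ℝ → ℂ => Continuous m ∧ (∃ C, ∀ x, ‖m x‖ ≤ C * negWeight x) ∧
      ∀ x, m x = 1 + ∫ y in Ioi x, volterraKernel k (y - x) * ((V y : ℂ) * m y)

theorem jostM_spec (hV : MemL11 V) {k : ℂ} (hk : 0 ≤ k.im) :
    Continuous (jostM V k) ∧ (∃ C, ∀ x, ‖jostM V k x‖ ≤ C * negWeight x) ∧
      ∀ x, jostM V k x = 1 + ∫ y in Ioi x, volterraKernel k (y - x) * ((V y : ℂ) * jostM V k y) :=
  Classical.epsilon_spec (exists_volterra_solution hV hk)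

theorem norm_jostM_le (hV : MemL11 V) {k : ℂ} (hk : 0 ≤ k.im) (x : ℝ) :
    ‖jostM V k x‖ ≤ 2 * volterraConst V * negWeight x := by
  obtain ⟨hc, ⟨C, hC⟩, he⟩ := jostM_spec hV hk
  have := volterra_gronwall hV (a := x) zero_le_one (d := jostM V k) (fun y _ => hC y)
    (fun y _ => ?_) x le_rfl
  · simpa using this
  · conv_lhs => rw [he y]
    refine (norm_add_le _ _).trans ?_
    have h1 := norm_setIntegral_kernel_le (c := 1) (fun r hr => by
      rw [one_mul]; exact norm_volterraKernel_le hk hr) (integrableOn_sub_mul_norm hV hc hC y)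
    rw [norm_one]
    have := one_le_negWeight y
    linarith

/-- The `x`-derivative of `jostM`. -/
noncomputable def jostMDeriv (V : ℝ → ℝ) (k : ℂ) (x : ℝ) : ℂ :=
  -∫ y in Ioi x, cexp (2 * I * k * (y - x : ℝ)) * ((V y : ℂ) * jostM V k y)

theorem continuous_jostM (hV : MemL11 V) {k : ℂ} (hk : 0 ≤ k.im) : Continuous (jostM V k) :=
  (jostM_spec hV hk).1

theorem hasDerivAt_jostM (hV : MemL11 V) {k : ℂ} (hk : 0 ≤ k.im) (x : ℝ) :
    HasDerivAt (jostM V k) (jostMDeriv V k x) x := by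
  obtain ⟨hc, ⟨C, hC⟩, he⟩ := jostM_spec hV hk
  have h := (hasDerivAt_volterra hV hc hC hk x).const_add 1
  exact h.congr_of_eventuallyEq (Eventually.of_forall he)

theorem norm_jostMDeriv_le (hV : MemL11 V) {k : ℂ} (hk : 0 ≤ k.im) (x : ℝ) :
    ‖jostMDeriv V k x‖ ≤ 2 * volterraConst V * negWeight x * ∫ y in Ioi x, |V y| := by
  rw [jostMDeriv, norm_neg, ← integral_const_mul]
  refine norm_integral_le_of_norm_le (hV.integrable.abs.integrableOn.const_mul _)
    ((ae_restrict_mem measurableSet_Ioi).mono fun y hy => ?_)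
  rw [norm_mul, norm_mul, Complex.norm_real, Real.norm_eq_abs]
  have h1 := norm_cexp_two_I_mul_le hk (sub_nonneg.2 (le_of_lt hy))
  have h2 := norm_jostM_le hV hk y
  have h3 := mul_le_mul_of_nonneg_left (negWeight_anti (le_of_lt hy))
    (by linarith [volterraConst_pos V] : 0 ≤ 2 * volterraConst V)
  calc _ ≤ 1 * (|V y| * (2 * volterraConst V * negWeight x)) := by
        gcongr; exact h2.trans h3
    _ = _ := by ring

/-- Here the kernel enters through `|k| |kernel| ≤ 1`. This is the high-energy expansion `m₊ = 1 +
O(1/|k|)`, needed for the asymptotics of the Wronskian. -/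
theorem norm_mul_norm_jostM_sub_one_le (hV : MemL11 V) {k : ℂ} (hk : 0 ≤ k.im) (x : ℝ) :
    ‖k‖ * ‖jostM V k x - 1‖ ≤ 2 * volterraConst V * negWeight x * ∫ y in Ioi x, |V y| := by
  obtain ⟨hc, ⟨C, hC⟩, he⟩ := jostM_spec hV hk
  rw [he x, add_sub_cancel_left, ← norm_mul, ← integral_const_mul, ← integral_const_mul]
  refine norm_integral_le_of_norm_le (hV.integrable.abs.integrableOn.const_mul _)
    ((ae_restrict_mem measurableSet_Ioi).mono fun y hy => ?_)
  rw [norm_mul, norm_mul, norm_mul, Complex.norm_real, Real.norm_eq_abs, ← mul_assoc]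
  have h1 := norm_mul_norm_volterraKernel_le hk (sub_nonneg.2 (le_of_lt hy))
  have h2 := norm_jostM_le hV hk y
  have h3 := mul_le_mul_of_nonneg_left (negWeight_anti (le_of_lt hy))
    (by linarith [volterraConst_pos V] : 0 ≤ 2 * volterraConst V)
  calc _ ≤ 1 * (|V y| * (2 * volterraConst V * negWeight x)) := by
        gcongr; exact h2.trans h3
    _ = _ := by ring

theorem norm_jostM_sub_one_le (hV : MemL11 V) {k : ℂ} (hk : 0 ≤ k.im) (x : ℝ) :
    ‖jostM V k x - 1‖ ≤
      2 * volterraConst V * negWeight x * ∫ y in Ioi x, (1 + |y|) * |V y| := by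
  obtain ⟨hc, ⟨C, hC⟩, he⟩ := jostM_spec hV hk
  rw [he x, add_sub_cancel_left, ← integral_const_mul]
  refine norm_integral_le_of_norm_le (hV.integrable_weight.integrableOn.const_mul _)
    ((ae_restrict_mem measurableSet_Ioi).mono fun y hy => ?_)
  have := norm_kernel_mul_le (V := V) (fun z => norm_jostM_le hV hk z) (le_of_lt hy)
    (by rw [one_mul]; exact norm_volterraKernel_le hk (sub_nonneg.2 (le_of_lt hy))) zero_le_one
  rwa [one_mul] at this

/-- Dependence of `jostM` on the spectral parameter. -/
theorem norm_jostM_sub_le (hV : MemL11 V) {k k' : ℂ} (hk : 0 ≤ k.im) (hk' : 0 ≤ k'.im) {a c : ℝ}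
    (hc : 0 ≤ c)
    (hd : ∀ x, a ≤ x → ‖∫ y in Ioi x, (volterraKernel k (y - x) - volterraKernel k' (y - x)) *
      ((V y : ℂ) * jostM V k' y)‖ ≤ c * negWeight x) (x : ℝ) (hx : a ≤ x) :
    ‖jostM V k x - jostM V k' x‖ ≤ 2 * c * volterraConst V * negWeight x := by
  obtain ⟨h1, ⟨C, hC⟩, he⟩ := jostM_spec hV hk
  obtain ⟨h1', ⟨C', hC'⟩, he'⟩ := jostM_spec hV hk'
  have hcd : Continuous fun y => jostM V k y - jostM V k' y := h1.sub h1'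
  have hCd : ∀ y, ‖jostM V k y - jostM V k' y‖ ≤ (C + C') * negWeight y := fun y =>
    (norm_sub_le _ _).trans (by linarith [hC y, hC' y])
  have hkern : ∀ r : ℝ, 0 ≤ r → ‖volterraKernel k r‖ ≤ 1 * r := fun r hr => by
    rw [one_mul]; exact norm_volterraKernel_le hk hr
  have hkern' : ∀ r : ℝ, 0 ≤ r → ‖volterraKernel k' r‖ ≤ 1 * r := fun r hr => by
    rw [one_mul]; exact norm_volterraKernel_le hk' hr
  refine volterra_gronwall hV hc (d := fun y => jostM V k y - jostM V k' y) (fun y _ => hCd y)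
    (fun y hy => ?_) x hx
  have h2 := norm_setIntegral_kernel_le hkern (integrableOn_sub_mul_norm hV hcd hCd y)
  have h3 : jostM V k y - jostM V k' y =
      (∫ z in Ioi y, (volterraKernel k (z - y) - volterraKernel k' (z - y)) *
        ((V z : ℂ) * jostM V k' z)) +
      ∫ z in Ioi y, volterraKernel k (z - y) * ((V z : ℂ) * (jostM V k z - jostM V k' z)) := by
    have i1 := (integrableOn_kernel_mul hV h1 hC (continuous_volterraKernel k) zero_le_one hkern y).1
    have i2 := (integrableOn_kernel_mul hV h1' hC' (continuous_volterraKernel k) zero_le_one hkern y).1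
    have i3 := (integrableOn_kernel_mul hV h1' hC' (continuous_volterraKernel k') zero_le_one hkern' y).1
    have e1 : ∫ z in Ioi y, (volterraKernel k (z - y) - volterraKernel k' (z - y)) *
        ((V z : ℂ) * jostM V k' z) =
        (∫ z in Ioi y, volterraKernel k (z - y) * ((V z : ℂ) * jostM V k' z)) -
        ∫ z in Ioi y, volterraKernel k' (z - y) * ((V z : ℂ) * jostM V k' z) := by
      rw [← integral_sub i2 i3]; simp only [sub_mul]
    have e2 : ∫ z in Ioi y, volterraKernel k (z - y) * ((V z : ℂ) * (jostM V k z - jostM V k' z)) =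
        (∫ z in Ioi y, volterraKernel k (z - y) * ((V z : ℂ) * jostM V k z)) -
        ∫ z in Ioi y, volterraKernel k (z - y) * ((V z : ℂ) * jostM V k' z) := by
      rw [← integral_sub i1 i2]; simp only [mul_sub]
    rw [e1, e2]
    conv_lhs => rw [he y, he' y]
    ring
  have h4 := norm_add_le (∫ z in Ioi y, (volterraKernel k (z - y) - volterraKernel k' (z - y)) *
        ((V z : ℂ) * jostM V k' z))
      (∫ z in Ioi y, volterraKernel k (z - y) * ((V z : ℂ) * (jostM V k z - jostM V k' z)))
  rw [← h3] at h4
  have h5 := hd y hy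
  linarith

/-- The constant in the symbol estimates for `jostM`. -/
noncomputable def jostLipConst (V : ℝ → ℝ) : ℝ :=
  8 * volterraConst V ^ 2 * ∫ y, (1 + |y|) * |V y|

theorem jostLipConst_nonneg (V : ℝ → ℝ) : 0 ≤ jostLipConst V :=
  mul_nonneg (by positivity) (integral_nonneg fun y => by positivity)

/-- Gronwall's inequality with `norm_mul_volterraKernel_sub_le` as source term. The result is
Lipschitz continuity in `log k`, the regularity in `k` on which the oscillatory estimate relies. -/
theorem norm_mul_norm_jostM_sub_le (hV : MemL11 V) {k k' : ℂ} (hk : 0 ≤ k.im) (hk' : 0 ≤ k'.im)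
    (x : ℝ) :
    ‖k‖ * ‖jostM V k x - jostM V k' x‖ ≤ jostLipConst V * negWeight x * ‖k - k'‖ := by
  rcases eq_or_ne k 0 with rfl | h0
  · have := mul_nonneg (mul_nonneg (jostLipConst_nonneg V) (negWeight_pos x).le)
      (norm_nonneg (0 - k'))
    simpa using this
  have hk0 : 0 < ‖k‖ := norm_pos_iff.2 h0
  have hI : 0 ≤ ∫ y, (1 + |y|) * |V y| := integral_nonneg fun y => by positivity
  have hv := volterraConst_pos V
  have h := norm_jostM_sub_le hV hk hk' (a := x)
    (c := 2 * ‖k - k'‖ / ‖k‖ * (2 * volterraConst V) * ∫ y, (1 + |y|) * |V y|) (by positivity)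
    (fun y _ => ?_) x le_rfl
  · calc _ ≤ ‖k‖ * _ := mul_le_mul_of_nonneg_left h hk0.le
      _ = _ := by unfold jostLipConst; field_simp; ring
  · obtain ⟨h1', ⟨C', hC'⟩, he'⟩ := jostM_spec hV hk'
    have h5 := (integrableOn_kernel_mul hV h1' (fun z => norm_jostM_le hV hk' z)
      (K := fun r => volterraKernel k r - volterraKernel k' r)
      ((continuous_volterraKernel k).sub (continuous_volterraKernel k'))
      (c := 2 * ‖k - k'‖ / ‖k‖) (by positivity) (fun r hr => by
        rw [div_mul_eq_mul_div, le_div_iff₀ hk0, mul_comm]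
        exact norm_mul_volterraKernel_sub_le hk hk' hr) y).2
    refine h5.trans (le_of_eq ?_)
    ring

/-- `jostM` is uniformly continuous in `k`, uniformly on right half-lines. -/
theorem jostM_uniform (hV : MemL11 V) (a : ℝ) {ε : ℝ} (hε : 0 < ε) :
    ∃ δ > 0, ∀ k k' : ℂ, 0 ≤ k.im → 0 ≤ k'.im → ‖k - k'‖ < δ → ∀ x, a ≤ x →
      ‖jostM V k x - jostM V k' x‖ ≤ ε := by
  set M := 2 * volterraConst V * negWeight a with hM
  have hM0 : 0 < M := mul_pos (mul_pos two_pos (volterraConst_pos V)) (negWeight_pos a)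
  -- The minimum combines a kernel bound integrable against `V ∈ L¹₁` with one that is small in `t`
  -- but grows too fast in `y`. Dominated convergence then gives `∫ G t → 0` as `t → 0`.
  set G : ℝ → ℝ → ℝ := fun t y => min (2 * |y - a|) (2 * |t| * (y - a) ^ 2) * |V y| * M with hG
  have hb : Integrable (fun y => 2 * ((1 + |a|) * ((1 + |y|) * |V y|)) * M) volume :=
    ((hV.integrable_weight.const_mul (1 + |a|)).const_mul 2).mul_const M
  have hGb : ∀ t y, ‖G t y‖ ≤ 2 * ((1 + |a|) * ((1 + |y|) * |V y|)) * M := fun t y => by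
    have h0 : 0 ≤ min (2 * |y - a|) (2 * |t| * (y - a) ^ 2) := le_min (by positivity) (by positivity)
    rw [Real.norm_eq_abs, abs_of_nonneg (mul_nonneg (mul_nonneg h0 (abs_nonneg _)) hM0.le)]
    have h1 : min (2 * |y - a|) (2 * |t| * (y - a) ^ 2) ≤ 2 * ((1 + |a|) * (1 + |y|)) := by
      refine (min_le_left _ _).trans ?_
      have := abs_sub y a
      nlinarith [abs_nonneg y, abs_nonneg a]
    calc _ ≤ 2 * ((1 + |a|) * (1 + |y|)) * |V y| * M :=
          mul_le_mul_of_nonneg_right (mul_le_mul_of_nonneg_right h1 (abs_nonneg _)) hM0.le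
      _ = _ := by ring
  have hGm : ∀ t, AEStronglyMeasurable (G t) volume := fun t =>
    ((by fun_prop : Continuous fun y : ℝ =>
      min (2 * |y - a|) (2 * |t| * (y - a) ^ 2)).aestronglyMeasurable.mul
      hV.aestronglyMeasurable.norm).mul aestronglyMeasurable_const
  have hlim : Tendsto (fun t => ∫ y, G t y) (𝓝 0) (𝓝 (∫ y, G 0 y)) := by
    refine tendsto_integral_filter_of_dominated_convergence _ (Eventually.of_forall hGm)
      (Eventually.of_forall fun t => Eventually.of_forall (hGb t)) hb
      (Eventually.of_forall fun y => ?_)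
    have : Continuous fun t => G t y := by simp only [hG]; fun_prop
    exact this.tendsto 0
  have hG0 : ∫ y, G 0 y = 0 := by
    rw [← integral_zero ℝ ℝ]
    congr 1; ext y
    simp [hG]
  rw [hG0] at hlim
  have hv := volterraConst_pos V
  have hev := hlim.eventually (gt_mem_nhds
    (show (0 : ℝ) < ε / (2 * volterraConst V * negWeight a) by
      have := negWeight_pos a; positivity))
  obtain ⟨δ, hδ, H⟩ := Metric.eventually_nhds_iff.1 hev
  refine ⟨δ, hδ, fun k k' hk hk' hkk x hx => ?_⟩
  have h1 := H (y := ‖k - k'‖) (by simpa using hkk)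
  have hGn : ∀ t y, 0 ≤ G t y := fun t y =>
    mul_nonneg (mul_nonneg (le_min (by positivity) (by positivity)) (abs_nonneg _)) hM0.le
  have hGi : Integrable (G ‖k - k'‖) := hb.mono' (hGm _) (Eventually.of_forall (hGb _))
  have h2 := norm_jostM_sub_le hV hk hk' (a := a) (c := ∫ y, G ‖k - k'‖ y)
    (integral_nonneg (hGn _)) (fun y hy => ?_) x hx
  · have h3 := negWeight_anti hx
    have h4 := negWeight_pos a
    rw [lt_div_iff₀ (by positivity)] at h1
    have h5 : 0 ≤ ∫ y, G ‖k - k'‖ y := integral_nonneg (hGn _)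
    calc _ ≤ _ := h2
      _ ≤ 2 * (∫ y, G ‖k - k'‖ y) * volterraConst V * negWeight a := by gcongr
      _ ≤ ε := by linarith
  · have h6 : ∀ z ∈ Ioi y, ‖(volterraKernel k (z - y) - volterraKernel k' (z - y)) *
        ((V z : ℂ) * jostM V k' z)‖ ≤ G ‖k - k'‖ z := fun z hz => by
      have hzy : 0 ≤ z - y := sub_nonneg.2 (le_of_lt hz)
      have hza : z - y ≤ z - a := by linarith
      rw [norm_mul, norm_mul, Complex.norm_real, Real.norm_eq_abs, ← mul_assoc]
      simp only [hG]
      have h7 : ‖jostM V k' z‖ ≤ M := (norm_jostM_le hV hk' z).trans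
        (mul_le_mul_of_nonneg_left (negWeight_anti (hy.trans (le_of_lt hz))) (by positivity))
      have h8 : ‖volterraKernel k (z - y) - volterraKernel k' (z - y)‖ ≤
          min (2 * |z - a|) (2 * |‖k - k'‖| * (z - a) ^ 2) := by
        refine le_min ?_ ?_
        · refine (norm_sub_le _ _).trans ?_
          have e1 := norm_volterraKernel_le hk hzy
          have e2 := norm_volterraKernel_le hk' hzy
          have e3 := le_abs_self (z - a)
          linarith
        · refine (norm_volterraKernel_sub_le_sq hk hk' hzy).trans ?_
          rw [abs_norm]
          gcongr
      exact mul_le_mul (mul_le_mul_of_nonneg_right h8 (abs_nonneg _)) h7 (norm_nonneg _)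
        (mul_nonneg (le_min (by positivity) (by positivity)) (abs_nonneg _))
    refine (norm_integral_le_of_norm_le hGi.integrableOn
      ((ae_restrict_mem measurableSet_Ioi).mono h6)).trans ?_
    refine (setIntegral_le_integral hGi (Eventually.of_forall (hGn _))).trans ?_
    exact le_mul_of_one_le_right (integral_nonneg (hGn _)) (one_le_negWeight y)

end Volterra

/-! ### Solutions of the Schrödinger equation and Wronskians -/

/-- `-u'' + V u = z u` with `u' = v`. -/
structure IsSol (V : ℝ → ℝ) (z : ℂ) (u v : ℝ → ℂ) : Prop where
  deriv : ∀ x, HasDerivAt u (v x) x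
  prim : IsPrimitive v fun x => ((V x : ℂ) - z) * u x

/-- The Wronskian of two pairs (function, derivative). -/
def wronskian (u v u' v' : ℝ → ℂ) (x : ℝ) : ℂ := u x * v' x - v x * u' x

section Solutions

open Complex

variable {V : ℝ → ℝ} {z : ℂ} {u v : ℝ → ℂ}

theorem IsSol.continuous (h : IsSol V z u v) : Continuous u :=
  continuous_iff_continuousAt.2 fun x => (h.deriv x).continuousAt

theorem IsSol.isPrimitive (h : IsSol V z u v) : IsPrimitive u v :=
  .of_hasDerivAt h.deriv h.prim.continuous

theorem IsSol.solvesSchrodinger (h : IsSol V z u v) :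
    SolvesSchrodinger V u (fun x => z * u x) := by
  refine ⟨v, h.deriv, fun a b => ?_⟩
  rw [h.prim.2]
  simp only [sub_mul]

theorem IsSol.of_solvesSchrodinger (hV : MemL11 V)
    (h : SolvesSchrodinger V u (fun x => z * u x)) : ∃ v, IsSol V z u v := by
  obtain ⟨v, h1, h2⟩ := h
  have hu : Continuous u := continuous_iff_continuousAt.2 fun x => (h1 x).continuousAt
  refine ⟨v, h1, fun a b => ?_, fun a b => ?_⟩
  · refine IntervalIntegrable.mul_continuousOn ?_ hu.continuousOn
    exact (hV.integrable.ofReal.intervalIntegrable).sub intervalIntegrable_const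
  · rw [h2]; simp only [sub_mul]

theorem IsSol.conj (h : IsSol V z u v) :
    IsSol V (starRingEnd ℂ z) (fun x => starRingEnd ℂ (u x)) (fun x => starRingEnd ℂ (v x)) := by
  refine ⟨fun x => ?_, ?_⟩
  · exact (h.deriv x).star
  · have := h.prim.conj
    simpa using this

theorem IsSol.comp_neg (h : IsSol V z u v) :
    IsSol (fun x => V (-x)) z (fun x => u (-x)) (fun x => -v (-x)) := by
  refine ⟨fun x => ?_, ?_⟩
  · have := (h.deriv (-x)).scomp x (hasDerivAt_neg x)
    simpa [Function.comp_def] using this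
  · have := (h.prim.comp_neg).const_mul (-1)
    simpa using this

theorem IsSol.isPrimitive_wronskian {z' : ℂ} {u' v' : ℝ → ℂ} (h : IsSol V z u v)
    (h' : IsSol V z' u' v') :
    IsPrimitive (wronskian u v u' v') fun x => (z - z') * (u x * u' x) := by
  refine ((h.isPrimitive.mul h'.prim).sub (h.prim.mul h'.isPrimitive)).congr
    (Eventually.of_forall fun x => ?_)
  simp only; ring

theorem IsSol.wronskian_eq {u' v' : ℝ → ℂ} (h : IsSol V z u v) (h' : IsSol V z u' v') (x y : ℝ) :
    wronskian u v u' v' x = wronskian u v u' v' y := by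
  refine IsPrimitive.eq_of_zero ?_ x y
  simpa using h.isPrimitive_wronskian h'

end Solutions

section Jost

open Complex

variable {V : ℝ → ℝ}

/-- The Jost solution `f₊(·, k)` for `Im k ≥ 0`. -/
noncomputable def jostF (V : ℝ → ℝ) (k : ℂ) (x : ℝ) : ℂ := cexp (I * k * x) * jostM V k x

/-- The derivative of `jostF`. -/
noncomputable def jostFDeriv (V : ℝ → ℝ) (k : ℂ) (x : ℝ) : ℂ :=
  cexp (I * k * x) * (I * k * jostM V k x + jostMDeriv V k x)

/-- The reflected potential. -/
def reflect (V : ℝ → ℝ) : ℝ → ℝ := fun x => V (-x)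

theorem reflect_reflect (V : ℝ → ℝ) : reflect (reflect V) = V := by
  ext x; simp [reflect]

theorem MemL11.reflect (hV : MemL11 V) : MemL11 (reflect V) := hV.comp_neg

/-- The Jost solution `f₋(·, k)` for `Im k ≥ 0`. -/
noncomputable def jostG (V : ℝ → ℝ) (k : ℂ) (x : ℝ) : ℂ := jostF (reflect V) k (-x)

/-- The derivative of `jostG`. -/
noncomputable def jostGDeriv (V : ℝ → ℝ) (k : ℂ) (x : ℝ) : ℂ := -jostFDeriv (reflect V) k (-x)

theorem hasDerivAt_cexp_mul (c : ℂ) (x : ℝ) :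
    HasDerivAt (fun x : ℝ => cexp (c * x)) (c * cexp (c * x)) x := by
  have := ((hasDerivAt_id (x : ℂ)).const_mul c).cexp.comp_ofReal
  simpa [mul_comm] using this

theorem isPrimitive_cexp_mul (c : ℂ) :
    IsPrimitive (fun x : ℝ => cexp (c * x)) (fun x => c * cexp (c * x)) :=
  .of_hasDerivAt (hasDerivAt_cexp_mul c) (by fun_prop)

theorem isPrimitive_neg_integral_Ioi {p : ℝ → ℂ} (h : ∀ x, IntegrableOn p (Ioi x)) :
    IsPrimitive (fun x => -∫ y in Ioi x, p y) p := by
  refine ⟨fun a b => ?_, fun a b => ?_⟩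
  · rw [intervalIntegrable_iff]
    exact (h (min a b)).mono_set (by rw [uIoc]; exact Ioc_subset_Ioi_self)
  · rw [← intervalIntegral.integral_Ioi_sub_Ioi' (h a) (h b)]; ring

/-- The factor `e^{2ikx}` moves the dependence on `x` out of the integrand and into the endpoint
alone. In differential form this is `(e^{2ikx} m')' = e^{2ikx} V m`. -/
theorem isPrimitive_jostMDeriv (hV : MemL11 V) {k : ℂ} (hk : 0 ≤ k.im) :
    IsPrimitive (fun x : ℝ => cexp (2 * I * k * x) * jostMDeriv V k x)
      (fun x : ℝ => cexp (2 * I * k * x) * ((V x : ℂ) * jostM V k x)) := by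
  have hint : ∀ x, IntegrableOn (fun y : ℝ => cexp (2 * I * k * y) * ((V y : ℂ) * jostM V k y))
      (Ioi x) := fun x => by
    refine ((integrableOn_exp_mul hV (continuous_jostM hV hk) (norm_jostM_le hV hk) hk x).const_mul
      (cexp (2 * I * k * x))).congr (Eventually.of_forall fun y => ?_)
    simp only
    rw [← mul_assoc, ← Complex.exp_add]
    congr 2; push_cast; ring
  convert isPrimitive_neg_integral_Ioi hint using 2 with x
  rw [jostMDeriv, mul_neg, ← integral_const_mul]
  congr 1
  refine integral_congr_ae (Eventually.of_forall fun y => ?_)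
  simp only
  rw [← mul_assoc, ← Complex.exp_add]
  congr 2; push_cast; ring

theorem isSol_jostF (hV : MemL11 V) {k : ℂ} (hk : 0 ≤ k.im) :
    IsSol V (k ^ 2) (jostF V k) (jostFDeriv V k) := by
  have hd : ∀ x, HasDerivAt (jostF V k) (jostFDeriv V k x) x := fun x => by
    have := (hasDerivAt_cexp_mul (I * k) x).mul (hasDerivAt_jostM hV hk x)
    refine this.congr_deriv ?_
    rw [jostFDeriv]; ring
  refine ⟨hd, ?_⟩
  have hP := isPrimitive_jostMDeriv hV hk
  have he := isPrimitive_cexp_mul (-(I * k))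
  have hprod := he.mul hP
  have hexp : ∀ x : ℝ, cexp (-(I * k) * x) * cexp (2 * I * k * x) = cexp (I * k * x) := fun x => by
    rw [← Complex.exp_add]; congr 1; ring
  have heq : jostFDeriv V k = fun x => I * k * jostF V k x +
      cexp (-(I * k) * x) * (cexp (2 * I * k * x) * jostMDeriv V k x) := by
    ext x; rw [← mul_assoc, hexp, jostFDeriv, jostF]; ring
  have hF : IsPrimitive (jostF V k) (jostFDeriv V k) := by
    refine .of_hasDerivAt hd ?_
    rw [heq]
    exact (continuous_const.mul (continuous_iff_continuousAt.2 fun x => (hd x).continuousAt)).add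
      (he.continuous.mul hP.continuous)
  have := (hF.const_mul (I * k)).add hprod
  rw [← heq] at this
  refine this.congr (Eventually.of_forall fun x => ?_)
  simp only
  have h1 : ∀ c : ℂ, cexp (-(I * k) * x) * (cexp (2 * I * k * x) * c) = cexp (I * k * x) * c :=
    fun c => by rw [← mul_assoc, hexp]
  rw [mul_assoc (-(I * k)), h1, h1, jostFDeriv, jostF]
  have hI : I ^ 2 = -1 := I_sq
  linear_combination cexp (I * k * x) * k ^ 2 * jostM V k x * hI

theorem isSol_jostG (hV : MemL11 V) {k : ℂ} (hk : 0 ≤ k.im) :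
    IsSol V (k ^ 2) (jostG V k) (jostGDeriv V k) := by
  have := (isSol_jostF hV.reflect hk).comp_neg
  rwa [show (fun x => reflect V (-x)) = V from reflect_reflect V] at this

/-- The difference of two solutions satisfies the Gronwall inequality with `c = 0`. -/
theorem volterra_solution_unique (hV : MemL11 V) {k : ℂ} (hk : 0 ≤ k.im) {m : ℝ → ℂ}
    (hc : Continuous m) {C : ℝ} (hC : ∀ x, ‖m x‖ ≤ C * negWeight x)
    (he : ∀ x, m x = 1 + ∫ y in Ioi x, volterraKernel k (y - x) * ((V y : ℂ) * m y)) :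
    m = jostM V k := by
  obtain ⟨h1, -, he'⟩ := jostM_spec hV hk
  have hC' := norm_jostM_le hV hk
  have hkern : ∀ r : ℝ, 0 ≤ r → ‖volterraKernel k r‖ ≤ 1 * r := fun r hr => by
    rw [one_mul]; exact norm_volterraKernel_le hk hr
  ext x
  have hcd : Continuous fun y => m y - jostM V k y := hc.sub h1
  have hCd : ∀ y, ‖m y - jostM V k y‖ ≤ (C + 2 * volterraConst V) * negWeight y := fun y =>
    (norm_sub_le _ _).trans (by linarith [hC y, hC' y])
  have := volterra_gronwall hV le_rfl (a := x) (d := fun y => m y - jostM V k y)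
    (fun y _ => hCd y) (fun y _ => ?_) x le_rfl
  · simp only [mul_zero, zero_mul, norm_le_zero_iff] at this
    exact sub_eq_zero.1 this
  · have h3 : m y - jostM V k y =
        ∫ z in Ioi y, volterraKernel k (z - y) * ((V z : ℂ) * (m z - jostM V k z)) := by
      conv_lhs => rw [he y, he' y]
      rw [add_sub_add_left_eq_sub, ← integral_sub
        (integrableOn_kernel_mul hV hc hC (continuous_volterraKernel k) zero_le_one hkern y).1
        (integrableOn_kernel_mul hV h1 hC' (continuous_volterraKernel k) zero_le_one hkern y).1]
      simp only [mul_sub]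
    simp only [zero_mul, zero_add]
    conv_lhs => rw [h3]
    have := norm_setIntegral_kernel_le hkern (integrableOn_sub_mul_norm hV hcd hCd y)
    rwa [one_mul] at this

theorem volterraKernel_neg_conj (k : ℂ) (r : ℝ) :
    volterraKernel (-starRingEnd ℂ k) r = starRingEnd ℂ (volterraKernel k r) := by
  rw [volterraKernel, volterraKernel, intervalIntegral, intervalIntegral, map_sub, ← integral_conj,
    ← integral_conj]
  simp [← Complex.exp_conj, Complex.conj_ofNat]

/-- The map `k ↦ -conj k` preserves the closed upper half-plane and conjugates the kernel, and `V`
is real, so uniqueness applies. For real `k` this yields `f₊(·, -k) = conj f₊(·, k)`. -/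
theorem jostM_neg_conj (hV : MemL11 V) {k : ℂ} (hk : 0 ≤ k.im) (x : ℝ) :
    jostM V (-starRingEnd ℂ k) x = starRingEnd ℂ (jostM V k x) := by
  obtain ⟨h1, -, he⟩ := jostM_spec hV hk
  have := volterra_solution_unique hV (k := -starRingEnd ℂ k) (by simpa using hk)
    (m := fun x => starRingEnd ℂ (jostM V k x)) (Complex.continuous_conj.comp h1)
    (C := 2 * volterraConst V) (fun x => by simpa using norm_jostM_le hV hk x) (fun x => ?_)
  · exact (congrFun this x).symm
  · rw [he x, map_add, map_one, ← integral_conj]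
    congr 1
    refine integral_congr_ae (Eventually.of_forall fun y => ?_)
    simp only [volterraKernel_neg_conj, map_mul, Complex.conj_ofReal]

theorem jostF_neg_conj (hV : MemL11 V) {k : ℂ} (hk : 0 ≤ k.im) (x : ℝ) :
    jostF V (-starRingEnd ℂ k) x = starRingEnd ℂ (jostF V k x) := by
  rw [jostF, jostM_neg_conj hV hk, jostF, map_mul, ← Complex.exp_conj]
  simp

theorem jostG_neg_conj (hV : MemL11 V) {k : ℂ} (hk : 0 ≤ k.im) (x : ℝ) :
    jostG V (-starRingEnd ℂ k) x = starRingEnd ℂ (jostG V k x) :=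
  jostF_neg_conj hV.reflect hk (-x)

/-! ### Asymptotics -/

theorem tendsto_integral_Ioi_zero {g : ℝ → ℝ} (hg : Integrable g) :
    Tendsto (fun x => ∫ y in Ioi x, g y) atTop (𝓝 0) := by
  have h := intervalIntegral_tendsto_integral_Ioi 0 hg.integrableOn tendsto_id
  have h2 := h.const_sub (∫ y in Ioi 0, g y)
  rw [sub_self] at h2
  exact h2.congr fun x => (integral_Ioi_eq_sub hg x).symm

theorem negWeight_of_nonneg {x : ℝ} (hx : 0 ≤ x) : negWeight x = 1 := by
  simp [negWeight, hx]

theorem tendsto_jostM (hV : MemL11 V) {k : ℂ} (hk : 0 ≤ k.im) :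
    Tendsto (jostM V k) atTop (𝓝 1) := by
  rw [tendsto_iff_norm_sub_tendsto_zero]
  have h0 := (tendsto_integral_Ioi_zero hV.integrable_weight).const_mul (2 * volterraConst V)
  rw [mul_zero] at h0
  refine squeeze_zero' (Eventually.of_forall fun x => norm_nonneg _) ?_ h0
  filter_upwards [eventually_ge_atTop 0] with x hx
  have := norm_jostM_sub_one_le hV hk x
  rwa [negWeight_of_nonneg hx, mul_one] at this

theorem tendsto_jostMDeriv (hV : MemL11 V) {k : ℂ} (hk : 0 ≤ k.im) :
    Tendsto (jostMDeriv V k) atTop (𝓝 0) := by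
  rw [tendsto_zero_iff_norm_tendsto_zero]
  have h0 := (tendsto_integral_Ioi_zero hV.integrable.abs).const_mul (2 * volterraConst V)
  rw [mul_zero] at h0
  refine squeeze_zero' (Eventually.of_forall fun x => norm_nonneg _) ?_ h0
  filter_upwards [eventually_ge_atTop 0] with x hx
  have := norm_jostMDeriv_le hV hk x
  rwa [negWeight_of_nonneg hx, mul_one] at this

theorem norm_cexp_I_mul_real (k x : ℝ) : ‖cexp (I * k * x)‖ = 1 := by
  rw [Complex.norm_exp]; simp

theorem cexp_mul_conj (k x : ℝ) : cexp (I * k * x) * starRingEnd ℂ (cexp (I * k * x)) = 1 := by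
  rw [Complex.mul_conj, Complex.normSq_eq_norm_sq, norm_cexp_I_mul_real]; simp

/-- The Wronskian is constant and is evaluated at `+∞`, where `m₊ → 1` and `m₊' → 0`; the
oscillating factors cancel because they are conjugate of modulus one. -/
theorem wronskian_jostF_conj (hV : MemL11 V) (k x : ℝ) :
    wronskian (jostF V k) (jostFDeriv V k) (fun x => starRingEnd ℂ (jostF V k x))
      (fun x => starRingEnd ℂ (jostFDeriv V k x)) x = -2 * I * k := by
  have hk : 0 ≤ (k : ℂ).im := by simp
  have h1 := isSol_jostF hV hk
  have h2 := h1.conj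
  have hz : starRingEnd ℂ ((k : ℂ) ^ 2) = (k : ℂ) ^ 2 := by simp
  rw [hz] at h2
  have hm := tendsto_jostM hV hk
  have hm' := tendsto_jostMDeriv hV hk
  have hmc := (Complex.continuous_conj.tendsto _).comp hm
  have hmc' := (Complex.continuous_conj.tendsto _).comp hm'
  have hlim : Tendsto (wronskian (jostF V k) (jostFDeriv V k)
      (fun x => starRingEnd ℂ (jostF V k x)) (fun x => starRingEnd ℂ (jostFDeriv V k x))) atTop
      (𝓝 (1 * (-(I * k) * starRingEnd ℂ 1 + starRingEnd ℂ 0) -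
        (I * k * 1 + 0) * starRingEnd ℂ 1)) := by
    refine ((hm.mul ((hmc.const_mul _).add hmc')).sub
      (((hm.const_mul _).add hm').mul hmc)).congr fun y => ?_
    simp only [wronskian, jostF, jostFDeriv, map_mul, map_add, Complex.conj_I, Complex.conj_ofReal,
      Function.comp_apply]
    linear_combination (-(jostM V k y * (-(I * k) * starRingEnd ℂ (jostM V k y) +
      starRingEnd ℂ (jostMDeriv V k y)) - (I * k * jostM V k y + jostMDeriv V k y) *
      starRingEnd ℂ (jostM V k y))) * cexp_mul_conj k y
  have hconst : Tendsto (wronskian (jostF V k) (jostFDeriv V k)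
      (fun x => starRingEnd ℂ (jostF V k x)) (fun x => starRingEnd ℂ (jostFDeriv V k x))) atTop
      (𝓝 (wronskian (jostF V k) (jostFDeriv V k)
      (fun x => starRingEnd ℂ (jostF V k x)) (fun x => starRingEnd ℂ (jostFDeriv V k x)) x)) :=
    tendsto_const_nhds.congr fun y => h1.wronskian_eq h2 x y
  rw [tendsto_nhds_unique hconst hlim]
  simp; ring

theorem wronskian_conj_jostG (hV : MemL11 V) (k x : ℝ) :
    wronskian (fun x => starRingEnd ℂ (jostG V k x)) (fun x => starRingEnd ℂ (jostGDeriv V k x))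
      (jostG V k) (jostGDeriv V k) x = -2 * I * k := by
  rw [← wronskian_jostF_conj hV.reflect k (-x)]
  simp only [wronskian, jostG, jostGDeriv, map_neg]
  ring

/-- The Wronskian `f₊ f₋' - f₊' f₋`. -/
noncomputable def jostW (V : ℝ → ℝ) (k : ℂ) : ℂ :=
  wronskian (jostF V k) (jostFDeriv V k) (jostG V k) (jostGDeriv V k) 0

theorem wronskian_jostF_jostG (hV : MemL11 V) {k : ℂ} (hk : 0 ≤ k.im) (x : ℝ) :
    wronskian (jostF V k) (jostFDeriv V k) (jostG V k) (jostGDeriv V k) x = jostW V k :=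
  (isSol_jostF hV hk).wronskian_eq (isSol_jostG hV hk) x 0

theorem jostW_reflect (V : ℝ → ℝ) (k : ℂ) : jostW (reflect V) k = jostW V k := by
  simp only [jostW, wronskian, jostG, jostGDeriv, reflect_reflect, neg_zero]
  ring

/-- The expansion coefficients of `f₊` in terms of `conj f₋` and `f₋`. -/
theorem exists_scattering (hV : MemL11 V) {k : ℝ} (hk : k ≠ 0) :
    jostW V k ≠ 0 ∧ 2 * |k| ≤ ‖jostW V k‖ ∧
    ∃ R : ℂ, (∀ x, (-2 * I * k / jostW V k) * jostF V k x =
        starRingEnd ℂ (jostG V k x) + R * jostG V k x) ∧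
      ‖-2 * I * k / jostW V k‖ ^ 2 + ‖R‖ ^ 2 = 1 := by
  have hk' : 0 ≤ (k : ℂ).im := by simp
  have hkC : (k : ℂ) ≠ 0 := ofReal_ne_zero.2 hk
  set F := jostF V k
  set F' := jostFDeriv V k
  set G := jostG V k
  set G' := jostGDeriv V k
  set W := jostW V k
  set Gc : ℝ → ℂ := fun x => starRingEnd ℂ (G x)
  set Gc' : ℝ → ℂ := fun x => starRingEnd ℂ (G' x)
  have hsF := isSol_jostF hV hk'
  have hsG := isSol_jostG hV hk'
  have hsGc := hsG.conj
  rw [show starRingEnd ℂ ((k : ℂ) ^ 2) = (k : ℂ) ^ 2 by simp] at hsGc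
  set b := wronskian Gc Gc' F F' 0 with hb
  have hbx : ∀ x, wronskian Gc Gc' F F' x = b := fun x => hsGc.wronskian_eq hsF x 0
  have hWx : ∀ x, wronskian F F' G G' x = W := wronskian_jostF_jostG hV hk'
  have hGG : ∀ x, wronskian Gc Gc' G G' x = -2 * I * k := wronskian_conj_jostG hV k
  have hFF : ∀ x, wronskian F F' (fun x => starRingEnd ℂ (F x)) (fun x => starRingEnd ℂ (F' x)) x =
    -2 * I * k := wronskian_jostF_conj hV k
  -- Three vectors of `ℂ²` satisfy a linear relation whose coefficients are their pairwise
  -- determinants. Applied to the pairs (value, derivative) at `x`, it expands `f₊` in `f₋` and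
  -- `conj f₋` with constant coefficients.
  have e1 : ∀ x, -2 * I * k * F x = b * G x + W * Gc x := fun x => by
    rw [← hGG x, ← hbx x, ← hWx x]; simp only [wronskian]; ring
  have e2 : ∀ x, -2 * I * k * F' x = b * G' x + W * Gc' x := fun x => by
    rw [← hGG x, ← hbx x, ← hWx x]; simp only [wronskian]; ring
  -- Conservation of flux: the expansion is inserted into the Wronskian of `f₊` and `conj f₊`, which
  -- has the same value `-2ik` as that of `conj f₋` and `f₋`.
  have h4 : 4 * k ^ 2 = ‖W‖ ^ 2 - ‖b‖ ^ 2 := by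
    have e1c := congrArg (starRingEnd ℂ) (e1 0)
    have e2c := congrArg (starRingEnd ℂ) (e2 0)
    simp only [map_mul, map_add, map_neg, Complex.conj_I, Complex.conj_ofReal, map_ofNat, Gc, Gc',
      Complex.conj_conj] at e1c e2c
    have h5 := hFF 0
    have h6 := hGG 0
    simp only [wronskian, Gc, Gc'] at h5 h6
    have e10 := e1 0
    have e20 := e2 0
    simp only [Gc, Gc'] at e10 e20
    have h7 : (4 * k ^ 2 : ℂ) * (-2 * I * k) =
        (W * starRingEnd ℂ W - b * starRingEnd ℂ b) * (-2 * I * k) := by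
      conv_rhs => rw [← h6]
      conv_lhs => rw [← h5]
      have : (4 * k ^ 2 : ℂ) * (F 0 * starRingEnd ℂ (F' 0) - F' 0 * starRingEnd ℂ (F 0)) =
          (-2 * I * k * F 0) * (-2 * -I * k * starRingEnd ℂ (F' 0)) -
          (-2 * I * k * F' 0) * (-2 * -I * k * starRingEnd ℂ (F 0)) := by
        linear_combination (4 * k ^ 2 : ℂ) * (F 0 * starRingEnd ℂ (F' 0) -
          F' 0 * starRingEnd ℂ (F 0)) * I_sq
      rw [this, e10, e20, e1c, e2c]; ring
    have h8 := mul_right_cancel₀ (by simp [hkC]) h7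
    rw [Complex.mul_conj, Complex.mul_conj, Complex.normSq_eq_norm_sq,
      Complex.normSq_eq_norm_sq] at h8
    exact_mod_cast h8
  have hWk : 2 * |k| ≤ ‖W‖ := by
    refine abs_le_of_sq_le_sq' ?_ (norm_nonneg _) |>.2
    rw [mul_pow, sq_abs]
    nlinarith [sq_nonneg ‖b‖]
  have hW0 : W ≠ 0 := by
    rw [← norm_pos_iff]
    have : 0 < |k| := abs_pos.2 hk
    linarith
  refine ⟨hW0, hWk, b / W, fun x => ?_, ?_⟩
  · have := e1 x
    field_simp
    linear_combination this
  · have hWn : ‖W‖ ≠ 0 := norm_ne_zero_iff.2 hW0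
    rw [norm_div, norm_div, norm_mul, norm_mul, norm_neg, Complex.norm_I, Complex.norm_real,
      Real.norm_eq_abs, div_pow, div_pow, ← add_div, div_eq_one_iff_eq (by positivity)]
    simp only [RCLike.norm_ofNat, mul_one, mul_pow, sq_abs]
    linarith

end Jost

/-! ### Symbols -/

section Symbols

open Complex

/-- `b` is bounded by `A` and `A`-Lipschitz in the variable `log k`. -/
structure IsSymbol (S : Set ℂ) (A : ℝ) (b : ℂ → ℂ) : Prop where
  bound : ∀ k ∈ S, ‖b k‖ ≤ A
  lip : ∀ k ∈ S, ∀ k' ∈ S, ‖k‖ * ‖b k - b k'‖ ≤ A * ‖k - k'‖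

variable {S : Set ℂ} {A B : ℝ} {a b : ℂ → ℂ}

theorem IsSymbol.mono_set {S' : Set ℂ} (h : IsSymbol S A b) (hS : S' ⊆ S) : IsSymbol S' A b :=
  ⟨fun k hk => h.bound k (hS hk), fun k hk k' hk' => h.lip k (hS hk) k' (hS hk')⟩

theorem IsSymbol.congr (h : IsSymbol S A b) (hab : ∀ k ∈ S, a k = b k) : IsSymbol S A a :=
  ⟨fun k hk => hab k hk ▸ h.bound k hk, fun k hk k' hk' =>
    hab k hk ▸ hab k' hk' ▸ h.lip k hk k' hk'⟩

theorem IsSymbol.add (ha : IsSymbol S A a) (hb : IsSymbol S B b) :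
    IsSymbol S (A + B) fun k => a k + b k := by
  refine ⟨fun k hk => (norm_add_le _ _).trans (add_le_add (ha.bound k hk) (hb.bound k hk)),
    fun k hk k' hk' => ?_⟩
  have h1 := ha.lip k hk k' hk'
  have h2 := hb.lip k hk k' hk'
  have h3 : ‖a k + b k - (a k' + b k')‖ ≤ ‖a k - a k'‖ + ‖b k - b k'‖ := by
    rw [add_sub_add_comm]; exact norm_add_le _ _
  have h4 := mul_le_mul_of_nonneg_left h3 (norm_nonneg k)
  linarith

theorem IsSymbol.mul (ha : IsSymbol S A a) (hb : IsSymbol S B b) :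
    IsSymbol S (2 * A * B) fun k => a k * b k := by
  have key : ∀ k ∈ S, ‖a k‖ * ‖b k‖ ≤ A * B ∧ 0 ≤ A * B := fun k hk => by
    have h := mul_le_mul (ha.bound k hk) (hb.bound k hk) (norm_nonneg _)
      ((norm_nonneg _).trans (ha.bound k hk))
    exact ⟨h, (by positivity : 0 ≤ ‖a k‖ * ‖b k‖).trans h⟩
  refine ⟨fun k hk => ?_, fun k hk k' hk' => ?_⟩
  · obtain ⟨h1, h2⟩ := key k hk
    rw [norm_mul]
    linarith
  · have h1 := ha.lip k hk k' hk'
    have h2 := hb.lip k hk k' hk'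
    have h3 : ‖a k * b k - a k' * b k'‖ ≤ ‖a k‖ * ‖b k - b k'‖ + ‖a k - a k'‖ * ‖b k'‖ := by
      rw [show a k * b k - a k' * b k' = a k * (b k - b k') + (a k - a k') * b k' by ring,
        ← norm_mul, ← norm_mul]
      exact norm_add_le _ _
    have h4 := mul_le_mul_of_nonneg_left h3 (norm_nonneg k)
    have h5 := mul_le_mul (ha.bound k hk) h2 (by positivity)
      ((norm_nonneg _).trans (ha.bound k hk))
    have h6 := mul_le_mul h1 (hb.bound k' hk') (norm_nonneg _)
      ((by positivity : 0 ≤ ‖k‖ * ‖a k - a k'‖).trans h1)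
    nlinarith

theorem IsSymbol.const_mul (ha : IsSymbol S A a) (c : ℂ) :
    IsSymbol S (‖c‖ * A) fun k => c * a k := by
  refine ⟨fun k hk => ?_, fun k hk k' hk' => ?_⟩
  · rw [norm_mul]; exact mul_le_mul_of_nonneg_left (ha.bound k hk) (norm_nonneg _)
  · rw [← mul_sub, norm_mul]
    have := mul_le_mul_of_nonneg_left (ha.lip k hk k' hk') (norm_nonneg c)
    linarith

theorem IsSymbol.conj (ha : IsSymbol S A a) : IsSymbol S A fun k => starRingEnd ℂ (a k) := by
  refine ⟨fun k hk => ?_, fun k hk k' hk' => ?_⟩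
  · simpa using ha.bound k hk
  · rw [← map_sub, RCLike.norm_conj]; exact ha.lip k hk k' hk'

theorem IsSymbol.inv (ha : IsSymbol S A a) {c : ℝ} (hc : 0 < c) (h : ∀ k ∈ S, c ≤ ‖a k‖) :
    IsSymbol S (1 / c + A / c ^ 2) fun k => (a k)⁻¹ := by
  refine ⟨fun k hk => ?_, fun k hk k' hk' => ?_⟩
  · have hA : 0 ≤ A := (norm_nonneg _).trans (ha.bound k hk)
    rw [norm_inv, inv_eq_one_div]
    have := one_div_le_one_div_of_le hc (h k hk)
    have : 0 ≤ A / c ^ 2 := by positivity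
    linarith
  · have hA : 0 ≤ A := (norm_nonneg _).trans (ha.bound k hk)
    have h1 := h k hk
    have h2 := h k' hk'
    have hk0 : a k ≠ 0 := norm_pos_iff.1 (hc.trans_le h1)
    have hk0' : a k' ≠ 0 := norm_pos_iff.1 (hc.trans_le h2)
    rw [inv_sub_inv hk0 hk0', norm_div, norm_mul, norm_sub_rev, ← mul_div_assoc]
    have h3 : c ^ 2 ≤ ‖a k‖ * ‖a k'‖ := by nlinarith
    have h4 := ha.lip k hk k' hk'
    calc _ ≤ A * ‖k - k'‖ / c ^ 2 := by gcongr
      _ = A / c ^ 2 * ‖k - k'‖ := by ring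
      _ ≤ _ := by
        have : 0 ≤ 1 / c * ‖k - k'‖ := by positivity
        linarith

/-- The closed upper half plane. -/
def closedUHP : Set ℂ := {k | 0 ≤ k.im}

/-- The positive half line as a subset of `ℂ`. -/
def posLine : Set ℂ := {k | ∃ r : ℝ, 0 < r ∧ k = r}

theorem posLine_subset : posLine ⊆ closedUHP := by
  rintro k ⟨r, -, rfl⟩; simp [closedUHP]

end Symbols

/-! ### Jost functions and their Wronskian as functions of `k` -/

section Estimates

open Complex

variable {V : ℝ → ℝ}

/-- A constant in the symbol estimates of `jostM` on `[a, ∞)`. -/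
noncomputable def jostConst (V : ℝ → ℝ) (a : ℝ) : ℝ :=
  (2 * volterraConst V + jostLipConst V) * negWeight a

theorem isSymbol_jostM (hV : MemL11 V) {a x : ℝ} (hx : a ≤ x) :
    IsSymbol closedUHP (jostConst V a) fun k => jostM V k x := by
  have h1 := negWeight_anti hx
  have h2 := negWeight_pos x
  have h3 := volterraConst_pos V
  have h4 := jostLipConst_nonneg V
  refine ⟨fun k hk => (norm_jostM_le hV hk x).trans ?_, fun k hk k' hk' =>
    (norm_mul_norm_jostM_sub_le hV hk hk' x).trans ?_⟩
  · unfold jostConst; nlinarith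
  · refine mul_le_mul_of_nonneg_right ?_ (norm_nonneg _)
    unfold jostConst; nlinarith

theorem continuousOn_of_uniform {b : ℂ → ℂ} (h : ∀ ε > 0, ∃ δ > 0, ∀ k k' : ℂ, 0 ≤ k.im →
    0 ≤ k'.im → ‖k - k'‖ < δ → ‖b k - b k'‖ ≤ ε) : ContinuousOn b closedUHP := by
  intro k hk
  rw [ContinuousWithinAt, Metric.tendsto_nhdsWithin_nhds]
  intro ε hε
  obtain ⟨δ, hδ, H⟩ := h (ε / 2) (by positivity)
  refine ⟨δ, hδ, fun k' hk' hd => ?_⟩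
  rw [dist_eq_norm] at hd ⊢
  exact (H k' k hk' hk hd).trans_lt (by linarith)

theorem continuousOn_jostM (hV : MemL11 V) (x : ℝ) :
    ContinuousOn (fun k => jostM V k x) closedUHP :=
  continuousOn_of_uniform fun ε hε => by
    obtain ⟨δ, hδ, H⟩ := jostM_uniform hV x hε
    exact ⟨δ, hδ, fun k k' hk hk' h => H k k' hk hk' h x le_rfl⟩

theorem norm_jostMDeriv_sub_le (hV : MemL11 V) {k k' : ℂ} (hk : 0 ≤ k.im) (hk' : 0 ≤ k'.im)
    {x η : ℝ} (hη : ∀ y, x ≤ y → ‖jostM V k y - jostM V k' y‖ ≤ η) :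
    ‖jostMDeriv V k x - jostMDeriv V k' x‖ ≤
      4 * volterraConst V * negWeight x * (∫ y, (1 + |y|) * |V y|) * ‖k - k'‖ +
        η * ∫ y, |V y| := by
  have hη0 : 0 ≤ η := (norm_nonneg _).trans (hη x le_rfl)
  have i1 := integrableOn_exp_mul hV (continuous_jostM hV hk) (norm_jostM_le hV hk) hk x
  have i2 := integrableOn_exp_mul hV (continuous_jostM hV hk') (norm_jostM_le hV hk') hk' x
  rw [jostMDeriv, jostMDeriv, neg_sub_neg, norm_sub_rev, ← integral_sub i1 i2]
  have hv := volterraConst_pos V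
  have hw := negWeight_pos x
  have j1 := hV.integrable_weight.const_mul (4 * volterraConst V * negWeight x * ‖k - k'‖)
  have j2 := hV.integrable.abs.const_mul η
  refine (norm_integral_le_of_norm_le (j1.add j2).integrableOn
    ((ae_restrict_mem measurableSet_Ioi).mono fun y hy => ?_)).trans
    ((setIntegral_le_integral (j1.add j2) (Eventually.of_forall fun y => ?_)).trans (le_of_eq ?_))
  · have hyx : 0 ≤ y - x := sub_nonneg.2 (le_of_lt hy)
    rw [show cexp (2 * I * k * (y - x : ℝ)) * ((V y : ℂ) * jostM V k y) -
      cexp (2 * I * k' * (y - x : ℝ)) * ((V y : ℂ) * jostM V k' y) =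
      (cexp (2 * I * k * (y - x : ℝ)) - cexp (2 * I * k' * (y - x : ℝ))) *
        ((V y : ℂ) * jostM V k' y) +
      cexp (2 * I * k * (y - x : ℝ)) * ((V y : ℂ) * (jostM V k y - jostM V k' y)) by ring]
    refine (norm_add_le _ _).trans (add_le_add ?_ ?_)
    · have h1 := norm_kernel_mul_le (V := V) (fun z => norm_jostM_le hV hk' z) (le_of_lt hy)
        (c := 2 * ‖k - k'‖) (K := cexp (2 * I * k * (y - x : ℝ)) - cexp (2 * I * k' * (y - x : ℝ)))
        (by have := norm_cexp_sub_le hk hk' hyx; linarith) (by positivity)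
      refine h1.trans (le_of_eq ?_); ring
    · rw [norm_mul, norm_mul, Complex.norm_real, Real.norm_eq_abs]
      have h1 := norm_cexp_two_I_mul_le hk hyx
      calc _ ≤ 1 * (|V y| * η) := by gcongr; exact hη y (le_of_lt hy)
        _ = _ := by ring
  · exact add_nonneg (mul_nonneg (by positivity) (by positivity)) (mul_nonneg hη0 (abs_nonneg _))
  · simp only [Pi.add_apply]
    rw [integral_add j1 j2, integral_const_mul, integral_const_mul]; ring

theorem continuousOn_jostMDeriv (hV : MemL11 V) (x : ℝ) :
    ContinuousOn (fun k => jostMDeriv V k x) closedUHP :=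
  continuousOn_of_uniform fun ε hε => by
    set C₁ := 4 * volterraConst V * negWeight x * ∫ y, (1 + |y|) * |V y| with hC₁
    have hI : 0 ≤ ∫ y, (1 + |y|) * |V y| := integral_nonneg fun y => by positivity
    have hC0 : 0 ≤ C₁ := by
      have := volterraConst_pos V; have := negWeight_pos x; positivity
    set C₂ := ∫ y, |V y|
    have hC2 : 0 ≤ C₂ := integral_nonneg fun y => abs_nonneg _
    obtain ⟨δ, hδ, H⟩ := jostM_uniform hV x (ε := ε / (2 * (C₂ + 1))) (by positivity)
    refine ⟨min δ (ε / (2 * (C₁ + 1))), lt_min hδ (by positivity), fun k k' hk hk' h => ?_⟩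
    have h1 := norm_jostMDeriv_sub_le hV hk hk' (H k k' hk hk' (h.trans_le (min_le_left _ _)))
    have h2 := (h.trans_le (min_le_right _ _)).le
    have h3 : C₁ * ‖k - k'‖ ≤ ε / 2 := by
      calc C₁ * ‖k - k'‖ ≤ (C₁ + 1) * (ε / (2 * (C₁ + 1))) := by gcongr; linarith
        _ = ε / 2 := by field_simp
    have h4 : ε / (2 * (C₂ + 1)) * C₂ ≤ ε / 2 := by
      calc ε / (2 * (C₂ + 1)) * C₂ ≤ ε / (2 * (C₂ + 1)) * (C₂ + 1) := by gcongr; linarith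
        _ = ε / 2 := by field_simp
    linarith

/-- The exponential in `jostMDeriv` is Lipschitz in `k` with a factor `y - x` and no gain of
`1/|k|`, hence the growth `1 + ‖k‖`. In the generic case it is compensated by the lower bound `c (1
+ r)` of the Wronskian in `low_energy`. -/
theorem exists_norm_mul_jostMDeriv_sub_le (hV : MemL11 V) (x : ℝ) :
    ∃ C, 0 ≤ C ∧ ∀ k ∈ closedUHP, ‖jostMDeriv V k x‖ ≤ C ∧ ∀ k' ∈ closedUHP,
      ‖k‖ * ‖jostMDeriv V k x - jostMDeriv V k' x‖ ≤ C * (1 + ‖k‖) * ‖k - k'‖ := by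
  have hI : 0 ≤ ∫ y, (1 + |y|) * |V y| := integral_nonneg fun y => by positivity
  have hI2 : 0 ≤ ∫ y, |V y| := integral_nonneg fun y => by positivity
  have hI3 : 0 ≤ ∫ y in Ioi x, |V y| := integral_nonneg fun y => by positivity
  have hv := volterraConst_pos V
  have hw := negWeight_pos x
  have hl := jostLipConst_nonneg V
  set C₀ := 2 * volterraConst V * negWeight x * ∫ y in Ioi x, |V y|
  set C₁ := 4 * volterraConst V * negWeight x * ∫ y, (1 + |y|) * |V y|
  set C₂ := jostConst V x * ∫ y, |V y|
  have h0 : 0 ≤ C₀ := by positivity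
  have h1 : 0 ≤ C₁ := by positivity
  have h2 : 0 ≤ C₂ := by simp only [C₂, jostConst]; positivity
  refine ⟨C₀ + C₁ + C₂, by positivity, fun k hk => ⟨(norm_jostMDeriv_le hV hk x).trans
    (by linarith), fun k' hk' => ?_⟩⟩
  rcases eq_or_ne k 0 with rfl | hk0
  · simp; positivity
  have hkp : 0 < ‖k‖ := norm_pos_iff.2 hk0
  have h3 := norm_jostMDeriv_sub_le hV hk hk' (x := x) (η := jostConst V x * ‖k - k'‖ / ‖k‖)
    fun y hy => by
      rw [le_div_iff₀ hkp, mul_comm]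
      exact (isSymbol_jostM hV hy).lip k hk k' hk'
  have h4 := mul_le_mul_of_nonneg_left h3 hkp.le
  refine h4.trans ?_
  have h5 : ‖k‖ * (4 * volterraConst V * negWeight x * (∫ y, (1 + |y|) * |V y|) * ‖k - k'‖ +
        jostConst V x * ‖k - k'‖ / ‖k‖ * ∫ y, |V y|) =
      C₁ * ‖k‖ * ‖k - k'‖ + C₂ * ‖k - k'‖ := by
    simp only [C₁, C₂]; field_simp
  rw [h5]
  have h6 : 0 ≤ ‖k - k'‖ := norm_nonneg _
  have h7 : 0 ≤ C₀ * (1 + ‖k‖) * ‖k - k'‖ := by positivity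
  have h8 : 0 ≤ C₁ * ‖k - k'‖ := by positivity
  have h9 : 0 ≤ C₂ * ‖k‖ * ‖k - k'‖ := by positivity
  nlinarith

/-! ### The Wronskian of the Jost solutions as a function of `k` -/

theorem jostW_eq (V : ℝ → ℝ) (k : ℂ) : jostW V k =
    -(2 * I * k * (jostM V k 0 * jostM (reflect V) k 0)) -
      (jostM V k 0 * jostMDeriv (reflect V) k 0 + jostMDeriv V k 0 * jostM (reflect V) k 0) := by
  simp only [jostW, wronskian, jostG, jostGDeriv, jostF, jostFDeriv, neg_zero, ofReal_zero, mul_zero,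
    Complex.exp_zero, one_mul]
  ring

theorem continuousOn_jostW (hV : MemL11 V) : ContinuousOn (jostW V) closedUHP := by
  have h1 := continuousOn_jostM hV 0
  have h2 := continuousOn_jostM hV.reflect 0
  have h3 := continuousOn_jostMDeriv hV 0
  have h4 := continuousOn_jostMDeriv hV.reflect 0
  rw [show jostW V = _ from funext (jostW_eq V)]
  exact ((continuousOn_const.mul continuousOn_id).mul (h1.mul h2)).neg.sub
    ((h1.mul h4).add (h3.mul h2))

/-- High-energy asymptotics `W = -2ik + O(1)`: at `x = 0` both `|k| |m - 1|` and `m'` are bounded.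
-/
theorem exists_norm_jostW_add_le (hV : MemL11 V) :
    ∃ C, ∀ k ∈ closedUHP, ‖jostW V k + 2 * I * k‖ ≤ C := by
  obtain ⟨C₁, hC₁, h1⟩ := exists_norm_mul_jostMDeriv_sub_le hV 0
  obtain ⟨C₂, hC₂, h2⟩ := exists_norm_mul_jostMDeriv_sub_le hV.reflect 0
  have hs1 := isSymbol_jostM hV (le_refl (0 : ℝ))
  have hs2 := isSymbol_jostM hV.reflect (le_refl (0 : ℝ))
  set A₁ := jostConst V 0
  set A₂ := jostConst (reflect V) 0
  set D₁ := 2 * volterraConst V * negWeight 0 * ∫ y in Ioi 0, |V y|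
  set D₂ := 2 * volterraConst (reflect V) * negWeight 0 * ∫ y in Ioi 0, |reflect V y|
  refine ⟨2 * (D₁ * A₂ + D₂) + (A₁ * C₂ + C₁ * A₂), fun k hk => ?_⟩
  have hA1 : 0 ≤ A₁ := (norm_nonneg _).trans (hs1.bound k hk)
  have e : jostW V k + 2 * I * k = -(2 * I * (k * (jostM V k 0 - 1) * jostM (reflect V) k 0 +
      k * (jostM (reflect V) k 0 - 1))) -
      (jostM V k 0 * jostMDeriv (reflect V) k 0 + jostMDeriv V k 0 * jostM (reflect V) k 0) := by
    rw [jostW_eq]; ring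
  rw [e]
  refine (norm_sub_le _ _).trans (add_le_add ?_ ?_)
  · rw [norm_neg, norm_mul, norm_mul, Complex.norm_I, mul_one, RCLike.norm_ofNat]
    refine mul_le_mul_of_nonneg_left ((norm_add_le _ _).trans (add_le_add ?_ ?_)) zero_le_two
    · rw [norm_mul, norm_mul]
      have h3 := norm_mul_norm_jostM_sub_one_le hV hk 0
      exact mul_le_mul h3 (hs2.bound k hk) (norm_nonneg _) ((by positivity :
        0 ≤ ‖k‖ * ‖jostM V k 0 - 1‖).trans h3)
    · rw [norm_mul]; exact norm_mul_norm_jostM_sub_one_le hV.reflect hk 0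
  · refine (norm_add_le _ _).trans (add_le_add ?_ ?_)
    · rw [norm_mul]; exact mul_le_mul (hs1.bound k hk) (h2 k hk).1 (norm_nonneg _) hA1
    · rw [norm_mul]; exact mul_le_mul (h1 k hk).1 (hs2.bound k hk) (norm_nonneg _) hC₁

theorem exists_norm_mul_jostW_sub_le (hV : MemL11 V) :
    ∃ C, 0 ≤ C ∧ ∀ k ∈ closedUHP, ∀ k' ∈ closedUHP,
      ‖k‖ * ‖jostW V k - jostW V k'‖ ≤ C * (1 + ‖k‖) * ‖k - k'‖ := by
  obtain ⟨C₁, hC₁, h1⟩ := exists_norm_mul_jostMDeriv_sub_le hV 0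
  obtain ⟨C₂, hC₂, h2⟩ := exists_norm_mul_jostMDeriv_sub_le hV.reflect 0
  have hs1 := isSymbol_jostM hV (le_refl (0 : ℝ))
  have hs2 := isSymbol_jostM hV.reflect (le_refl (0 : ℝ))
  set A₁ := jostConst V 0
  set A₂ := jostConst (reflect V) 0
  have h0 : (0 : ℂ) ∈ closedUHP := by simp [closedUHP]
  have hA1 : 0 ≤ A₁ := (norm_nonneg _).trans (hs1.bound 0 h0)
  have hA2 : 0 ≤ A₂ := (norm_nonneg _).trans (hs2.bound 0 h0)
  have hs := hs1.mul hs2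
  refine ⟨8 * A₁ * A₂ + 2 * (A₁ * C₂ + C₁ * A₂), by positivity, fun k hk k' hk' => ?_⟩
  have hd : 0 ≤ ‖k - k'‖ := norm_nonneg _
  have hkn : 0 ≤ ‖k‖ := norm_nonneg _
  set m := jostM V k 0
  set n := jostM (reflect V) k 0
  set m' := jostM V k' 0
  set n' := jostM (reflect V) k' 0
  set p := jostMDeriv V k 0
  set q := jostMDeriv (reflect V) k 0
  set p' := jostMDeriv V k' 0
  set q' := jostMDeriv (reflect V) k' 0
  have e : jostW V k - jostW V k' = -(2 * I * (k * (m * n - m' * n'))) -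
      2 * I * ((k - k') * (m' * n')) - m * (q - q') - (m - m') * q' - p * (n - n') -
      (p - p') * n' := by
    rw [jostW_eq, jostW_eq]; ring
  have t1 : ‖k‖ * ‖2 * I * (k * (m * n - m' * n'))‖ ≤ 2 * ‖k‖ * (2 * A₁ * A₂ * ‖k - k'‖) := by
    have := mul_le_mul_of_nonneg_left (hs.lip k hk k' hk') hkn
    simp only [norm_mul, Complex.norm_I, RCLike.norm_ofNat] at this ⊢
    linarith
  have t2 : ‖k‖ * ‖2 * I * ((k - k') * (m' * n'))‖ ≤ 2 * ‖k‖ * (2 * A₁ * A₂ * ‖k - k'‖) := by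
    have := mul_le_mul_of_nonneg_left (hs.bound k' hk') (mul_nonneg hkn hd)
    simp only [norm_mul, Complex.norm_I, RCLike.norm_ofNat] at this ⊢
    linarith
  have t3 : ‖k‖ * ‖m * (q - q')‖ ≤ A₁ * (C₂ * (1 + ‖k‖) * ‖k - k'‖) := by
    have := mul_le_mul (hs1.bound k hk) ((h2 k hk).2 k' hk') (by positivity) hA1
    rw [norm_mul]; linarith
  have t4 : ‖k‖ * ‖(m - m') * q'‖ ≤ A₁ * ‖k - k'‖ * C₂ := by
    have := mul_le_mul (hs1.lip k hk k' hk') (h2 k' hk').1 (by positivity) (by positivity)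
    rw [norm_mul]; linarith
  have t5 : ‖k‖ * ‖p * (n - n')‖ ≤ C₁ * (A₂ * ‖k - k'‖) := by
    have := mul_le_mul (h1 k hk).1 (hs2.lip k hk k' hk') (by positivity) hC₁
    rw [norm_mul]; linarith
  have t6 : ‖k‖ * ‖(p - p') * n'‖ ≤ C₁ * (1 + ‖k‖) * ‖k - k'‖ * A₂ := by
    have := mul_le_mul ((h1 k hk).2 k' hk') (hs2.bound k' hk') (by positivity) (by positivity)
    rw [norm_mul]; linarith
  have t0 : ‖jostW V k - jostW V k'‖ ≤ ‖2 * I * (k * (m * n - m' * n'))‖ +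
      ‖2 * I * ((k - k') * (m' * n'))‖ + ‖m * (q - q')‖ + ‖(m - m') * q'‖ + ‖p * (n - n')‖ +
      ‖(p - p') * n'‖ := by
    rw [e]
    refine (norm_sub_le _ _).trans (add_le_add_left ?_ _)
    refine (norm_sub_le _ _).trans (add_le_add_left ?_ _)
    refine (norm_sub_le _ _).trans (add_le_add_left ?_ _)
    refine (norm_sub_le _ _).trans (add_le_add_left ?_ _)
    refine (norm_sub_le _ _).trans (add_le_add_left ?_ _)
    rw [norm_neg]
  have t7 := mul_le_mul_of_nonneg_left t0 hkn
  have p1 : 0 ≤ A₁ * A₂ * ‖k - k'‖ := by positivity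
  have p2 : 0 ≤ A₁ * C₂ * ‖k‖ * ‖k - k'‖ := by positivity
  have p3 : 0 ≤ C₁ * A₂ * ‖k‖ * ‖k - k'‖ := by positivity
  linarith

/-- For small `k` the bound is assumed, for large `k` the term `-2ik` dominates, and in between
`|W|` attains a positive minimum on a compact half-annulus. -/
theorem exists_le_norm_jostW (hV : MemL11 V)
    (h0 : ∃ c > 0, ∃ δ > 0, ∀ k ∈ closedUHP, k ≠ 0 → ‖k‖ < δ → c * ‖k‖ ≤ ‖jostW V k‖)
    (hW : ∀ k ∈ closedUHP, k ≠ 0 → jostW V k ≠ 0) :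
    ∃ c > 0, ∀ k ∈ closedUHP, c * ‖k‖ ≤ ‖jostW V k‖ := by
  obtain ⟨c, hc, δ, hδ, H⟩ := h0
  obtain ⟨C, hC⟩ := exists_norm_jostW_add_le hV
  set K : Set ℂ := {k | 0 ≤ k.im} ∩ (Metric.closedBall 0 (max C δ) ∩ {k | δ ≤ ‖k‖}) with hK
  have hKc : IsCompact K := by
    refine IsCompact.inter_left ?_ (isClosed_le continuous_const Complex.continuous_im)
    exact (isCompact_closedBall _ _).inter_right (isClosed_le continuous_const continuous_norm)
  have hcont : ContinuousOn (fun k => ‖jostW V k‖) K :=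
    ((continuousOn_jostW hV).mono fun k hk => hk.1).norm
  have hmid : ∃ c' > 0, ∀ k ∈ K, c' ≤ ‖jostW V k‖ := by
    rcases K.eq_empty_or_nonempty with he | hne
    · exact ⟨1, one_pos, fun k hk => by simp [he] at hk⟩
    · obtain ⟨k₀, hk₀, hmin⟩ := hKc.exists_isMinOn hne hcont
      refine ⟨‖jostW V k₀‖, norm_pos_iff.2 (hW k₀ hk₀.1 ?_), fun k hk => hmin hk⟩
      rintro rfl
      have : δ ≤ ‖(0 : ℂ)‖ := hk₀.2.2
      rw [norm_zero] at this
      linarith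
  obtain ⟨c', hc', H'⟩ := hmid
  have hM : 0 < max C δ := lt_max_of_lt_right hδ
  refine ⟨min (min c 1) (c' / max C δ), by positivity, fun k hk => ?_⟩
  rcases eq_or_ne k 0 with rfl | hk0
  · simp
  rcases lt_or_ge ‖k‖ δ with h | h
  · refine le_trans ?_ (H k hk hk0 h)
    gcongr
    exact (min_le_left _ _).trans (min_le_left _ _)
  rcases le_or_gt ‖k‖ (max C δ) with h2 | h2
  · refine le_trans ?_ (H' k ⟨hk, by simpa using h2, h⟩)
    calc _ ≤ c' / max C δ * max C δ := by gcongr; exact min_le_right _ _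
      _ = c' := by field_simp
  · have h3 := norm_sub_le (jostW V k + 2 * I * k) (jostW V k)
    rw [add_sub_cancel_left, norm_mul, norm_mul, Complex.norm_I, RCLike.norm_ofNat, mul_one] at h3
    have h4 := hC k hk
    have h5 := le_max_left C δ
    have h6 : min (min c 1) (c' / max C δ) * ‖k‖ ≤ 1 * ‖k‖ := by
      gcongr; exact (min_le_left _ _).trans (min_le_right _ _)
    linarith

end Estimates

section LowEnergy

open Complex

variable {V : ℝ → ℝ}

/-! ### The zero-energy solution -/

/-- The tail is minus the derivative of `∫_x^∞ (y - x) |V y| dy`, which is the Volterra integral for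
`k = 0` and `u = 1`. That function is decreasing and tends to zero, so its derivative is integrable.
-/
theorem integrableOn_tail (hV : MemL11 V) (a : ℝ) :
    IntegrableOn (fun x => ∫ y in Ioi x, |V y|) (Ioi a) := by
  have hVa : MemL11 fun x => |V x| := by
    have h : Integrable (fun x => |Real.sqrt (1 + x ^ 2) * V x|) volume := Integrable.abs hV
    refine h.congr (Eventually.of_forall fun x => ?_)
    simp only [abs_mul, abs_of_nonneg (Real.sqrt_nonneg _)]
  have hnw : ∀ x, ‖(1 : ℂ)‖ ≤ 1 * negWeight x := fun x => by simpa using one_le_negWeight x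
  have h1 := fun x => hasDerivAt_volterra hVa continuous_const hnw (k := 0) (by simp) x
  set g : ℝ → ℝ := fun x =>
    (∫ y in Ioi x, volterraKernel 0 (y - x) * (((|V y| : ℝ) : ℂ) * 1)).re with hg
  have hd : ∀ x, HasDerivAt g (-∫ y in Ioi x, |V y|) x := fun x => by
    have h2 := Complex.reCLM.hasFDerivAt.comp_hasDerivAt x (h1 x)
    refine h2.congr_deriv ?_
    simp only [mul_zero, zero_mul, Complex.exp_zero, one_mul, mul_one, integral_complex_ofReal]
    simp
  have hkern : ∀ r : ℝ, 0 ≤ r → ‖volterraKernel 0 r‖ ≤ 1 * r := fun r hr => by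
    rw [one_mul]; exact norm_volterraKernel_le (by simp) hr
  have hlim : Tendsto g atTop (𝓝 0) := by
    rw [tendsto_zero_iff_norm_tendsto_zero]
    refine squeeze_zero' (Eventually.of_forall fun x => norm_nonneg _) ?_
      (tendsto_integral_Ioi_zero hV.integrable_weight)
    filter_upwards [eventually_ge_atTop 0] with x hx
    refine (Complex.abs_re_le_norm _).trans ?_
    refine norm_integral_le_of_norm_le hV.integrable_weight.integrableOn
      ((ae_restrict_mem measurableSet_Ioi).mono fun y hy => ?_)
    have := norm_kernel_mul_le (V := fun x => |V x|) hnw (le_of_lt hy)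
      (hkern (y - x) (sub_nonneg.2 (le_of_lt hy))) zero_le_one
    rwa [negWeight_of_nonneg hx, one_mul, one_mul, one_mul, abs_abs] at this
  have h3 := integrableOn_Ioi_deriv_of_nonpos' (a := a) (fun x _ => hd x)
    (fun x _ => neg_nonpos.2 (integral_nonneg fun y => abs_nonneg _)) hlim
  simpa using h3.neg

/-- If two solutions have zero Wronskian they are proportional where one of them does not vanish. -/
theorem exists_eq_const_mul {u v u' v' : ℝ → ℂ} (hu : ∀ x, HasDerivAt u (v x) x)
    (hu' : ∀ x, HasDerivAt u' (v' x) x) (hW : ∀ x, wronskian u v u' v' x = 0) {b : ℝ}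
    (h0 : ∀ x ∈ Iic b, u' x ≠ 0) :
    ∃ c : ℂ, ∀ x ∈ Iic b, u x = c * u' x ∧ v x = c * v' x := by
  have hd : ∀ x ∈ Iic b, HasDerivWithinAt (fun x => u x / u' x) 0 (Iic b) x := fun x hx => by
    refine (((hu x).div (hu' x) (h0 x hx)).congr_deriv ?_).hasDerivWithinAt
    have := hW x
    simp only [wronskian] at this
    rw [div_eq_zero_iff]; left
    linear_combination -this
  have hq : ∀ x ∈ Iic b, u x / u' x = u b / u' b := fun x hx => by
    have := (convex_Iic b).norm_image_sub_le_of_norm_hasDerivWithin_le (C := 0) hd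
      (fun y _ => by simp) self_mem_Iic hx
    simpa [sub_eq_zero] using this
  refine ⟨u b / u' b, fun x hx => ?_⟩
  have h1 := h0 x hx
  rw [← hq x hx]
  refine ⟨by field_simp, ?_⟩
  have := hW x
  simp only [wronskian] at this
  field_simp
  linear_combination -this

/-- The reduced Wronskian of `f₊(·, k)` and a zero-energy solution `φ` bounded at `+∞`. -/
noncomputable def zeroEnergySymbol (V : ℝ → ℝ) (φ φ' : ℝ → ℂ) (l : ℂ) (a : ℝ) (k : ℂ) : ℂ :=
  jostM V k a * φ a - 2 * l + 2 * ∫ x in Ioi a, jostM V k x * φ' x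

theorem integrableOn_jostM_mul (hV : MemL11 V) {a : ℝ} {φ' : ℝ → ℂ} (hi : IntegrableOn φ' (Ioi a))
    {k : ℂ} (hk : k ∈ closedUHP) : IntegrableOn (fun x => jostM V k x * φ' x) (Ioi a) := by
  refine Integrable.bdd_mul (c := jostConst V a) hi
    (continuous_jostM hV hk).aestronglyMeasurable.restrict
    ((ae_restrict_mem measurableSet_Ioi).mono fun x hx => ?_)
  exact (isSymbol_jostM hV (le_of_lt hx)).bound k hk

/-- Let `m` stand for `jostM V k`. Since `φ` has zero energy, `m φ' - m' φ - 2ik m φ` has derivative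
`-2ik m φ'`, with an explicit factor `k`. Integrating from `a` to `+∞`, where the function tends to
`-2ik l`, makes the whole Wronskian divisible by `k`, and only `φ' ∈ L¹` is required. -/
theorem wronskian_zeroEnergy (hV : MemL11 V) {φ φ' : ℝ → ℂ} (hφ : IsSol V 0 φ φ') {l : ℂ}
    (hl : Tendsto φ atTop (𝓝 l)) (hl' : Tendsto φ' atTop (𝓝 0)) {a : ℝ}
    (hi : IntegrableOn φ' (Ioi a)) {k : ℂ} (hk : k ∈ closedUHP) :
    wronskian (jostF V k) (jostFDeriv V k) φ φ' a =
      cexp (I * k * a) * (I * k) * zeroEnergySymbol V φ φ' l a k := by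
  have hF := isSol_jostF hV hk
  have hmc := continuous_jostM hV hk
  have he : ∀ x : ℝ, cexp (-(I * k) * x) * cexp (I * k * x) = 1 := fun x => by
    rw [← Complex.exp_add]; simp
  have hw := (isPrimitive_cexp_mul (-(I * k))).mul (hF.isPrimitive_wronskian hφ)
  have hm : IsPrimitive (jostM V k) (jostMDeriv V k) := by
    have h1 := (isPrimitive_cexp_mul (-(I * k))).mul hF.isPrimitive
    have e1 : (fun x : ℝ => cexp (-(I * k) * x) * jostF V k x) = jostM V k := by
      ext x; rw [jostF, ← mul_assoc, he, one_mul]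
    rw [e1] at h1
    refine h1.congr (Eventually.of_forall fun x => ?_)
    simp only [jostF, jostFDeriv]
    linear_combination (jostMDeriv V k x) * he x
  have hmφ := hm.mul hφ.isPrimitive
  have hS := hw.sub (hmφ.const_mul (I * k))
  have hS' : IsPrimitive (fun x => jostM V k x * φ' x - jostMDeriv V k x * φ x -
      2 * I * k * (jostM V k x * φ x)) (fun x => -(2 * I * k) * (jostM V k x * φ' x)) := by
    have e1 : (fun x : ℝ => cexp (-(I * k) * x) * wronskian (jostF V k) (jostFDeriv V k) φ φ' x -
        I * k * (jostM V k x * φ x)) = fun x => jostM V k x * φ' x - jostMDeriv V k x * φ x -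
      2 * I * k * (jostM V k x * φ x) := by
      ext x
      simp only [wronskian, jostF, jostFDeriv]
      linear_combination (jostM V k x * φ' x - (I * k * jostM V k x + jostMDeriv V k x) * φ x) * he x
    rw [e1] at hS
    refine hS.congr (Eventually.of_forall fun x => ?_)
    simp only [wronskian, jostF, jostFDeriv]
    linear_combination (-(I * k) * (jostM V k x * φ' x - (I * k * jostM V k x + jostMDeriv V k x) *
      φ x) + k ^ 2 * jostM V k x * φ x) * he x + k ^ 2 * jostM V k x * φ x * I_sq
  have hint := integrableOn_jostM_mul hV hi hk
  have l1 : Tendsto (fun b => ∫ x in a..b, -(2 * I * k) * (jostM V k x * φ' x)) atTop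
      (𝓝 (∫ x in Ioi a, -(2 * I * k) * (jostM V k x * φ' x))) :=
    intervalIntegral_tendsto_integral_Ioi a (hint.const_mul _) tendsto_id
  have t1 := tendsto_jostM hV hk
  have t2 := tendsto_jostMDeriv hV hk
  have l2 : Tendsto (fun x => jostM V k x * φ' x - jostMDeriv V k x * φ x -
      2 * I * k * (jostM V k x * φ x)) atTop (𝓝 (1 * 0 - 0 * l - 2 * I * k * (1 * l))) :=
    ((t1.mul hl').sub (t2.mul hl)).sub ((t1.mul hl).const_mul _)
  have l3 := l2.sub_const (jostM V k a * φ' a - jostMDeriv V k a * φ a -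
      2 * I * k * (jostM V k a * φ a))
  have h4 := tendsto_nhds_unique l1 (l3.congr fun b => hS'.2 a b)
  rw [integral_const_mul] at h4
  simp only [wronskian, jostF, jostFDeriv, zeroEnergySymbol]
  linear_combination cexp (I * k * a) * h4

theorem norm_zeroEnergySymbol_sub_le (hV : MemL11 V) {φ φ' : ℝ → ℂ} {l : ℂ} {a : ℝ}
    (hi : IntegrableOn φ' (Ioi a)) {k k' : ℂ} (hk : k ∈ closedUHP) (hk' : k' ∈ closedUHP) {η : ℝ}
    (hη : ∀ x, a ≤ x → ‖jostM V k x - jostM V k' x‖ ≤ η) :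
    ‖zeroEnergySymbol V φ φ' l a k - zeroEnergySymbol V φ φ' l a k'‖ ≤
      η * (‖φ a‖ + 2 * ∫ x in Ioi a, ‖φ' x‖) := by
  have i1 := integrableOn_jostM_mul hV hi hk
  have i2 := integrableOn_jostM_mul hV hi hk'
  have e : zeroEnergySymbol V φ φ' l a k - zeroEnergySymbol V φ φ' l a k' =
      (jostM V k a - jostM V k' a) * φ a +
      2 * ∫ x in Ioi a, (jostM V k x - jostM V k' x) * φ' x := by
    simp only [sub_mul]
    rw [integral_sub i1 i2, zeroEnergySymbol, zeroEnergySymbol]; ring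
  rw [e, mul_add]
  refine (norm_add_le _ _).trans (add_le_add ?_ ?_)
  · rw [norm_mul]; exact mul_le_mul_of_nonneg_right (hη a le_rfl) (norm_nonneg _)
  · rw [norm_mul, RCLike.norm_ofNat, mul_left_comm]
    refine mul_le_mul_of_nonneg_left ?_ zero_le_two
    rw [← integral_const_mul]
    refine norm_integral_le_of_norm_le (hi.norm.const_mul η)
      ((ae_restrict_mem measurableSet_Ioi).mono fun x hx => ?_)
    rw [norm_mul]; exact mul_le_mul_of_nonneg_right (hη x (le_of_lt hx)) (norm_nonneg _)

/-- The expression is affine in `jostM` and involves it only on `[a, ∞)`, against the integrable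
weight `φ'`. The log-Lipschitz bound and the continuity of `jostM`, both uniform on `[a, ∞)`,
therefore carry over. -/
theorem exists_isSymbol_zeroEnergySymbol (hV : MemL11 V) {φ φ' : ℝ → ℂ} (l : ℂ) {a : ℝ}
    (hi : IntegrableOn φ' (Ioi a)) :
    (∃ A, IsSymbol closedUHP A (zeroEnergySymbol V φ φ' l a)) ∧
      ContinuousOn (zeroEnergySymbol V φ φ' l a) closedUHP := by
  set M := ‖φ a‖ + 2 * ∫ x in Ioi a, ‖φ' x‖ with hM
  have hI : 0 ≤ ∫ x in Ioi a, ‖φ' x‖ := integral_nonneg fun x => norm_nonneg _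
  have hM0 : 0 ≤ M := by positivity
  have h0 : (0 : ℂ) ∈ closedUHP := by simp [closedUHP]
  have hJ : 0 ≤ jostConst V a := (norm_nonneg _).trans ((isSymbol_jostM hV le_rfl).bound 0 h0)
  constructor
  · refine ⟨‖zeroEnergySymbol V φ φ' l a 0‖ + 2 * (jostConst V a * M), fun k hk => ?_,
      fun k hk k' hk' => ?_⟩
    · have h1 := norm_zeroEnergySymbol_sub_le hV (φ := φ) (l := l) hi hk h0
        (η := 2 * jostConst V a) fun x hx => (norm_sub_le _ _).trans (by
          have e1 := (isSymbol_jostM hV hx).bound k hk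
          have e2 := (isSymbol_jostM hV hx).bound 0 h0
          linarith)
      have h2 := norm_sub_norm_le (zeroEnergySymbol V φ φ' l a k) (zeroEnergySymbol V φ φ' l a 0)
      linarith
    · rcases eq_or_ne k 0 with rfl | hk0
      · simp; positivity
      have hkp : 0 < ‖k‖ := norm_pos_iff.2 hk0
      have h1 := norm_zeroEnergySymbol_sub_le hV (φ := φ) (l := l) hi hk hk'
        (η := jostConst V a * ‖k - k'‖ / ‖k‖) fun x hx => by
          rw [le_div_iff₀ hkp, mul_comm]
          exact (isSymbol_jostM hV hx).lip k hk k' hk'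
      have h2 := mul_le_mul_of_nonneg_left h1 hkp.le
      refine h2.trans ?_
      rw [show ‖k‖ * (jostConst V a * ‖k - k'‖ / ‖k‖ * M) = jostConst V a * M * ‖k - k'‖ by
        field_simp]
      have h3 := norm_nonneg (zeroEnergySymbol V φ φ' l a 0)
      refine mul_le_mul_of_nonneg_right ?_ (norm_nonneg _)
      have : 0 ≤ jostConst V a * M := by positivity
      linarith
  · refine continuousOn_of_uniform fun ε hε => ?_
    obtain ⟨δ, hδ, H⟩ := jostM_uniform hV a (ε := ε / (M + 1)) (by positivity)
    refine ⟨δ, hδ, fun k k' hk hk' h => (norm_zeroEnergySymbol_sub_le hV hi hk hk'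
      (H k k' hk hk' h)).trans ?_⟩
    calc ε / (M + 1) * M ≤ ε / (M + 1) * (M + 1) := by gcongr; linarith
      _ = ε := by field_simp

theorem integrableOn_jostMDeriv (hV : MemL11 V) {k : ℂ} (hk : k ∈ closedUHP) (a : ℝ) :
    IntegrableOn (jostMDeriv V k) (Ioi a) := by
  have hc : Continuous (jostMDeriv V k) := by
    have h1 := (isPrimitive_jostMDeriv hV hk).continuous
    have h2 : jostMDeriv V k = fun x : ℝ => cexp (-(2 * I * k * x)) *
        (cexp (2 * I * k * x) * jostMDeriv V k x) := by
      ext x; rw [← mul_assoc, ← Complex.exp_add]; simp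
    rw [h2]
    exact (by fun_prop : Continuous fun x : ℝ => cexp (-(2 * I * k * x))).mul h1
  refine Integrable.mono' ((integrableOn_tail hV a).const_mul
    (2 * volterraConst V * negWeight a)) hc.aestronglyMeasurable.restrict
    ((ae_restrict_mem measurableSet_Ioi).mono fun x hx => (norm_jostMDeriv_le hV hk x).trans ?_)
  have h1 := negWeight_anti (le_of_lt hx)
  have h2 := volterraConst_pos V
  have h3 : 0 ≤ ∫ y in Ioi x, |V y| := integral_nonneg fun y => abs_nonneg _
  gcongr

theorem jostF_zero (V : ℝ → ℝ) : jostF V 0 = jostM V 0 := by ext x; simp [jostF]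

theorem jostFDeriv_zero (V : ℝ → ℝ) : jostFDeriv V 0 = jostMDeriv V 0 := by
  ext x; simp [jostFDeriv]

theorem zero_mem_closedUHP : (0 : ℂ) ∈ closedUHP := by simp [closedUHP]

theorem real_mem_closedUHP (k : ℝ) : (k : ℂ) ∈ closedUHP := by simp [closedUHP]

/-- In the exceptional case the Wronskian is `ik` times a symbol. -/
theorem exists_jostW_eq_of_zero (hV : MemL11 V) (h0 : jostW V 0 = 0) :
    ∃ H : ℂ → ℂ, (∃ A, IsSymbol closedUHP A H) ∧ ContinuousOn H closedUHP ∧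
      ∀ k ∈ closedUHP, jostW V k = I * k * H k := by
  set φ := jostF V 0
  set φ' := jostFDeriv V 0
  have hsol : IsSol V 0 φ φ' := by simpa using isSol_jostF hV zero_mem_closedUHP
  have hsolr := hsol.comp_neg
  have hφlim : Tendsto φ atTop (𝓝 1) := by
    simp only [φ, jostF_zero]; exact tendsto_jostM hV zero_mem_closedUHP
  have hφlim' : Tendsto φ' atTop (𝓝 0) := by
    simp only [φ', jostFDeriv_zero]; exact tendsto_jostMDeriv hV zero_mem_closedUHP
  have hGlim : Tendsto (jostM (reflect V) 0) atTop (𝓝 1) :=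
    tendsto_jostM hV.reflect zero_mem_closedUHP
  obtain ⟨b, hb⟩ := eventually_atTop.1 (hGlim.eventually_ne one_ne_zero)
  -- Near `-∞` the solution `f₋(·, 0)` tends to `1` and so does not vanish there. As `W(0) = 0`, `φ`
  -- is a multiple of it, which makes `φ` bounded at both ends with `φ'` integrable.
  obtain ⟨c, hc⟩ := exists_eq_const_mul (isSol_jostF hV zero_mem_closedUHP).deriv
    (isSol_jostG hV zero_mem_closedUHP).deriv (fun x => by
      rw [wronskian_jostF_jostG hV zero_mem_closedUHP, h0]) (b := -b) (fun x hx => by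
      rw [jostG, jostF_zero]
      exact hb _ (by simp only [mem_Iic] at hx; linarith))
  have hr : ∀ x ∈ Ici b, φ (-x) = c * jostM (reflect V) 0 x ∧
      -φ' (-x) = c * jostMDeriv (reflect V) 0 x := fun x hx => by
    obtain ⟨e1, e2⟩ := hc (-x) (by simpa using hx)
    rw [jostG, jostF_zero (reflect V), neg_neg] at e1
    rw [jostGDeriv, jostFDeriv_zero (reflect V), neg_neg] at e2
    exact ⟨e1, by rw [show φ' (-x) = _ from e2]; ring⟩
  -- A base point at which `φ` does not vanish: the final formula for `H` divides by `φ a`.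
  obtain ⟨a, ha⟩ := (hφlim.eventually_ne one_ne_zero).exists
  have hi : IntegrableOn φ' (Ioi a) := by
    simp only [φ', jostFDeriv_zero]; exact integrableOn_jostMDeriv hV zero_mem_closedUHP a
  have hir : IntegrableOn (fun x => -φ' (-x)) (Ioi (-a)) := by
    have h1 : IntegrableOn (fun x => -φ' (-x)) (Ioi b) := by
      refine ((integrableOn_jostMDeriv hV.reflect zero_mem_closedUHP b).const_mul c).congr
        ((ae_restrict_mem measurableSet_Ioi).mono fun x hx => ?_)
      exact (hr x (mem_Ioi.1 hx).le).2.symm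
    have h2 : IntegrableOn (fun x => -φ' (-x)) (Icc (-a) b) :=
      hsolr.prim.continuous.continuousOn.integrableOn_Icc
    refine (h2.union h1).mono_set fun x hx => ?_
    rcases le_or_gt x b with h | h
    · exact Or.inl ⟨le_of_lt hx, h⟩
    · exact Or.inr h
  have hrlim : Tendsto (fun x => φ (-x)) atTop (𝓝 c) := by
    have := hGlim.const_mul c
    rw [mul_one] at this
    refine this.congr' ?_
    filter_upwards [eventually_ge_atTop b] with x hx using (hr x hx).1.symm
  have hrlim' : Tendsto (fun x => -φ' (-x)) atTop (𝓝 0) := by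
    have := (tendsto_jostMDeriv hV.reflect zero_mem_closedUHP).const_mul c
    rw [mul_zero] at this
    refine this.congr' ?_
    filter_upwards [eventually_ge_atTop b] with x hx using (hr x hx).2.symm
  obtain ⟨⟨A, hA⟩, hAc⟩ := exists_isSymbol_zeroEnergySymbol hV (φ := φ) 1 hi
  obtain ⟨⟨B, hB⟩, hBc⟩ := exists_isSymbol_zeroEnergySymbol hV.reflect (φ := fun x => φ (-x)) c hir
  have hsm := isSymbol_jostM hV (le_refl a)
  have hsn := isSymbol_jostM hV.reflect (le_refl (-a))
  refine ⟨fun k => (φ a)⁻¹ * (jostM V k a *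
      zeroEnergySymbol (reflect V) (fun x => φ (-x)) (fun x => -φ' (-x)) c (-a) k +
      jostM (reflect V) k (-a) * zeroEnergySymbol V φ φ' 1 a k),
    ⟨_, ((hsm.mul hB).add (hsn.mul hA)).const_mul _⟩, ?_, fun k hk => ?_⟩
  · exact continuousOn_const.mul (((continuousOn_jostM hV a).mul hBc).add
      ((continuousOn_jostM hV.reflect (-a)).mul hAc))
  · have w1 := wronskian_zeroEnergy hV hsol hφlim hφlim' hi hk
    have w2 := wronskian_zeroEnergy hV.reflect hsolr hrlim hrlim' hir hk
    have w3 := wronskian_jostF_jostG hV hk a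
    set h := zeroEnergySymbol V φ φ' 1 a k
    set hr := zeroEnergySymbol (reflect V) (fun x => φ (-x)) (fun x => -φ' (-x)) c (-a) k
    have e1 : cexp (I * k * a) * cexp (I * k * (-a : ℝ)) = 1 := by
      rw [← Complex.exp_add]; simp
    have e2 : jostW V k * φ a = I * k * (jostM V k a * hr + jostM (reflect V) k (-a) * h) := by
      rw [← w3]
      -- The determinant identity for three vectors of `ℂ²`, with `φ` as the third one, splits `W`
      -- into a Wronskian of `φ` with `f₊` and one with `f₋`. Each of them is `ik` times a symbol.
      have e3 : wronskian (jostF V k) (jostFDeriv V k) (jostG V k) (jostGDeriv V k) a * φ a =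
          jostF V k a * wronskian (jostF (reflect V) k) (jostFDeriv (reflect V) k)
            (fun x => φ (-x)) (fun x => -φ' (-x)) (-a) +
          jostG V k a * wronskian (jostF V k) (jostFDeriv V k) φ φ' a := by
        simp only [wronskian, jostG, jostGDeriv, neg_neg]; ring
      rw [e3, w1, w2, jostG, jostF, jostF]
      linear_combination (I * k * (jostM V k a * hr + jostM (reflect V) k (-a) * h)) * e1
    rw [mul_left_comm, ← e2, mul_comm (jostW V k), inv_mul_cancel_left₀ ha]

/-- Low-energy behaviour of the Wronskian and of the transmission coefficient. -/
theorem low_energy (hV : MemL11 V) :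
    (∃ c > 0, ∃ δ > 0, ∀ k ∈ closedUHP, k ≠ 0 → ‖k‖ < δ → c * ‖k‖ ≤ ‖jostW V k‖) ∧
    ∃ A, IsSymbol posLine A fun k => -2 * I * k / jostW V k := by
  have hreal : ∀ k : ℝ, k ≠ 0 → jostW V k ≠ 0 ∧ 2 * |k| ≤ ‖jostW V k‖ := fun k hk => by
    obtain ⟨h1, h2, -⟩ := exists_scattering hV hk
    exact ⟨h1, h2⟩
  by_cases h0 : jostW V 0 = 0
  · obtain ⟨H, ⟨A, hA⟩, hHc, hH⟩ := exists_jostW_eq_of_zero hV h0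
    -- The flux bound `|W| ≥ 2|k|` becomes a lower bound for `H` on the real line. By continuity it
    -- holds at `0`, and with a smaller constant in a complex neighbourhood of `0`.
    have h2 : ∀ k : ℝ, k ≠ 0 → 2 ≤ ‖H k‖ := fun k hk => by
      have := (hreal k hk).2
      rw [hH k (real_mem_closedUHP k), norm_mul, norm_mul, Complex.norm_I, one_mul, Complex.norm_real,
        Real.norm_eq_abs, mul_comm] at this
      exact le_of_mul_le_mul_left this (abs_pos.2 hk)
    constructor
    · have hlim : Tendsto (fun n : ℕ => ‖H ((1 / ((n : ℝ) + 1) : ℝ) : ℂ)‖) atTop (𝓝 ‖H 0‖) := by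
        refine ((hHc 0 zero_mem_closedUHP).norm.tendsto).comp
          (tendsto_nhdsWithin_iff.2 ⟨?_, Eventually.of_forall fun n => real_mem_closedUHP _⟩)
        have := (Complex.continuous_ofReal.tendsto 0).comp
          (tendsto_one_div_add_atTop_nhds_zero_nat (𝕜 := ℝ))
        simpa [Function.comp_def] using this
      have h3 : 2 ≤ ‖H 0‖ := ge_of_tendsto' hlim fun n => h2 _ (by positivity)
      have h4 : ∀ᶠ k in 𝓝[closedUHP] (0 : ℂ), 1 < ‖H k‖ :=
        (hHc 0 zero_mem_closedUHP).norm.eventually (lt_mem_nhds (by linarith))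
      obtain ⟨δ, hδ, h5⟩ := Metric.mem_nhdsWithin_iff.1 h4
      refine ⟨1, one_pos, δ, hδ, fun k hk _ hkδ => ?_⟩
      have h6 : 1 < ‖H k‖ := h5 ⟨by simpa using hkδ, hk⟩
      rw [hH k hk, norm_mul, norm_mul, Complex.norm_I, one_mul]
      exact le_mul_of_one_le_right (norm_nonneg _) h6.le
    · have h3 := ((hA.mono_set posLine_subset).inv two_pos (by
        rintro k ⟨r, hr, rfl⟩; exact h2 r hr.ne')).const_mul (-2)
      refine ⟨_, h3.congr ?_⟩
      rintro k ⟨r, hr, rfl⟩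
      have hk0 : (r : ℂ) ≠ 0 := ofReal_ne_zero.2 hr.ne'
      have hH0 : H r ≠ 0 := norm_pos_iff.1 (by linarith [h2 r hr.ne'])
      rw [hH r (real_mem_closedUHP r)]
      field_simp
  · have hc0 : 0 < ‖jostW V 0‖ := norm_pos_iff.2 h0
    have h4 : ∀ᶠ k in 𝓝[closedUHP] (0 : ℂ), ‖jostW V 0‖ / 2 < ‖jostW V k‖ :=
      (continuousOn_jostW hV 0 zero_mem_closedUHP).norm.eventually (lt_mem_nhds (by linarith))
    obtain ⟨δ, hδ, h5⟩ := Metric.mem_nhdsWithin_iff.1 h4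
    constructor
    · refine ⟨‖jostW V 0‖ / 2, by positivity, min δ 1, lt_min hδ one_pos, fun k hk _ hkδ => ?_⟩
      have h6 : ‖jostW V 0‖ / 2 < ‖jostW V k‖ :=
        h5 ⟨by simpa using hkδ.trans_le (min_le_left _ _), hk⟩
      have h7 : ‖k‖ ≤ 1 := (hkδ.trans_le (min_le_right _ _)).le
      calc _ ≤ ‖jostW V 0‖ / 2 * 1 := by gcongr
        _ ≤ _ := by linarith
    · obtain ⟨c, hc, hcW⟩ : ∃ c > 0, ∀ r : ℝ, 0 < r → c * (1 + r) ≤ ‖jostW V r‖ := by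
        -- Below `δ` continuity at zero gives `|W| > |W(0)| / 2`, above `δ` the flux bound gives
        -- `|W| ≥ 2r`; each is compared with a multiple of `1 + r`.
        refine ⟨min (‖jostW V 0‖ / (2 * (1 + δ))) (2 * δ / (1 + δ)), by positivity, fun r hr => ?_⟩
        rcases lt_or_ge r δ with h | h
        · have h6 : ‖jostW V 0‖ / 2 < ‖jostW V r‖ :=
            h5 ⟨by simpa [abs_of_pos hr] using h, real_mem_closedUHP r⟩
          calc _ ≤ ‖jostW V 0‖ / (2 * (1 + δ)) * (1 + δ) := by gcongr; exact min_le_left _ _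
            _ = ‖jostW V 0‖ / 2 := by field_simp
            _ ≤ _ := h6.le
        · have h6 := (hreal r hr.ne').2
          rw [abs_of_pos hr] at h6
          refine le_trans ?_ h6
          calc _ ≤ 2 * δ / (1 + δ) * (1 + r) := by gcongr; exact min_le_right _ _
            _ ≤ 2 * r := by
              rw [div_mul_eq_mul_div, div_le_iff₀ (by positivity)]; nlinarith
      obtain ⟨C, hC, hL⟩ := exists_norm_mul_jostW_sub_le hV
      have hsplit : ∀ r r' : ℝ, 0 < r → 0 < r' → ‖(r : ℂ)‖ * ‖-2 * I * r / jostW V r -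
          -2 * I * r' / jostW V r'‖ ≤ (C / c + 1) * ‖(r : ℂ) - r'‖ := fun r r' hr hr' => by
        obtain ⟨a1, a2⟩ := hreal r hr.ne'
        obtain ⟨b1, b2⟩ := hreal r' hr'.ne'
        rw [abs_of_pos hr] at a2
        rw [abs_of_pos hr'] at b2
        have w1 := norm_pos_iff.2 a1
        have w2 := norm_pos_iff.2 b1
        -- The splitting pairs `r'` with `1 / W(r')`, bounded by flux, and leaves the difference of
        -- Wronskians over `W(r)`, where the two factors `1 + r` cancel.
        have e1 : -2 * I * r / jostW V r - -2 * I * r' / jostW V r' =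
            2 * I * (r' * (jostW V r - jostW V r') / (jostW V r * jostW V r') -
              ((r : ℂ) - r') / jostW V r) := by
          field_simp; ring
        have e2 := norm_sub_le (r' * (jostW V r - jostW V r') / (jostW V r * jostW V r'))
          (((r : ℂ) - r') / jostW V r)
        have e3 := hL r (real_mem_closedUHP r) r' (real_mem_closedUHP r')
        have e4 := hcW r hr
        rw [e1]
        simp only [norm_mul, norm_div, Complex.norm_I, RCLike.norm_ofNat, Complex.norm_real,
          Real.norm_eq_abs, abs_of_pos hr, abs_of_pos hr', mul_one] at e2 e3 ⊢
        have d0 : 0 ≤ ‖(r : ℂ) - r'‖ := norm_nonneg _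
        have f1 : r * (2 * (r' * ‖jostW V r - jostW V r'‖ / (‖jostW V r‖ * ‖jostW V r'‖))) ≤
            C / c * ‖(r : ℂ) - r'‖ := by
          calc _ = (2 * r' / ‖jostW V r'‖) * (r * ‖jostW V r - jostW V r'‖ / ‖jostW V r‖) := by
                field_simp
            _ ≤ 1 * (C * (1 + r) * ‖(r : ℂ) - r'‖ / (c * (1 + r))) := by
                gcongr
                rw [div_le_one w2]; exact b2
            _ = _ := by field_simp
        have f2 : r * (2 * (‖(r : ℂ) - r'‖ / ‖jostW V r‖)) ≤ 1 * ‖(r : ℂ) - r'‖ := by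
          rw [show r * (2 * (‖(r : ℂ) - r'‖ / ‖jostW V r‖)) =
            (2 * r / ‖jostW V r‖) * ‖(r : ℂ) - r'‖ by field_simp]
          gcongr
          rw [div_le_one w1]; exact a2
        have e5 := mul_le_mul_of_nonneg_left e2 (by positivity : 0 ≤ r * 2)
        linarith
      refine ⟨C / c + 1, ?_, ?_⟩
      · rintro k ⟨r, hr, rfl⟩
        obtain ⟨-, -, R, -, hR⟩ := exists_scattering hV hr.ne'
        have h7 : ‖-2 * I * r / jostW V r‖ ≤ 1 :=
          (sq_le_one_iff₀ (norm_nonneg _)).1 (by nlinarith [sq_nonneg ‖R‖])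
        have : 0 ≤ C / c := by positivity
        linarith
      · rintro k ⟨r, hr, rfl⟩ k' ⟨r', hr', rfl⟩
        exact hsplit r r' hr hr'

/-! ### Identification of the Jost solutions and of the transmission coefficient -/

theorem isEquivalent_iff_of_norm_one {l : Filter ℝ} {f e : ℝ → ℂ} (he : ∀ x, ‖e x‖ = 1) :
    Asymptotics.IsEquivalent l f e ↔ Tendsto (fun x => f x - e x) l (𝓝 0) := by
  have h1 : Asymptotics.IsEquivalent l f e ↔ (f - e) =o[l] fun _ => (1 : ℝ) := by
    rw [Asymptotics.IsEquivalent, ← Asymptotics.isLittleO_norm_right]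
    simp only [he]
  rw [h1, Asymptotics.isLittleO_one_iff]
  rfl

theorem isJostPlus_jostF (hV : MemL11 V) (k : ℝ) : IsJostPlus V k (jostF V k) := by
  refine ⟨(isSol_jostF hV (real_mem_closedUHP k)).solvesSchrodinger,
    (isEquivalent_iff_of_norm_one (norm_cexp_I_mul_real k)).2 ?_⟩
  have h := (tendsto_iff_norm_sub_tendsto_zero.1 (tendsto_jostM hV (real_mem_closedUHP k)))
  rw [tendsto_zero_iff_norm_tendsto_zero]
  refine h.congr fun x => ?_
  rw [jostF, show cexp (I * k * x) * jostM V k x - cexp (I * k * x) =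
    cexp (I * k * x) * (jostM V k x - 1) by ring, norm_mul, norm_cexp_I_mul_real, one_mul]

/-- In the expansion of `h` in `f₊` and `conj f₊`, the condition at `+∞` says that `(κ - α) + β
e^{-2ikx} → 0`. A shift of `x` by `π / (2k)` reverses the sign of the exponential, so averaging
gives `α = κ`, and then `β = 0`. At `k = 0` the two solutions are no longer independent, whence the
exclusion. -/
theorem isJostPlus_unique (hV : MemL11 V) {k : ℝ} (hk : k ≠ 0) {h : ℝ → ℂ}
    (hh : IsJostPlus V k h) : h = jostF V k := by
  obtain ⟨h1, h2⟩ := hh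
  obtain ⟨v, hv⟩ := IsSol.of_solvesSchrodinger hV h1
  rw [isEquivalent_iff_of_norm_one (norm_cexp_I_mul_real k)] at h2
  have hkC : (k : ℂ) ≠ 0 := ofReal_ne_zero.2 hk
  have hF := isSol_jostF hV (real_mem_closedUHP k)
  have hFc := hF.conj
  rw [show starRingEnd ℂ ((k : ℂ) ^ 2) = (k : ℂ) ^ 2 by simp] at hFc
  set Fc : ℝ → ℂ := fun x => starRingEnd ℂ (jostF V k x)
  set Fc' : ℝ → ℂ := fun x => starRingEnd ℂ (jostFDeriv V k x)
  set κ : ℂ := -2 * I * k with hκ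
  have hκ0 : κ ≠ 0 := by simp [hκ, hkC]
  have hFF : ∀ x, wronskian (jostF V k) (jostFDeriv V k) Fc Fc' x = κ := wronskian_jostF_conj hV k
  set α := wronskian h v Fc Fc' 0
  set β := wronskian h v (jostF V k) (jostFDeriv V k) 0
  have hα : ∀ x, wronskian h v Fc Fc' x = α := fun x => hv.wronskian_eq hFc x 0
  have hβ : ∀ x, wronskian h v (jostF V k) (jostFDeriv V k) x = β := fun x => hv.wronskian_eq hF x 0
  have e : ∀ x, κ * h x = α * jostF V k x - β * Fc x := fun x => by
    rw [← hFF x, ← hα x, ← hβ x]; simp only [wronskian]; ring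
  set E : ℝ → ℂ := fun x => cexp (I * k * x)
  have hE : ∀ x, E x * starRingEnd ℂ (E x) = 1 := fun x => cexp_mul_conj k x
  have hm := tendsto_jostM hV (real_mem_closedUHP k)
  have hmc := (Complex.continuous_conj.tendsto _).comp hm
  have hbd : ∀ g : ℝ → ℂ, Tendsto g atTop (𝓝 0) → ∀ u : ℝ → ℂ, (∀ x, ‖u x‖ = 1) →
      Tendsto (fun x => u x * g x) atTop (𝓝 0) := fun g hg u hu => by
    rw [tendsto_zero_iff_norm_tendsto_zero] at hg ⊢
    exact hg.congr fun x => by rw [norm_mul, hu, one_mul]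
  have hEn : ∀ x, ‖E x‖ = 1 := norm_cexp_I_mul_real k
  have hEcn : ∀ x, ‖starRingEnd ℂ (E x)‖ = 1 := fun x => by rw [RCLike.norm_conj, hEn]
  have l1 : Tendsto (fun x => (κ - α) + β * (starRingEnd ℂ (E x) * starRingEnd ℂ (E x))) atTop
      (𝓝 0) := by
    have t1 := hbd _ h2 _ hEcn
    have t2 := hm.sub_const 1
    rw [sub_self] at t2
    have t3 := hmc.sub_const 1
    rw [map_one, sub_self] at t3
    have t4 := hbd _ t3 (fun x => starRingEnd ℂ (E x) * starRingEnd ℂ (E x)) fun x => by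
      rw [norm_mul, hEcn, one_mul]
    have t5 := ((t2.const_mul α).sub (t4.const_mul β)).sub (t1.const_mul κ)
    simp only [mul_zero, sub_zero] at t5
    refine t5.congr fun x => ?_
    simp only [Function.comp_apply]
    have e1 := e x
    simp only [Fc, jostF, map_mul] at e1
    have hx := hE x
    simp only [E] at hx ⊢
    linear_combination (-starRingEnd ℂ (cexp (I * k * x))) * e1 +
      (κ - α * jostM V k x) * hx
  have hper : ∀ x, starRingEnd ℂ (E (x + Real.pi / (2 * k))) * starRingEnd ℂ (E (x + Real.pi / (2 * k)))
      = -(starRingEnd ℂ (E x) * starRingEnd ℂ (E x)) := fun x => by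
    have : E (x + Real.pi / (2 * k)) * E (x + Real.pi / (2 * k)) = -(E x * E x) := by
      simp only [E]
      rw [← Complex.exp_add, ← Complex.exp_add, ← mul_neg_one, ← Complex.exp_pi_mul_I,
        ← Complex.exp_add]
      congr 1; push_cast; field_simp; ring
    rw [← map_mul, this, map_neg, map_mul]
  have l2 := l1.comp (tendsto_atTop_add_const_right atTop (Real.pi / (2 * k)) tendsto_id)
  have l3 := l1.add l2
  have hα1 : κ - α = 0 := by
    have l4 : Tendsto (fun _ : ℝ => 2 * (κ - α)) atTop (𝓝 (0 + 0)) := l3.congr fun x => by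
      simp only [Function.comp_apply, id, hper]; ring
    have := tendsto_nhds_unique tendsto_const_nhds l4
    simpa using this
  have hβ1 : β = 0 := by
    rw [tendsto_zero_iff_norm_tendsto_zero] at l1
    have l4 : Tendsto (fun _ : ℝ => ‖β‖) atTop (𝓝 0) := l1.congr fun x => by
      rw [hα1, zero_add, norm_mul, norm_mul, hEcn, mul_one, mul_one]
    exact norm_eq_zero.1 (tendsto_nhds_unique tendsto_const_nhds l4)
  ext x
  have := e x
  rw [hβ1, zero_mul, sub_zero, ← sub_eq_zero.1 hα1] at this
  exact mul_left_cancel₀ hκ0 this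

theorem jostPlus_eq (hV : MemL11 V) {k : ℝ} (hk : k ≠ 0) : jostPlus V k = jostF V k :=
  isJostPlus_unique hV hk (Classical.epsilon_spec ⟨_, isJostPlus_jostF hV k⟩)

theorem isJostMinus_iff (hV : MemL11 V) {k : ℝ} {h : ℝ → ℂ} :
    IsJostMinus V k h ↔ IsJostPlus (reflect V) k (fun x => h (-x)) := by
  have hn : ∀ x : ℝ, ‖cexp (-(I * k * x))‖ = 1 := fun x => by
    rw [Complex.norm_exp]; simp
  rw [IsJostMinus, IsJostPlus, isEquivalent_iff_of_norm_one hn,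
    isEquivalent_iff_of_norm_one (norm_cexp_I_mul_real k)]
  refine and_congr ⟨fun h1 => ?_, fun h1 => ?_⟩ ⟨fun h1 => ?_, fun h1 => ?_⟩
  · obtain ⟨v, hv⟩ := IsSol.of_solvesSchrodinger hV h1
    exact hv.comp_neg.solvesSchrodinger
  · obtain ⟨v, hv⟩ := IsSol.of_solvesSchrodinger hV.reflect h1
    have := hv.comp_neg.solvesSchrodinger
    simp only [neg_neg] at this
    rwa [show (fun x => reflect V (-x)) = V from reflect_reflect V] at this
  · refine (h1.comp tendsto_neg_atTop_atBot).congr fun x => ?_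
    simp
  · refine (h1.comp tendsto_neg_atBot_atTop).congr fun x => ?_
    simp

theorem jostMinus_eq (hV : MemL11 V) {k : ℝ} (hk : k ≠ 0) : jostMinus V k = jostG V k := by
  have hex : ∃ h, IsJostMinus V k h := ⟨jostG V k, (isJostMinus_iff hV).2 (by
    simp only [jostG, neg_neg]; exact isJostPlus_jostF hV.reflect k)⟩
  have h1 := (isJostMinus_iff hV).1 (Classical.epsilon_spec hex)
  have h2 := isJostPlus_unique hV.reflect hk h1
  ext x
  have := congrFun h2 (-x)
  rw [neg_neg] at this
  exact this

/-- Since `W ≠ 0`, `f₊` and `f₋` are linearly independent, so the coefficients in the defining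
relation are unique and the chosen value is the one from `exists_scattering`. -/
theorem transmission_eq (hV : MemL11 V) {k : ℝ} (hk : k ≠ 0) :
    transmission V k = -2 * I * k / jostW V k := by
  obtain ⟨hW, -, R, hR, -⟩ := exists_scattering hV hk
  have hG : ∀ x, jostMinus V (-k) x = starRingEnd ℂ (jostG V k x) := fun x => by
    rw [jostMinus_eq hV (neg_ne_zero.2 hk), ← jostG_neg_conj hV (real_mem_closedUHP k)]
    simp
  have hspec : ∃ R' : ℂ, ∀ x : ℝ, transmission V k * jostPlus V k x =
      jostMinus V (-k) x + R' * jostMinus V k x :=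
    Classical.epsilon_spec (p := fun T : ℂ => ∃ R : ℂ, ∀ x : ℝ,
      T * jostPlus V k x = jostMinus V (-k) x + R * jostMinus V k x)
      ⟨_, R, fun x => by rw [jostPlus_eq hV hk, hG, jostMinus_eq hV hk]; exact hR x⟩
  obtain ⟨R', hR'⟩ := hspec
  rw [jostPlus_eq hV hk, jostMinus_eq hV hk] at hR'
  set T := -2 * I * k / jostW V k
  have h1 : ∀ x, (transmission V k - T) * jostF V k x = (R' - R) * jostG V k x := fun x => by
    have a1 := hR' x
    have a2 := hR x
    rw [hG] at a1
    linear_combination a1 - a2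
  have h2 : (transmission V k - T) * jostFDeriv V k 0 = (R' - R) * jostGDeriv V k 0 := by
    have d1 := ((isSol_jostF hV (real_mem_closedUHP k)).deriv 0).const_mul (transmission V k - T)
    have d2 := ((isSol_jostG hV (real_mem_closedUHP k)).deriv 0).const_mul (R' - R)
    exact d1.unique (d2.congr_of_eventuallyEq (Eventually.of_forall h1))
  have h3 : (transmission V k - T) * jostW V k = 0 := by
    rw [jostW, wronskian]
    linear_combination (jostGDeriv V k 0) * h1 0 - jostG V k 0 * h2
  rcases mul_eq_zero.1 h3 with h | h
  · exact sub_eq_zero.1 h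
  · exact absurd h hW

end LowEnergy

/-! ### Oscillatory integrals -/

section Oscillatory

open Complex

theorem integral_inv_sq_le {τ k₀ α β : ℝ} (hτ : 0 < τ) (hαβ : α ≤ β)
    (h : k₀ + τ ≤ α ∨ β ≤ k₀ - τ) :
    IntervalIntegrable (fun k : ℝ => ((k - k₀) ^ 2)⁻¹) volume α β ∧
      ∫ k in α..β, ((k - k₀) ^ 2)⁻¹ ≤ τ⁻¹ := by
  have h0 : ∀ k ∈ Icc α β, k - k₀ ≠ 0 := fun k hk => by
    rcases h with h | h
    · have := hk.1; intro h'; linarith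
    · have := hk.2; intro h'; linarith
  have hd : ∀ k ∈ uIcc α β, HasDerivAt (fun k => -(k - k₀)⁻¹) (((k - k₀) ^ 2)⁻¹) k := fun k hk => by
    rw [uIcc_of_le hαβ] at hk
    have := ((hasDerivAt_id k).sub_const k₀).fun_inv (h0 k hk) |>.fun_neg
    refine this.congr_deriv ?_
    simp only [id]
    rw [neg_div, neg_neg, one_div]
  have hi : IntervalIntegrable (fun k : ℝ => ((k - k₀) ^ 2)⁻¹) volume α β := by
    refine ContinuousOn.intervalIntegrable ?_
    rw [uIcc_of_le hαβ]
    exact ContinuousOn.inv₀ (by fun_prop) fun k hk => pow_ne_zero 2 (h0 k hk)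
  refine ⟨hi, ?_⟩
  rw [intervalIntegral.integral_eq_sub_of_hasDerivAt hd hi]
  rcases h with h | h
  · have h1 : 0 ≤ (β - k₀)⁻¹ := inv_nonneg.2 (by linarith)
    have h2 : (α - k₀)⁻¹ ≤ τ⁻¹ := inv_anti₀ hτ (by linarith)
    linarith
  · have h1 : (α - k₀)⁻¹ ≤ 0 := inv_nonpos.2 (by linarith)
    have h2 : (k₀ - β)⁻¹ ≤ τ⁻¹ := inv_anti₀ hτ (by linarith)
    rw [← neg_sub k₀ β, inv_neg]
    linarith

variable {A M D : ℝ} {b : ℂ → ℂ} {G g : ℝ → ℂ}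

theorem real_mem_posLine {k : ℝ} (hk : 0 < k) : (k : ℂ) ∈ posLine := ⟨k, hk, rfl⟩

theorem IsSymbol.norm_sub_le (hb : IsSymbol posLine A b) {k k' : ℝ} (hk : 0 < k) (hk' : 0 < k') :
    ‖b k - b k'‖ ≤ A / k * |k - k'| := by
  have := hb.lip k (real_mem_posLine hk) k' (real_mem_posLine hk')
  rw [Complex.norm_real, Real.norm_eq_abs, abs_of_pos hk, ← ofReal_sub, Complex.norm_real,
    Real.norm_eq_abs] at this
  rw [div_mul_eq_mul_div, le_div_iff₀ hk]
  linarith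

theorem IsSymbol.nonneg (hb : IsSymbol posLine A b) : 0 ≤ A :=
  (norm_nonneg _).trans (hb.bound _ (real_mem_posLine one_pos))

theorem IsSymbol.lipschitzOnWith (hb : IsSymbol posLine A b) {α β : ℝ} (hα : 0 < α) :
    LipschitzOnWith (Real.toNNReal (A / α)) (fun k : ℝ => b k) (Icc α β) := by
  have hA := hb.nonneg
  refine LipschitzOnWith.of_dist_le_mul fun k hk k' hk' => ?_
  rw [dist_eq_norm, Real.dist_eq, Real.coe_toNNReal _ (by positivity)]
  refine (hb.norm_sub_le (hα.trans_le hk.1) (hα.trans_le hk'.1)).trans ?_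
  have := hk.1
  gcongr

theorem IsSymbol.continuousOn (hb : IsSymbol posLine A b) :
    ContinuousOn (fun k : ℝ => b k) (Ioi 0) := by
  intro k hk
  have hk' : (0 : ℝ) < k := hk
  have h := (hb.lipschitzOnWith (half_pos hk') (β := k + 1)).continuousOn k
    ⟨by linarith, by linarith⟩
  exact (h.continuousAt (Icc_mem_nhds (by linarith) (by linarith))).continuousWithinAt

theorem IsSymbol.intervalIntegrable (hb : IsSymbol posLine A b) {e : ℝ → ℂ} (he : Continuous e)
    {N : ℝ} (hN : 0 ≤ N) : IntervalIntegrable (fun k : ℝ => b k * e k) volume 0 N := by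
  rw [intervalIntegrable_iff_integrableOn_Ioc_of_le hN]
  have h1 : IntegrableOn e (Ioc 0 N) := (he.intervalIntegrable 0 N).1
  refine Integrable.bdd_mul (c := A) h1 ?_ ?_
  · exact (hb.continuousOn.mono Ioc_subset_Ioi_self).aestronglyMeasurable measurableSet_Ioc
  · exact (ae_restrict_mem measurableSet_Ioc).mono fun k hk => hb.bound _ (real_mem_posLine hk.1)

/-- One integration by parts against `1 / (2it (k - k₀))`, where `t = τ⁻²`. Each boundary term is at
most `A M τ / 2`. In the remainder, `1 / (k |k - k₀|)` is bounded by the mean of the two inverse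
squares, each of integral at most `1/τ`, and the term with `g` is treated by a weighted Young
inequality. -/
theorem norm_oscillatory_integral_nonstationary (hb : IsSymbol posLine A b) (hG : IsPrimitive G g)
    (hM : ∀ k, ‖G k‖ ≤ M) (hg : MemLp g 2 volume) (hD : 0 < D) (hgD : ∫ k, ‖g k‖ ^ 2 ≤ D ^ 2)
    {τ k₀ α β : ℝ} (hτ : 0 < τ) (hα : τ ≤ α) (hαβ : α ≤ β) (h : k₀ + τ ≤ α ∨ β ≤ k₀ - τ) :
    ‖∫ k in α..β, b k * (cexp (I * ((k ^ 2 - 2 * k₀ * k) / τ ^ 2 : ℝ)) * G k)‖ ≤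
      A * (2 * (M * τ) + D * (τ * Real.sqrt τ)) := by
  have hA := hb.nonneg
  have hM0 : 0 ≤ M := (norm_nonneg _).trans (hM 0)
  have hα0 : 0 < α := hτ.trans_le hα
  have hs : ∀ k ∈ Icc α β, τ ≤ |k - k₀| := fun k hk => by
    rcases h with h | h
    · exact (le_abs_self _).trans' (by linarith [hk.1])
    · exact (neg_le_abs _).trans' (by linarith [hk.2])
  have hs0 : ∀ k ∈ Icc α β, ((k : ℂ) - k₀) ≠ 0 := fun k hk => by
    have := hs k hk
    rw [← ofReal_sub, ofReal_ne_zero]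
    intro h'
    rw [h', abs_zero] at this
    linarith
  set t : ℝ := (τ ^ 2)⁻¹ with ht
  have ht0 : 0 < t := by positivity
  have htC : (t : ℂ) ≠ 0 := ofReal_ne_zero.2 ht0.ne'
  set e : ℝ → ℂ := fun k => cexp (I * ((k ^ 2 - 2 * k₀ * k) / τ ^ 2 : ℝ)) with he
  have hen : ∀ k, ‖e k‖ = 1 := fun k => by
    rw [he]; simp only; rw [mul_comm]; exact Complex.norm_exp_ofReal_mul_I _
  have hed : ∀ k : ℝ, HasDerivAt e (2 * I * t * ((k : ℂ) - k₀) * e k) k := fun k => by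
    have h1 : HasDerivAt (fun k : ℝ => (k ^ 2 - 2 * k₀ * k) / τ ^ 2) (2 * t * (k - k₀)) k := by
      have h2 := (((hasDerivAt_id k).fun_pow 2).sub ((hasDerivAt_id k).const_mul (2 * k₀))).div_const
        (τ ^ 2)
      refine h2.congr_deriv ?_
      simp [ht]; ring
    have h3 := (h1.ofReal_comp.const_mul I).cexp
    refine h3.congr_deriv ?_
    simp only [he]; push_cast; ring
  set r : ℝ → ℂ := fun k => (2 * I * t * ((k : ℂ) - k₀))⁻¹ with hr
  set r' : ℝ → ℂ := fun k => -(2 * I * t * ((k : ℂ) - k₀) ^ 2)⁻¹ with hr'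
  have hrd : ∀ k ∈ Icc α β, HasDerivAt r (r' k) k := fun k hk => by
    have h0 := hs0 k hk
    have h1 : HasDerivAt (fun k : ℝ => 2 * I * t * ((k : ℂ) - k₀)) (2 * I * t) k := by
      have := ((hasDerivAt_id k).ofReal_comp.sub_const (k₀ : ℂ)).const_mul (2 * I * t)
      simpa using this
    refine (h1.fun_inv (by simp [htC, h0])).congr_deriv ?_
    simp only [hr']
    have := I_ne_zero
    field_simp
  have hrn : ∀ k ∈ Icc α β, ‖r k‖ = (2 * t)⁻¹ * |k - k₀|⁻¹ := fun k _ => by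
    rw [hr]; simp only
    rw [norm_inv, norm_mul, norm_mul, norm_mul, Complex.norm_I, RCLike.norm_ofNat, Complex.norm_real,
      Real.norm_eq_abs, abs_of_pos ht0, ← ofReal_sub, Complex.norm_real, Real.norm_eq_abs, mul_one,
      mul_inv]
  have hrn' : ∀ k ∈ Icc α β, ‖r' k‖ = (2 * t)⁻¹ * ((k - k₀) ^ 2)⁻¹ := fun k _ => by
    rw [hr']; simp only
    rw [norm_neg, norm_inv, norm_mul, norm_mul, norm_mul, norm_pow, Complex.norm_I,
      RCLike.norm_ofNat, Complex.norm_real,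
      Real.norm_eq_abs, abs_of_pos ht0, ← ofReal_sub, Complex.norm_real, Real.norm_eq_abs, mul_one,
      mul_inv, sq_abs]
  have hrc : ContinuousOn r (Icc α β) := fun k hk => (hrd k hk).continuousAt.continuousWithinAt
  have hrc' : ContinuousOn r' (Icc α β) := by
    refine (ContinuousOn.inv₀ (by fun_prop) fun k hk => ?_).neg
    have := hs0 k hk
    simp [htC, this]
  set B : ℝ → ℂ := fun k => b k with hB
  set B' : ℝ → ℂ := deriv B with hB'
  have hBlip := hb.lipschitzOnWith hα0 (β := β)
  have hBn : ∀ k : ℝ, 0 < k → ‖B k‖ ≤ A := fun k hk => hb.bound _ (real_mem_posLine hk)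
  have hBd : ∀ᵐ k, k ∈ Ioo α β → HasDerivAt B (B' k) k := by
    have := hBlip.ae_differentiableWithinAt_of_mem (μ := (volume : Measure ℝ))
    filter_upwards [this] with k hk hkI
    exact ((hk (Ioo_subset_Icc_self hkI)).differentiableAt
      (Icc_mem_nhds hkI.1 hkI.2)).hasDerivAt
  have hBn' : ∀ k ∈ Icc α β, ‖B' k‖ ≤ A / k := fun k hk => by
    have hk0 : 0 < k := hα0.trans_le hk.1
    by_cases hd : DifferentiableAt ℝ B k
    · refine hd.hasDerivAt.le_of_lip' (by positivity) ?_
      filter_upwards [Ioi_mem_nhds hk0] with x hx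
      rw [Real.norm_eq_abs, norm_sub_rev, abs_sub_comm]
      exact hb.norm_sub_le hk0 hx
    · rw [hB', deriv_zero_of_not_differentiableAt hd]
      simp; positivity
  have hBc : ContinuousOn B (Icc α β) := hBlip.continuousOn
  have hec : Continuous e := continuous_iff_continuousAt.2 fun k => (hed k).continuousAt
  have hGc := hG.continuous
  have hiB' : IntervalIntegrable B' volume α β := by
    rw [intervalIntegrable_iff_integrableOn_Ioc_of_le hαβ]
    refine Integrable.mono' (g := fun _ => A / α) (integrableOn_const (by simp))
      (measurable_deriv B).aestronglyMeasurable
      ((ae_restrict_mem measurableSet_Ioc).mono fun k hk => ?_)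
    refine (hBn' k (Ioc_subset_Icc_self hk)).trans ?_
    have := hk.1.le
    gcongr
  have hu : uIcc α β = Icc α β := uIcc_of_le hαβ
  set f₁ : ℝ → ℂ := fun k => b k * (e k * G k) with hf₁
  -- The remainder of the integration by parts: the derivative falls on the symbol, on `G`, or on
  -- the inverse of the phase derivative.
  set f₂ : ℝ → ℂ := fun k => B' k * (e k * G k * r k) + g k * (B k * e k * r k) +
    B k * e k * G k * r' k with hf₂
  have hi₁ : IntervalIntegrable f₁ volume α β := by
    refine ContinuousOn.intervalIntegrable ?_
    rw [hu]; exact hBc.mul (hec.mul hGc).continuousOn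
  have hi₂ : IntervalIntegrable f₂ volume α β := by
    refine ((hiB'.mul_continuousOn ?_).add ((hG.1 α β).mul_continuousOn ?_)).add
      (ContinuousOn.intervalIntegrable ?_) <;> rw [hu]
    · exact (hec.mul hGc).continuousOn.mul hrc
    · exact (hBc.mul hec.continuousOn).mul hrc
    · exact ((hBc.mul hec.continuousOn).mul hGc.continuousOn).mul hrc'
  have hac : AbsolutelyContinuousOnInterval (fun k => B k • (e k • (G k • r k))) α β := by
    refine AbsolutelyContinuousOnInterval.fun_smul ?_ (AbsolutelyContinuousOnInterval.fun_smul ?_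
      (AbsolutelyContinuousOnInterval.fun_smul (hG.absolutelyContinuous α β) ?_))
    · rw [← hu] at hBlip; exact hBlip.absolutelyContinuousOnInterval
    · exact (IsPrimitive.of_hasDerivAt hed (by fun_prop)).absolutelyContinuous α β
    · refine ContDiffOn.absolutelyContinuousOnInterval ?_
      rw [hu]
      refine ContDiffOn.inv ?_ fun k hk => by simp [htC, hs0 k hk]
      refine ContDiff.contDiffOn ?_
      exact contDiff_const.mul (Complex.ofRealCLM.contDiff.sub contDiff_const)
  have hIBP := integral_eq_sub_of_ae_hasDerivAt hac (hi₁.add hi₂) (by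
    have hne : ∀ᵐ k : ℝ, k ≠ α ∧ k ≠ β := by
      rw [eventually_and]; simp [ae_iff, measure_singleton]
    filter_upwards [hBd, hG.ae_hasDerivAt, hne] with k h1 h2 h3 hk
    rw [hu] at hk
    have h4 := h1 ⟨lt_of_le_of_ne hk.1 h3.1.symm, lt_of_le_of_ne hk.2 h3.2⟩
    have h5 := h4.mul ((hed k).mul (h2.mul (hrd k hk)))
    refine h5.congr_deriv ?_
    have h6 : 2 * I * t * ((k : ℂ) - k₀) * r k = 1 :=
      mul_inv_cancel₀ (by simp [htC, hs0 k hk])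
    simp only [hf₁, hf₂, Pi.mul_apply]
    linear_combination (B k * e k * G k) * h6)
  have hadd : ∫ k in α..β, (f₁ k + f₂ k) = (∫ k in α..β, f₁ k) + ∫ k in α..β, f₂ k :=
    intervalIntegral.integral_add hi₁ hi₂
  rw [hadd] at hIBP
  have hbdry : ∀ k ∈ Icc α β, ‖B k • (e k • (G k • r k))‖ ≤ A * (M * τ / 2) := fun k hk => by
    simp only [smul_eq_mul, norm_mul, hen, one_mul]
    rw [hrn k hk]
    have h1 : |k - k₀|⁻¹ ≤ τ⁻¹ := inv_anti₀ hτ (hs k hk)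
    calc _ ≤ A * (M * ((2 * t)⁻¹ * τ⁻¹)) := by
          have := hBn k (hα0.trans_le hk.1)
          have := hM k
          gcongr
      _ = _ := by rw [ht]; field_simp
  -- The parameter of Young's inequality that balances `1 / (2στ)` against `σ D² / 2`. It requires
  -- `D > 0`.
  set σ : ℝ := (D * Real.sqrt τ)⁻¹ with hσ
  have hsτ : 0 < Real.sqrt τ := Real.sqrt_pos.2 hτ
  have hσ0 : 0 < σ := by positivity
  obtain ⟨j1, j1'⟩ := integral_inv_sq_le hτ hαβ h
  obtain ⟨j0, j0'⟩ := integral_inv_sq_le (k₀ := 0) hτ hαβ (Or.inl (by simpa using hα))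
  simp only [sub_zero] at j0 j0'
  have hg2 : Integrable (fun k => ‖g k‖ ^ 2) := hg.integrable_norm_pow (by norm_num)
  have hrem : ‖∫ k in α..β, f₂ k‖ ≤ A * (M * τ + D * (τ * Real.sqrt τ)) := by
    have hp : ∀ k ∈ Icc α β, ‖f₂ k‖ ≤ A * (2 * t)⁻¹ * (M * (k ^ 2)⁻¹ / 2 +
        (3 * M / 2 + 1 / (2 * σ)) * ((k - k₀) ^ 2)⁻¹ + σ / 2 * ‖g k‖ ^ 2) := fun k hk => by
      have hk0 : 0 < k := hα0.trans_le hk.1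
      have b1 := hBn k hk0
      have b2 := hBn' k hk
      have b3 := hM k
      set y := |k - k₀|⁻¹ with hy
      have hy0 : 0 ≤ y := by positivity
      have hy2 : ((k - k₀) ^ 2)⁻¹ = y ^ 2 := by rw [hy, inv_pow, sq_abs]
      have n1 : ‖f₂ k‖ ≤ A / k * (M * ((2 * t)⁻¹ * y)) + ‖g k‖ * (A * ((2 * t)⁻¹ * y)) +
          A * M * ((2 * t)⁻¹ * y ^ 2) := by
        refine (norm_add_le _ _).trans (add_le_add ((norm_add_le _ _).trans (add_le_add ?_ ?_)) ?_)
        · simp only [norm_mul, hen, one_mul]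
          rw [hrn k hk]; gcongr
        · simp only [norm_mul, hen, mul_one]
          rw [hrn k hk]; gcongr
        · simp only [norm_mul, hen, mul_one]
          rw [hrn' k hk, hy2]; gcongr
      refine n1.trans ?_
      rw [hy2]
      have a1 : k⁻¹ * y ≤ ((k ^ 2)⁻¹ + y ^ 2) / 2 := by
        rw [← inv_pow]; nlinarith [sq_nonneg (k⁻¹ - y)]
      have a2 : ‖g k‖ * y ≤ σ / 2 * ‖g k‖ ^ 2 + 1 / (2 * σ) * y ^ 2 := by
        have e1 : σ / 2 * ‖g k‖ ^ 2 + 1 / (2 * σ) * y ^ 2 - ‖g k‖ * y =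
          (σ * ‖g k‖ - y) ^ 2 / (2 * σ) := by field_simp; ring
        have : 0 ≤ (σ * ‖g k‖ - y) ^ 2 / (2 * σ) := by positivity
        linarith
      have ht2 : 0 ≤ A * (2 * t)⁻¹ := by positivity
      have a3 := mul_le_mul_of_nonneg_left a1 hM0
      calc _ = A * (2 * t)⁻¹ * (M * (k⁻¹ * y) + ‖g k‖ * y + M * y ^ 2) := by
            rw [div_eq_mul_inv]; ring
        _ ≤ _ := by
            refine mul_le_mul_of_nonneg_left ?_ ht2
            linarith
    have hint : IntervalIntegrable (fun k => M * (k ^ 2)⁻¹ / 2 +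
        (3 * M / 2 + 1 / (2 * σ)) * ((k - k₀) ^ 2)⁻¹ + σ / 2 * ‖g k‖ ^ 2) volume α β :=
      (((j0.const_mul M).div_const 2).add (j1.const_mul _)).add
        (hg2.intervalIntegrable.const_mul _)
    have h1 := intervalIntegral.norm_integral_le_of_norm_le hαβ
      (Eventually.of_forall fun k hk => hp k (Ioc_subset_Icc_self hk)) (hint.const_mul _)
    refine h1.trans ?_
    have hg3 : ∫ k in α..β, ‖g k‖ ^ 2 ≤ D ^ 2 := by
      rw [intervalIntegral.integral_of_le hαβ]
      exact (setIntegral_le_integral hg2 (Eventually.of_forall fun k => by positivity)).trans hgD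
    rw [intervalIntegral.integral_const_mul, intervalIntegral.integral_add
      (((j0.const_mul M).div_const 2).add (j1.const_mul _)) (hg2.intervalIntegrable.const_mul _),
      intervalIntegral.integral_add ((j0.const_mul M).div_const 2) (j1.const_mul _),
      intervalIntegral.integral_div, intervalIntegral.integral_const_mul,
      intervalIntegral.integral_const_mul, intervalIntegral.integral_const_mul]
    calc _ ≤ A * (2 * t)⁻¹ * (M * τ⁻¹ / 2 + (3 * M / 2 + 1 / (2 * σ)) * τ⁻¹ + σ / 2 * D ^ 2) := by
          gcongr
      _ = A * (M * τ + D * (τ * Real.sqrt τ) / 2) := by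
          have e1 : 1 / (2 * σ) * τ⁻¹ + σ / 2 * D ^ 2 = D / Real.sqrt τ := by
            rw [hσ]
            have : τ = Real.sqrt τ ^ 2 := (Real.sq_sqrt hτ.le).symm
            rw [this, Real.sqrt_sq hsτ.le]
            field_simp; ring
          rw [show M * τ⁻¹ / 2 + (3 * M / 2 + 1 / (2 * σ)) * τ⁻¹ + σ / 2 * D ^ 2 =
            2 * M * τ⁻¹ + (1 / (2 * σ) * τ⁻¹ + σ / 2 * D ^ 2) by ring, e1, ht]
          have : τ = Real.sqrt τ ^ 2 := (Real.sq_sqrt hτ.le).symm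
          generalize Real.sqrt τ = s at *
          subst this
          field_simp
      _ ≤ _ := by
          have : 0 ≤ D * (τ * Real.sqrt τ) := by positivity
          gcongr
          linarith
  have hfin : ∫ k in α..β, f₁ k = B β • (e β • (G β • r β)) - B α • (e α • (G α • r α)) -
      ∫ k in α..β, f₂ k := by rw [← hIBP]; ring
  rw [hfin]
  have h1 := hbdry α ⟨le_rfl, hαβ⟩
  have h2 := hbdry β ⟨hαβ, le_rfl⟩
  refine (norm_sub_le _ _).trans ?_
  have h3 := norm_sub_le (B β • (e β • (G β • r β))) (B α • (e α • (G α • r α)))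
  linarith

theorem norm_oscillatory_integral_trivial (hb : IsSymbol posLine A b) (hM : ∀ k, ‖G k‖ ≤ M)
    {e : ℝ → ℂ} (he : ∀ k, ‖e k‖ = 1) {α β : ℝ} (hα : 0 ≤ α) (hαβ : α ≤ β) :
    ‖∫ k in α..β, b k * (e k * G k)‖ ≤ A * M * (β - α) := by
  have := intervalIntegral.norm_integral_le_of_norm_le_const (a := α) (b := β) (C := A * M)
    (f := fun k : ℝ => b k * (e k * G k)) fun k hk => by
      rw [uIoc_of_le hαβ] at hk
      rw [norm_mul, norm_mul, he, one_mul]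
      exact mul_le_mul (hb.bound _ (real_mem_posLine (hα.trans_lt hk.1))) (hM k) (norm_nonneg _)
        hb.nonneg
  rwa [abs_of_nonneg (sub_nonneg.2 hαβ)] at this

/-- The intervals `[0, τ]`, where the symbol is rough, and `[k₀ - τ, k₀ + τ]`, where the phase is
stationary, have total length at most `3τ` and are estimated trivially. The two nonstationary pieces
contribute `2 M τ + D τ^{3/2}` each, up to `A`, so `7` suffices. Nothing depends on `ξ`, which will
carry the position `x`. -/
theorem norm_oscillatory_integral_le (hb : IsSymbol posLine A b) (hG : IsPrimitive G g)
    (hM : ∀ k, ‖G k‖ ≤ M) (hg : MemLp g 2 volume) (hD : 0 < D) (hgD : ∫ k, ‖g k‖ ^ 2 ≤ D ^ 2)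
    {τ : ℝ} (hτ : 0 < τ) (ξ : ℝ) {N : ℝ} (hN : 0 < N) :
    ‖∫ k in (0 : ℝ)..N, b k * (cexp (I * (k ^ 2 / τ ^ 2 + ξ * k : ℝ)) * G k)‖ ≤
      7 * A * (M * τ + D * (τ * Real.sqrt τ)) := by
  set k₀ : ℝ := -ξ * τ ^ 2 / 2 with hk₀
  have hphase : ∀ k : ℝ, k ^ 2 / τ ^ 2 + ξ * k = (k ^ 2 - 2 * k₀ * k) / τ ^ 2 := fun k => by
    rw [hk₀]; field_simp; ring
  simp only [hphase]
  set e : ℝ → ℂ := fun k => cexp (I * ((k ^ 2 - 2 * k₀ * k) / τ ^ 2 : ℝ)) with he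
  have hen : ∀ k, ‖e k‖ = 1 := fun k => by
    rw [he]; simp only; rw [mul_comm]; exact Complex.norm_exp_ofReal_mul_I _
  have hec : Continuous e := by rw [he]; fun_prop
  have hA := hb.nonneg
  have hM0 : 0 ≤ M := (norm_nonneg _).trans (hM 0)
  have hint : ∀ α β, 0 ≤ α → 0 ≤ β →
      IntervalIntegrable (fun k : ℝ => b k * (e k * G k)) volume α β := fun α β hα hβ =>
    (hb.intervalIntegrable (hec.mul hG.continuous) hα).symm.trans
      (hb.intervalIntegrable (hec.mul hG.continuous) hβ)
  -- Clamping the cut points to `[p, N]` keeps them ordered wherever `k₀` lies. A piece of positive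
  -- length adjacent to the stationary zone has its true endpoints, so the nonstationary hypothesis
  -- holds there.
  set p := min τ N with hp
  set c₁ := max p (min (k₀ - τ) N) with hc₁
  set c₂ := max p (min (k₀ + τ) N) with hc₂
  have hp0 : 0 < p := lt_min hτ hN
  have hpc1 : p ≤ c₁ := le_max_left _ _
  have hpc2 : p ≤ c₂ := le_max_left _ _
  have hc12 : c₁ ≤ c₂ := max_le_max le_rfl (min_le_min (by linarith) le_rfl)
  have hc2N : c₂ ≤ N := max_le (min_le_right _ _) (min_le_right _ _)
  have hc21 : c₂ - c₁ ≤ 2 * τ := by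
    have h1 : |c₂ - c₁| ≤ |min (k₀ + τ) N - min (k₀ - τ) N| := by
      rw [hc₁, hc₂, max_comm p, max_comm p]; exact abs_max_sub_max_le_abs _ _ _
    have h2 := abs_min_sub_min_le_max (k₀ + τ) N (k₀ - τ) N
    rw [sub_self, abs_zero, max_eq_left (abs_nonneg _)] at h2
    have h3 : |k₀ + τ - (k₀ - τ)| = 2 * τ := by
      rw [show k₀ + τ - (k₀ - τ) = 2 * τ by ring, abs_of_pos (by linarith)]
    linarith [le_abs_self (c₂ - c₁)]
  have i1 := norm_oscillatory_integral_trivial hb hM hen le_rfl hp0.le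
  have i3 := norm_oscillatory_integral_trivial hb hM hen (hp0.le.trans hpc1) hc12
  have hB : 0 ≤ A * (2 * (M * τ) + D * (τ * Real.sqrt τ)) := by positivity
  have i2 : ‖∫ k in p..c₁, b k * (e k * G k)‖ ≤ A * (2 * (M * τ) + D * (τ * Real.sqrt τ)) := by
    rcases hpc1.eq_or_lt with h | h
    · rw [← h, intervalIntegral.integral_same, norm_zero]; exact hB
    · have h1 : c₁ = min (k₀ - τ) N := by
        rcases max_choice p (min (k₀ - τ) N) with h' | h'
        · exact absurd (hc₁.trans h') h.ne'
        · exact h'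
      have h2 : p = τ := by
        rcases min_choice τ N with h' | h'
        · exact h'
        · have : c₁ ≤ p := by rw [h1, hp, h']; exact min_le_right _ _
          exact absurd this (not_le.2 h)
      exact norm_oscillatory_integral_nonstationary hb hG hM hg hD hgD hτ h2.ge hpc1
        (Or.inr (h1 ▸ min_le_left _ _))
  have i4 : ‖∫ k in c₂..N, b k * (e k * G k)‖ ≤ A * (2 * (M * τ) + D * (τ * Real.sqrt τ)) := by
    rcases hc2N.eq_or_lt with h | h
    · rw [h, intervalIntegral.integral_same, norm_zero]; exact hB
    · have h2 : p = τ := by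
        rcases min_choice τ N with h' | h'
        · exact h'
        · have : N ≤ c₂ := by rw [← h']; exact hpc2
          exact absurd this (not_le.2 h)
      have h3 : k₀ + τ ≤ c₂ := by
        rcases min_choice (k₀ + τ) N with h' | h'
        · rw [← h']; exact le_max_right _ _
        · have : N ≤ c₂ := by rw [hc₂, h']; exact le_max_right _ _
          exact absurd this (not_le.2 h)
      exact norm_oscillatory_integral_nonstationary hb hG hM hg hD hgD hτ (h2 ▸ hpc2) hc2N
        (Or.inl h3)
  have hsum : ∫ k in (0 : ℝ)..N, b k * (e k * G k) = (∫ k in (0 : ℝ)..p, b k * (e k * G k)) +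
      (∫ k in p..c₁, b k * (e k * G k)) + (∫ k in c₁..c₂, b k * (e k * G k)) +
      ∫ k in c₂..N, b k * (e k * G k) := by
    have q1 := hp0.le
    have q2 := q1.trans hpc1
    have q3 := q1.trans hpc2
    rw [intervalIntegral.integral_add_adjacent_intervals (hint _ _ le_rfl q1) (hint _ _ q1 q2),
      intervalIntegral.integral_add_adjacent_intervals (hint _ _ le_rfl q2) (hint _ _ q2 q3),
      intervalIntegral.integral_add_adjacent_intervals (hint _ _ le_rfl q3) (hint _ _ q3 hN.le)]
  rw [hsum]
  have hAM : 0 ≤ A * M := by positivity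
  have i1' : A * M * (p - 0) ≤ A * M * τ := by
    rw [sub_zero]; exact mul_le_mul_of_nonneg_left (min_le_left _ _) hAM
  have i3' : A * M * (c₂ - c₁) ≤ A * M * (2 * τ) := mul_le_mul_of_nonneg_left hc21 hAM
  have hDτ : 0 ≤ A * (D * (τ * Real.sqrt τ)) := by positivity
  refine (norm_add_le _ _).trans ?_
  have s1 := norm_add_le ((∫ k in (0 : ℝ)..p, b k * (e k * G k)) +
      (∫ k in p..c₁, b k * (e k * G k))) (∫ k in c₁..c₂, b k * (e k * G k))
  have s2 := norm_add_le (∫ k in (0 : ℝ)..p, b k * (e k * G k))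
      (∫ k in p..c₁, b k * (e k * G k))
  linarith

end Oscillatory

/-! ### Uniform bound for the oscillatory integral of the generalized eigenfunctions -/

section PsiBound

open Complex

variable {V : ℝ → ℝ}

/-- The transmission coefficient in terms of the Wronskian. -/
noncomputable def transCoeff (V : ℝ → ℝ) (k : ℂ) : ℂ := -2 * I * k / jostW V k

/-- Provides a point at which `jostM` is invertible uniformly in `k`; applied to the reflected
potential, it allows the scattering relation to be solved for `R` within symbols. -/
theorem exists_half_le_norm_jostM (hV : MemL11 V) :
    ∃ a : ℝ, ∀ k ∈ closedUHP, 1 / 2 ≤ ‖jostM V k a‖ := by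
  have h := (tendsto_integral_Ioi_zero hV.integrable_weight).const_mul (2 * volterraConst V)
  rw [mul_zero] at h
  obtain ⟨a, ha, ha0⟩ := ((h.eventually (gt_mem_nhds (by norm_num : (0 : ℝ) < 1 / 2))).and
    (eventually_ge_atTop 0)).exists
  refine ⟨a, fun k hk => ?_⟩
  have h1 := norm_jostM_sub_one_le hV hk a
  rw [negWeight_of_nonneg ha0, mul_one] at h1
  have h2 := norm_sub_norm_le 1 (jostM V k a)
  rw [norm_one, norm_sub_rev] at h2
  linarith

/-- For `x ≥ -a` the amplitude `T m₊` is a symbol and the phase is `e^{ikx}`. For `x < -a` the bound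
on `m₊` degenerates, and `T f₊` is rewritten as `conj f₋ + R f₋`. Here `R` is a symbol times
`e^{-2iak}`; this factor is linear in `k` in the exponent and is absorbed into `ξ`. -/
theorem norm_integral_transCoeff_jostF_le (hV : MemL11 V) :
    ∃ C, 0 ≤ C ∧ ∀ (G g : ℝ → ℂ) (M D τ N x : ℝ), IsPrimitive G g → (∀ k, ‖G k‖ ≤ M) →
      MemLp g 2 volume → 0 < D → ∫ k, ‖g k‖ ^ 2 ≤ D ^ 2 → 0 < τ → 0 < N →
      ‖∫ k in (0 : ℝ)..N, transCoeff V k * jostF V k x * (cexp (I * (k ^ 2 / τ ^ 2 : ℝ)) * G k)‖ ≤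
        C * (M * τ + D * (τ * Real.sqrt τ)) := by
  obtain ⟨a, ha⟩ := exists_half_le_norm_jostM hV.reflect
  obtain ⟨-, A, hA⟩ := low_energy hV
  have hm : ∀ x, -a ≤ x → IsSymbol posLine (jostConst V (-a)) fun k => jostM V k x := fun x hx =>
    (isSymbol_jostM hV hx).mono_set posLine_subset
  have hn : ∀ x, a ≤ x → IsSymbol posLine (jostConst (reflect V) a) fun k => jostM (reflect V) k x :=
    fun x hx => (isSymbol_jostM hV.reflect hx).mono_set posLine_subset
  set J := jostConst V (-a)
  set J' := jostConst (reflect V) a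
  -- The scattering relation at `x = -a` solved for `R`, with the phase `e^{-2iak}` removed.
  set Rt : ℂ → ℂ := fun k => (transCoeff V k * jostM V k (-a) +
    (-1) * starRingEnd ℂ (jostM (reflect V) k a)) * (jostM (reflect V) k a)⁻¹ with hRt
  obtain ⟨B, hB⟩ : ∃ B, IsSymbol posLine B Rt :=
    ⟨_, ((hA.mul (hm (-a) le_rfl)).add ((hn a le_rfl).conj.const_mul (-1))).mul
      ((hn a le_rfl).inv one_half_pos fun k hk => ha k (posLine_subset hk))⟩
  have hA0 := hA.nonneg
  have hJ0 := (hm _ le_rfl).nonneg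
  have hJ0' := (hn _ le_rfl).nonneg
  have hB0 := hB.nonneg
  refine ⟨7 * (2 * A * J) + 7 * J' + 7 * (2 * B * J'), by positivity, ?_⟩
  intro G g M D τ N x hG hM hg hD hgD hτ hN
  have hM0 : 0 ≤ M := (norm_nonneg _).trans (hM 0)
  have hpos : 0 ≤ M * τ + D * (τ * Real.sqrt τ) := by positivity
  rcases le_or_gt (-a) x with hx | hx
  · have h1 := norm_oscillatory_integral_le (hA.mul (hm x hx)) hG hM hg hD hgD hτ x hN
    have h2 : ∀ k : ℝ, transCoeff V k * jostF V k x * (cexp (I * (k ^ 2 / τ ^ 2 : ℝ)) * G k) =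
        -2 * I * k / jostW V k * jostM V k x * (cexp (I * (k ^ 2 / τ ^ 2 + x * k : ℝ)) * G k) :=
      fun k => by
        have : cexp (I * (k ^ 2 / τ ^ 2 + x * k : ℝ)) =
            cexp (I * (k ^ 2 / τ ^ 2 : ℝ)) * cexp (I * k * x) := by
          rw [← Complex.exp_add]; congr 1; push_cast; ring
        rw [this, jostF, transCoeff]; ring
    simp only [h2]
    refine h1.trans ?_
    have : 0 ≤ (7 * J' + 7 * (2 * B * J')) * (M * τ + D * (τ * Real.sqrt τ)) := by positivity
    linarith
  · have hx' : a ≤ -x := by linarith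
    have s1 := (hn (-x) hx').conj
    have s2 := hB.mul (hn (-x) hx')
    have h1 := norm_oscillatory_integral_le s1 hG hM hg hD hgD hτ x hN
    have h2 := norm_oscillatory_integral_le s2 hG hM hg hD hgD hτ (-2 * a - x) hN
    have hc : ∀ ξ : ℝ, Continuous fun k : ℝ => cexp (I * (k ^ 2 / τ ^ 2 + ξ * k : ℝ)) * G k :=
      fun ξ => (by fun_prop : Continuous fun k : ℝ =>
        cexp (I * (k ^ 2 / τ ^ 2 + ξ * k : ℝ))).mul hG.continuous
    have heq : ∫ k in (0 : ℝ)..N, transCoeff V k * jostF V k x *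
          (cexp (I * (k ^ 2 / τ ^ 2 : ℝ)) * G k) =
        ∫ k in (0 : ℝ)..N, (starRingEnd ℂ (jostM (reflect V) k (-x)) *
          (cexp (I * (k ^ 2 / τ ^ 2 + x * k : ℝ)) * G k) + Rt k * jostM (reflect V) k (-x) *
          (cexp (I * (k ^ 2 / τ ^ 2 + (-2 * a - x) * k : ℝ)) * G k)) := by
      refine intervalIntegral.integral_congr_ae (Eventually.of_forall fun k hk => ?_)
      rw [uIoc_of_le hN.le] at hk
      obtain ⟨hW, -, R, hR, -⟩ := exists_scattering hV hk.1.ne'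
      have hna : jostM (reflect V) k a ≠ 0 := norm_pos_iff.1
        (lt_of_lt_of_le (by norm_num) (ha k (real_mem_closedUHP k)))
      have e0 : starRingEnd ℂ (cexp (I * k * a)) = cexp (I * k * (-a : ℝ)) := by
        rw [← Complex.exp_conj]; simp
      have e1 : Rt k * jostM (reflect V) k a = transCoeff V k * jostM V k (-a) +
          (-1) * starRingEnd ℂ (jostM (reflect V) k a) := by
        rw [hRt]; simp only; rw [mul_assoc, inv_mul_cancel₀ hna, mul_one]
      have e2 : R = cexp (I * k * (-2 * a : ℝ)) * Rt k := by
        have h3 := hR (-a)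
        rw [jostG, neg_neg, jostF, jostF, map_mul, e0] at h3
        have h4 : cexp (I * k * (-2 * a : ℝ)) * cexp (I * k * a) = cexp (I * k * (-a : ℝ)) := by
          rw [← Complex.exp_add]; congr 1; push_cast; ring
        have h5 : (R - cexp (I * k * (-2 * a : ℝ)) * Rt k) *
            (cexp (I * k * a) * jostM (reflect V) k a) = 0 := by
          rw [transCoeff] at e1
          linear_combination (-1 : ℂ) * h3 - cexp (I * k * (-a : ℝ)) * e1 -
            Rt k * jostM (reflect V) k a * h4
        rcases mul_eq_zero.1 h5 with h | h
        · exact sub_eq_zero.1 h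
        · exact absurd h (mul_ne_zero (Complex.exp_ne_zero _) hna)
      have e3 := hR x
      rw [jostG, jostF, jostF, map_mul, e2] at e3
      have e4 : starRingEnd ℂ (cexp (I * k * (-x : ℝ))) = cexp (I * k * x) := by
        rw [← Complex.exp_conj]; simp
      rw [e4] at e3
      have e5 : cexp (I * (k ^ 2 / τ ^ 2 + x * k : ℝ)) =
            cexp (I * (k ^ 2 / τ ^ 2 : ℝ)) * cexp (I * k * x) := by
        rw [← Complex.exp_add]; congr 1; push_cast; ring
      have e6 : cexp (I * (k ^ 2 / τ ^ 2 + (-2 * a - x) * k : ℝ)) =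
            cexp (I * (k ^ 2 / τ ^ 2 : ℝ)) * (cexp (I * k * (-2 * a : ℝ)) *
              cexp (I * k * (-x : ℝ))) := by
        rw [← Complex.exp_add, ← Complex.exp_add]; congr 1; push_cast; ring
      rw [e5, e6, jostF, transCoeff]
      linear_combination (cexp (I * (k ^ 2 / τ ^ 2 : ℝ)) * G k) * e3
    rw [heq, intervalIntegral.integral_add (s1.intervalIntegrable (hc x) hN.le)
      (s2.intervalIntegrable (hc (-2 * a - x)) hN.le)]
    refine (norm_add_le _ _).trans ((add_le_add h1 h2).trans ?_)
    have : 0 ≤ 7 * (2 * A * J) * (M * τ + D * (τ * Real.sqrt τ)) := by positivity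
    linarith

theorem psi_of_pos (hV : MemL11 V) (x : ℝ) {k : ℝ} (hk : 0 < k) :
    psi V x k = ((Real.sqrt (2 * Real.pi) : ℝ) : ℂ)⁻¹ * (transCoeff V k * jostF V k x) := by
  rw [psi, if_pos hk.le, jostPlus_eq hV hk.ne', transmission_eq hV hk.ne', transCoeff]

theorem psi_neg_of_pos (hV : MemL11 V) (x : ℝ) {k : ℝ} (hk : 0 < k) :
    psi V x (-k) = ((Real.sqrt (2 * Real.pi) : ℝ) : ℂ)⁻¹ * (transCoeff V k * jostG V k x) := by
  rw [psi, if_neg (by linarith), neg_neg, jostMinus_eq hV hk.ne', transmission_eq hV hk.ne',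
    transCoeff]

theorem transCoeff_reflect (V : ℝ → ℝ) (k : ℂ) : transCoeff (reflect V) k = transCoeff V k := by
  rw [transCoeff, transCoeff, jostW_reflect]

theorem isSymbol_transCoeff_mul_jostF (hV : MemL11 V) (x : ℝ) :
    ∃ A, IsSymbol posLine A fun k => transCoeff V k * jostM V k x := by
  obtain ⟨-, A, hA⟩ := low_energy hV
  exact ⟨_, hA.mul ((isSymbol_jostM hV le_rfl).mono_set posLine_subset)⟩

theorem intervalIntegrable_transCoeff_jostF (hV : MemL11 V) (x : ℝ) {e : ℝ → ℂ} (he : Continuous e)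
    {N : ℝ} (hN : 0 ≤ N) :
    IntervalIntegrable (fun k : ℝ => transCoeff V k * jostF V k x * e k) volume 0 N := by
  obtain ⟨A, hA⟩ := isSymbol_transCoeff_mul_jostF hV x
  refine (hA.intervalIntegrable ((by fun_prop : Continuous fun k : ℝ =>
    cexp (I * k * x)).mul he) hN).congr (fun k _ => ?_)
  simp only [jostF, Pi.mul_apply]; ring

/-- The half-line `k < 0` is the half-line `k > 0` for the reflected potential at the point `-x`:
reflection exchanges `f₊` and `f₋` and preserves `T`. -/
theorem norm_integral_psi_le (hV : MemL11 V) :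
    ∃ C, 0 ≤ C ∧ ∀ (G g : ℝ → ℂ) (M D τ N x : ℝ), IsPrimitive G g → (∀ k, ‖G k‖ ≤ M) →
      MemLp g 2 volume → 0 < D → ∫ k, ‖g k‖ ^ 2 ≤ D ^ 2 → 0 < τ → 0 < N →
      IntervalIntegrable (fun k => psi V x k * (cexp (I * (k ^ 2 / τ ^ 2 : ℝ)) * G k))
        volume (-N) N ∧
      ‖∫ k in (-N)..N, psi V x k * (cexp (I * (k ^ 2 / τ ^ 2 : ℝ)) * G k)‖ ≤
        C * (M * τ + D * (τ * Real.sqrt τ)) := by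
  obtain ⟨C₁, hC₁, H₁⟩ := norm_integral_transCoeff_jostF_le hV
  obtain ⟨C₂, hC₂, H₂⟩ := norm_integral_transCoeff_jostF_le hV.reflect
  set s : ℂ := ((Real.sqrt (2 * Real.pi) : ℝ) : ℂ)⁻¹ with hs
  refine ⟨‖s‖ * (C₁ + C₂), by positivity, ?_⟩
  intro G g M D τ N x hG hM hg hD hgD hτ hN
  have hec : Continuous fun k : ℝ => cexp (I * (k ^ 2 / τ ^ 2 : ℝ)) := by fun_prop
  have e1 : ∀ᵐ k : ℝ, k ∈ uIoc 0 N → psi V x k * (cexp (I * (k ^ 2 / τ ^ 2 : ℝ)) * G k) =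
      s * (transCoeff V k * jostF V k x * (cexp (I * (k ^ 2 / τ ^ 2 : ℝ)) * G k)) :=
    Eventually.of_forall fun k hk => by
      rw [uIoc_of_le hN.le] at hk
      rw [psi_of_pos hV x hk.1]; ring
  have e2 : ∀ᵐ k : ℝ, k ∈ uIoc 0 N → psi V x (-k) * (cexp (I * ((-k) ^ 2 / τ ^ 2 : ℝ)) * G (-k)) =
      s * (transCoeff (reflect V) k * jostF (reflect V) k (-x) *
        (cexp (I * (k ^ 2 / τ ^ 2 : ℝ)) * G (-k))) :=
    Eventually.of_forall fun k hk => by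
      rw [uIoc_of_le hN.le] at hk
      rw [psi_neg_of_pos hV x hk.1, jostG, transCoeff_reflect, neg_sq]; ring
  have hGn := hG.comp_neg
  have i1 : IntervalIntegrable (fun k => psi V x k * (cexp (I * (k ^ 2 / τ ^ 2 : ℝ)) * G k))
      volume 0 N :=
    ((intervalIntegrable_transCoeff_jostF hV x (hec.mul hG.continuous) hN.le).const_mul s).congr_ae
      ((ae_restrict_iff' measurableSet_uIoc).2 (e1.mono fun k h hk => (h hk).symm))
  have i2 : IntervalIntegrable (fun k => psi V x (-k) *
      (cexp (I * ((-k) ^ 2 / τ ^ 2 : ℝ)) * G (-k))) volume 0 N :=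
    ((intervalIntegrable_transCoeff_jostF hV.reflect (-x) (hec.mul hGn.continuous)
      hN.le).const_mul s).congr_ae
      ((ae_restrict_iff' measurableSet_uIoc).2 (e2.mono fun k h hk => (h hk).symm))
  have i3 : IntervalIntegrable (fun k => psi V x k * (cexp (I * (k ^ 2 / τ ^ 2 : ℝ)) * G k))
      volume (-N) 0 := by
    have := i2.comp_mul_left (c := -1)
    simp only [neg_mul, one_mul, neg_neg, div_neg, div_one, neg_zero] at this
    exact this.symm
  refine ⟨i3.trans i1, ?_⟩
  rw [← intervalIntegral.integral_add_adjacent_intervals i3 i1]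
  have h1 : ∫ k in (-N)..0, psi V x k * (cexp (I * (k ^ 2 / τ ^ 2 : ℝ)) * G k) =
      ∫ k in (0 : ℝ)..N, psi V x (-k) * (cexp (I * ((-k) ^ 2 / τ ^ 2 : ℝ)) * G (-k)) := by
    have := intervalIntegral.integral_comp_neg (a := 0) (b := N)
      (fun k => psi V x k * (cexp (I * (k ^ 2 / τ ^ 2 : ℝ)) * G k))
    rw [neg_zero] at this
    exact this.symm
  rw [h1, intervalIntegral.integral_congr_ae e1, intervalIntegral.integral_congr_ae e2,
    intervalIntegral.integral_const_mul, intervalIntegral.integral_const_mul, add_comm]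
  have b1 := H₁ G g M D τ N x hG hM hg hD hgD hτ hN
  have hgn : MemLp (fun k => -g (-k)) 2 volume :=
    (hg.comp_measurePreserving (Measure.measurePreserving_neg volume)).neg
  have b2 := H₂ (fun k => G (-k)) (fun k => -g (-k)) M D τ N (-x) hGn (fun k => hM _) hgn hD
    (by
      simp only [norm_neg]
      rw [integral_neg_eq_self (fun k => ‖g k‖ ^ 2) volume]
      exact hgD) hτ hN
  refine (norm_add_le _ _).trans ?_
  rw [norm_mul, norm_mul]
  have b1' := mul_le_mul_of_nonneg_left b1 (norm_nonneg s)
  have b2' := mul_le_mul_of_nonneg_left b2 (norm_nonneg s)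
  linarith

end PsiBound

/-! ### Weak derivatives -/

section WeakDeriv

theorem IsPrimitive.integral_mul_deriv {G g φ : ℝ → ℂ} (hG : IsPrimitive G g)
    (hφ : ContDiff ℝ ∞ φ) (hc : HasCompactSupport φ) :
    ∫ k, G k * deriv φ k = -∫ k, g k * φ k := by
  have hφ1 : ContDiff ℝ 1 φ := hφ.of_le (by exact_mod_cast le_top)
  have hφp : IsPrimitive φ (deriv φ) := .of_hasDerivAt
    (fun x => (hφ1.differentiable one_ne_zero x).hasDerivAt) (hφ1.continuous_deriv le_rfl)
  have h := hG.mul hφp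
  obtain ⟨R, hR⟩ := hc.isCompact.isBounded.subset_closedBall 0
  have hR' : ∀ k, R < |k| → k ∉ tsupport φ := fun k hk hk' => by
    have := hR hk'
    rw [mem_closedBall_zero_iff, Real.norm_eq_abs] at this
    linarith
  set S := |R| + 1
  have hS : ∀ k, k ∉ Ioc (-S) S → k ∉ tsupport φ := fun k hk => by
    refine hR' k ?_
    by_contra hcon
    have h1 := abs_le.1 (not_lt.1 hcon)
    exact hk ⟨by have := le_abs_self R; simp only [S]; linarith, by
      have := le_abs_self R; simp only [S]; linarith⟩
  have hd0 : ∀ k, k ∉ tsupport φ → deriv φ k = 0 := fun k hk => by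
    have := (support_deriv_subset (f := φ)).trans (le_refl _)
    by_contra hne
    exact hk (this hne)
  have hSle : -S ≤ S := by simp only [S]; linarith [abs_nonneg R]
  have e1 : ∫ k, G k * deriv φ k = ∫ k in (-S)..S, G k * deriv φ k := by
    rw [intervalIntegral.integral_of_le hSle]
    exact (setIntegral_eq_integral_of_forall_compl_eq_zero fun k hk => by
      rw [hd0 k (hS k hk), mul_zero]).symm
  have e2 : ∫ k, g k * φ k = ∫ k in (-S)..S, g k * φ k := by
    rw [intervalIntegral.integral_of_le hSle]
    exact (setIntegral_eq_integral_of_forall_compl_eq_zero fun k hk => by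
      rw [image_eq_zero_of_notMem_tsupport (hS k hk), mul_zero]).symm
  have i1 : IntervalIntegrable (fun k => g k * φ k) volume (-S) S :=
    (hG.1 _ _).mul_continuousOn hφ.continuous.continuousOn
  have i2 : IntervalIntegrable (fun k => G k * deriv φ k) volume (-S) S :=
    (hG.continuous.mul (hφ1.continuous_deriv le_rfl)).intervalIntegrable _ _
  have h3 := h.2 (-S) S
  change G S * φ S - G (-S) * φ (-S) = _ at h3
  rw [intervalIntegral.integral_add i1 i2, image_eq_zero_of_notMem_tsupport (hR' S ?_),
    image_eq_zero_of_notMem_tsupport (hR' (-S) ?_)] at h3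
  · rw [e1, e2]
    linear_combination -h3
  · rw [abs_neg, abs_of_nonneg (by positivity)]; simp only [S]; linarith [le_abs_self R]
  · rw [abs_of_nonneg (by positivity)]; simp only [S]; linarith [le_abs_self R]

/-- The mean-zero condition makes the primitive that vanishes far to the left vanish far to the
right as well; this feeds the du Bois-Reymond argument. -/
theorem exists_contDiff_primitive {p : ℝ → ℝ} (hp : ContDiff ℝ ∞ p) (hc : HasCompactSupport p)
    (h0 : ∫ x, p x = 0) : ∃ Φ : ℝ → ℝ, ContDiff ℝ ∞ Φ ∧ HasCompactSupport Φ ∧ deriv Φ = p := by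
  obtain ⟨R, hR⟩ := hc.isCompact.isBounded.subset_closedBall 0
  have hR' : ∀ k, R < |k| → p k = 0 := fun k hk => by
    refine image_eq_zero_of_notMem_tsupport fun hk' => ?_
    have := hR hk'
    rw [mem_closedBall_zero_iff, Real.norm_eq_abs] at this
    linarith
  set S := |R| + 1
  have hRS : R < S := by simp only [S]; linarith [le_abs_self R]
  have hS0 : 0 < S := by positivity
  have hd : ∀ x, HasDerivAt (fun x => ∫ y in (-S)..x, p y) (p x) x := fun x =>
    intervalIntegral.integral_hasDerivAt_right (hp.continuous.intervalIntegrable _ _)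
      (hp.continuous.stronglyMeasurableAtFilter _ _) hp.continuous.continuousAt
  have hd' : deriv (fun x => ∫ y in (-S)..x, p y) = p := funext fun x => (hd x).deriv
  refine ⟨fun x => ∫ y in (-S)..x, p y, ?_, ?_, hd'⟩
  · rw [contDiff_infty_iff_deriv, hd']
    exact ⟨fun x => (hd x).differentiableAt, hp⟩
  · refine HasCompactSupport.intro (isCompact_Icc (a := -S) (b := S)) fun x hx => ?_
    rw [mem_Icc, not_and_or, not_le, not_le] at hx
    rcases hx with hx | hx
    · refine (intervalIntegral.integral_congr (g := fun _ => 0) fun y hy => ?_).trans (by simp)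
      rw [uIcc_of_ge hx.le] at hy
      refine hR' y (hRS.trans_le ?_)
      exact (neg_le_abs y).trans' (by linarith [hy.2])
    · have hle : -S ≤ x := by linarith
      rw [intervalIntegral.integral_of_le hle, ← h0]
      refine setIntegral_eq_integral_of_forall_compl_eq_zero fun y hy => ?_
      rw [mem_Ioc, not_and_or, not_lt, not_le] at hy
      refine hR' y (hRS.trans_le ?_)
      rcases hy with hy | hy
      · exact (neg_le_abs y).trans' (by linarith)
      · exact (le_abs_self y).trans' (by linarith)

/-- A function with a weak derivative is almost everywhere equal to a primitive of it. -/
theorem HasWeakDeriv.exists_isPrimitive {g g' : ℝ → ℂ} (h : HasWeakDeriv g g') :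
    ∃ G, IsPrimitive G g' ∧ g =ᵐ[volume] G := by
  obtain ⟨hg, hg', hw⟩ := h
  have hi : ∀ a b : ℝ, IntervalIntegrable g' volume a b := fun a b =>
    intervalIntegrable_iff.mpr ((hg'.integrableOn_isCompact isCompact_uIcc).mono_set uIoc_subset_uIcc)
  set G : ℝ → ℂ := fun x => ∫ y in (0 : ℝ)..x, g' y with hGdef
  have hG : IsPrimitive G g' := ⟨hi, fun a b =>
    intervalIntegral.integral_interval_sub_left (hi _ _) (hi _ _)⟩
  have hGl : LocallyIntegrable G volume := hG.continuous.locallyIntegrable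
  set q : ℝ → ℂ := fun x => g x - G x with hq
  have hql : LocallyIntegrable q volume := hg.sub hGl
  obtain ⟨η⟩ : Nonempty (ContDiffBump (0 : ℝ)) := inferInstance
  set e : ℝ → ℝ := η.normed volume
  have he : ContDiff ℝ ∞ e := η.contDiff_normed
  have hec : HasCompactSupport e := η.hasCompactSupport_normed
  have he1 : ∫ x, e x = 1 := η.integral_normed
  have hzero : ∀ φ : ℝ → ℝ, ContDiff ℝ ∞ φ → HasCompactSupport φ →
      ∫ x, deriv φ x • q x = 0 := fun φ hφ hφc => by
    have hφ' : ContDiff ℝ ∞ fun x => (φ x : ℂ) := Complex.ofRealCLM.contDiff.comp hφ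
    have hφc' : HasCompactSupport fun x => (φ x : ℂ) := hφc.comp_left (g := ((↑) : ℝ → ℂ)) rfl
    have hφ1 : ContDiff ℝ 1 φ := hφ.of_le (by exact_mod_cast le_top)
    have hdc : Continuous (deriv φ) := hφ1.continuous_deriv le_rfl
    have hder : deriv (fun x => (φ x : ℂ)) = fun x => ((deriv φ x : ℝ) : ℂ) := by
      ext x
      exact ((hφ.differentiable (by simp)) x).hasDerivAt.ofReal_comp.deriv
    have a1 := hw _ hφ' hφc'
    have a2 := hG.integral_mul_deriv hφ' hφc'
    rw [hder] at a1 a2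
    have i1 : Integrable (fun x => g x * ((deriv φ x : ℝ) : ℂ)) volume := by
      have := hg.integrable_smul_left_of_hasCompactSupport hdc hφc.deriv
      simpa [mul_comm] using this
    have i2 : Integrable (fun x => G x * ((deriv φ x : ℝ) : ℂ)) volume := by
      have := hGl.integrable_smul_left_of_hasCompactSupport hdc hφc.deriv
      simpa [mul_comm] using this
    have : ∫ x, deriv φ x • q x = (∫ x, g x * ((deriv φ x : ℝ) : ℂ)) -
        ∫ x, G x * ((deriv φ x : ℝ) : ℂ) := by
      rw [← integral_sub i1 i2]
      refine integral_congr_ae (Eventually.of_forall fun x => ?_)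
      simp only [hq, Complex.real_smul]; ring
    rw [this, a1, a2, sub_self]
  set κ : ℂ := ∫ x, e x • q x with hκ
  -- The du Bois-Reymond argument: `φ - (∫ φ) e` is the derivative of a test function, and `q`
  -- annihilates such derivatives, so `q` acts on `φ` as the constant `κ`.
  have hae : ∀ᵐ x, q x - κ = 0 := by
    refine ae_eq_zero_of_integral_contDiff_smul_eq_zero
      (hql.sub (continuous_const.locallyIntegrable)) fun φ hφ hφc => ?_
    set c := ∫ x, φ x with hc
    have hi1 : Integrable φ := hφ.continuous.integrable_of_hasCompactSupport hφc
    have hi2 : Integrable e := he.continuous.integrable_of_hasCompactSupport hec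
    obtain ⟨Φ, hΦ, hΦc, hΦd⟩ := exists_contDiff_primitive (p := fun x => φ x - c * e x)
      (hφ.sub (contDiff_const.mul he)) (hφc.sub (hec.mul_left (f := fun _ => c))) (by
        rw [integral_sub hi1 (hi2.const_mul c), integral_const_mul, he1]; simp [hc])
    have h1 := hzero Φ hΦ hΦc
    rw [hΦd] at h1
    have j1 := hql.integrable_smul_left_of_hasCompactSupport hφ.continuous hφc
    have j2 := hql.integrable_smul_left_of_hasCompactSupport he.continuous hec
    have h2 : ∫ x, (φ x - c * e x) • q x = (∫ x, φ x • q x) - c • κ := by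
      have j3 : Integrable (fun x => c • (e x • q x)) volume := j2.smul c
      rw [hκ, ← integral_smul, ← integral_sub j1 j3]
      refine integral_congr_ae (Eventually.of_forall fun x => ?_)
      simp only [sub_smul, mul_smul]
    rw [h2] at h1
    have h3 : ∫ x, φ x • (q x - κ) = (∫ x, φ x • q x) - c • κ := by
      rw [hc, ← integral_smul_const, ← integral_sub j1 (hi1.smul_const κ)]
      simp only [smul_sub]
    rw [h3, h1]
  refine ⟨fun x => κ + G x, ⟨hi, fun a b => ?_⟩, ?_⟩
  · rw [← hG.2 a b]; ring
  · filter_upwards [hae] with x hx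
    simp only [hq] at hx
    linear_combination hx

end WeakDeriv

/-! ### The resolvent kernel -/

section Resolvent

open Complex

variable {V : ℝ → ℝ}

theorem IsPrimitive.hasDerivAt {F f : ℝ → ℂ} (h : IsPrimitive F f) (hf : Continuous f) (x : ℝ) :
    HasDerivAt F (f x) x := by
  rw [h.eq_add 0]
  exact (intervalIntegral.integral_hasDerivAt_right (h.1 _ _)
    (hf.stronglyMeasurableAtFilter _ _) hf.continuousAt).const_add _

theorem norm_jostF_le (hV : MemL11 V) {k : ℂ} (hk : 0 ≤ k.im) {b x : ℝ} (hx : b ≤ x) :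
    ‖jostF V k x‖ ≤ 2 * volterraConst V * negWeight b * Real.exp (-k.im * x) := by
  rw [jostF, norm_mul, Complex.norm_exp, mul_comm]
  have h1 : (I * k * x).re = -k.im * x := by simp
  rw [h1]
  refine mul_le_mul_of_nonneg_right ((norm_jostM_le hV hk x).trans ?_) (Real.exp_nonneg _)
  exact mul_le_mul_of_nonneg_left (negWeight_anti hx) (by have := volterraConst_pos V; positivity)

theorem norm_jostG_le (hV : MemL11 V) {k : ℂ} (hk : 0 ≤ k.im) {b x : ℝ} (hx : x ≤ b) :
    ‖jostG V k x‖ ≤ 2 * volterraConst (reflect V) * negWeight (-b) * Real.exp (k.im * x) := by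
  have := norm_jostF_le hV.reflect hk (neg_le_neg hx)
  rwa [neg_mul_neg] at this

theorem integrableOn_sq_norm_jostF (hV : MemL11 V) {k : ℂ} (hk : 0 < k.im) (b : ℝ) :
    IntegrableOn (fun x => ‖jostF V k x‖ ^ 2) (Ioi b) := by
  have h0 : 0 ≤ 2 * volterraConst V * negWeight b := by
    have := volterraConst_pos V
    have := negWeight_pos b
    positivity
  refine Integrable.mono' ((integrableOn_exp_mul_Ioi (a := -2 * k.im) (by linarith) b).const_mul
    ((2 * volterraConst V * negWeight b) ^ 2))
    ((isSol_jostF hV hk.le).continuous.norm.pow 2).aestronglyMeasurable ?_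
  refine (ae_restrict_iff' measurableSet_Ioi).2 (Eventually.of_forall fun x hx => ?_)
  rw [norm_pow, norm_norm]
  refine (pow_le_pow_left₀ (norm_nonneg _) (norm_jostF_le hV hk.le (mem_Ioi.1 hx).le) 2).trans_eq ?_
  rw [mul_pow, ← Real.exp_nat_mul]
  congr 2; push_cast; ring

theorem integrableOn_sq_norm_jostG (hV : MemL11 V) {k : ℂ} (hk : 0 < k.im) (b : ℝ) :
    IntegrableOn (fun x => ‖jostG V k x‖ ^ 2) (Iic b) := by
  refine Integrable.mono' ((integrableOn_exp_mul_Iic (a := 2 * k.im) (by linarith) b).const_mul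
    ((2 * volterraConst (reflect V) * negWeight (-b)) ^ 2))
    ((isSol_jostG hV hk.le).continuous.norm.pow 2).aestronglyMeasurable ?_
  refine (ae_restrict_iff' measurableSet_Iic).2 (Eventually.of_forall fun x hx => ?_)
  rw [norm_pow, norm_norm]
  refine (pow_le_pow_left₀ (norm_nonneg _) (norm_jostG_le hV hk.le (mem_Iic.1 hx)) 2).trans_eq ?_
  rw [mul_pow, ← Real.exp_nat_mul]
  congr 2; push_cast; ring

/-- A continuous function which is a multiple of `f₋` near `-∞` and of `f₊` near `+∞` is in `L²`. -/
theorem memLp_two_of_eq_mul_jost (hV : MemL11 V) {k : ℂ} (hk : 0 < k.im) {u : ℝ → ℂ}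
    (hu : Continuous u) {a b : ℝ} {c d : ℂ} (ha : ∀ x ≤ a, u x = c * jostG V k x)
    (hb : ∀ x, b < x → u x = d * jostF V k x) : MemLp u 2 volume := by
  rw [memLp_two_iff_integrable_sq_norm hu.aestronglyMeasurable, ← integrableOn_univ]
  have h1 : IntegrableOn (fun x => ‖u x‖ ^ 2) (Iic a) :=
    IntegrableOn.congr_fun ((integrableOn_sq_norm_jostG hV hk a).const_mul (‖c‖ ^ 2))
      (fun x hx => by simp only [ha x hx, norm_mul, mul_pow]) measurableSet_Iic
  have h2 : IntegrableOn (fun x => ‖u x‖ ^ 2) (Ioi b) :=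
    IntegrableOn.congr_fun ((integrableOn_sq_norm_jostF hV hk b).const_mul (‖d‖ ^ 2))
      (fun x hx => by simp only [hb x hx, norm_mul, mul_pow]) measurableSet_Ioi
  have h3 : IntegrableOn (fun x => ‖u x‖ ^ 2) (Icc a b) :=
    (hu.norm.pow 2).continuousOn.integrableOn_compact isCompact_Icc
  refine ((h1.union h3).union h2).mono_set fun x _ => ?_
  simp only [mem_union, mem_Iic, mem_Icc, mem_Ioi]
  by_cases h4 : x ≤ a
  · exact Or.inl (Or.inl h4)
  · by_cases h5 : b < x
    · exact Or.inr h5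
    · exact Or.inl (Or.inr ⟨(not_le.1 h4).le, not_lt.1 h5⟩)

theorem schrodingerGraph_of_isPrimitive {u v h : ℝ → ℂ} (hu : MemLp u 2 volume)
    (hd : ∀ x, HasDerivAt u (v x) x) (hv : IsPrimitive v fun x => (V x : ℂ) * u x - h x)
    {h' : L2R} (hh : (h' : ℝ → ℂ) =ᵐ[volume] h) : SchrodingerGraph V (hu.toLp u) h' := by
  refine ⟨u, hu.coeFn_toLp, v, hd, fun a b => ?_⟩
  rw [hv.sub_eq a b]
  refine intervalIntegral.integral_congr_ae (hh.mono fun x hx _ => ?_)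
  rw [hx]

/-- The integral kernel of `(L_V - k²)⁻¹`. -/
noncomputable def green (V : ℝ → ℝ) (k : ℂ) (x y : ℝ) : ℂ :=
  jostF V k (max x y) * jostG V k (min x y) / jostW V k

theorem integrable_mul_of_support {f g : ℝ → ℂ} (hf : Integrable f) (hg : Continuous g) {N : ℝ}
    (hN : ∀ x ∉ Icc (-N) N, f x = 0) : Integrable fun x => g x * f x := by
  have h : IntegrableOn (fun x => g x * f x) (Icc (-N) N) :=
    hf.integrableOn.continuousOn_mul hg.continuousOn isCompact_Icc
  refine (integrableOn_iff_integrable_of_support_subset fun x hx => ?_).1 h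
  by_contra hcon
  exact hx (by simp only [hN x hcon, mul_zero])

theorem integrable_of_memLp_two_of_support {f : ℝ → ℂ} (hf : MemLp f 2 volume) {N : ℝ}
    (hN : ∀ x ∉ Icc (-N) N, f x = 0) : Integrable f := by
  have h : IntegrableOn f (Icc (-N) N) := by
    have := (hf.restrict (Icc (-N) N)).integrable (by norm_num)
    exact this
  refine (integrableOn_iff_integrable_of_support_subset fun x hx => ?_).1 h
  by_contra hcon
  exact hx (hN x hcon)

/-- The integral is split at `y = x`, with the part over `(-∞, x]` written as total minus tail, so
that both variable integrals are tails with known primitives. -/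
theorem integral_green_mul (hV : MemL11 V) {k : ℂ} (hk : 0 ≤ k.im) {f : ℝ → ℂ}
    (hf : Integrable f) {N : ℝ} (hN : ∀ x ∉ Icc (-N) N, f x = 0) (x : ℝ) :
    ∫ y, green V k x y * f y = (jostW V k)⁻¹ *
      (jostF V k x * ((∫ y, jostG V k y * f y) - ∫ y in Ioi x, jostG V k y * f y) +
        jostG V k x * ∫ y in Ioi x, jostF V k y * f y) := by
  have hF := integrable_mul_of_support hf (isSol_jostF hV hk).continuous hN
  have hG := integrable_mul_of_support hf (isSol_jostG hV hk).continuous hN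
  have e1 : EqOn (fun y => green V k x y * f y)
      (fun y => (jostW V k)⁻¹ * jostF V k x * (jostG V k y * f y)) (Iic x) := fun y hy => by
    simp only [green, max_eq_left (mem_Iic.1 hy), min_eq_right (mem_Iic.1 hy)]; ring
  have e2 : EqOn (fun y => green V k x y * f y)
      (fun y => (jostW V k)⁻¹ * jostG V k x * (jostF V k y * f y)) (Ioi x) := fun y hy => by
    simp only [green, max_eq_right (mem_Ioi.1 hy).le, min_eq_left (mem_Ioi.1 hy).le]; ring
  have i1 : IntegrableOn (fun y => green V k x y * f y) (Iic x) :=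
    (hG.const_mul _).integrableOn.congr_fun e1.symm measurableSet_Iic
  have i2 : IntegrableOn (fun y => green V k x y * f y) (Ioi x) :=
    (hF.const_mul _).integrableOn.congr_fun e2.symm measurableSet_Ioi
  rw [← intervalIntegral.integral_Iic_add_Ioi i1 i2, setIntegral_congr_fun measurableSet_Iic e1,
    setIntegral_congr_fun measurableSet_Ioi e2, integral_const_mul, integral_const_mul,
    ← intervalIntegral.integral_Iic_add_Ioi (b := x) hG.integrableOn hG.integrableOn]
  ring

/-- Variation of constants: with `P' = f₋ f` and `Q' = -f₊ f`, the terms in `P'` and `Q'` cancel in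
the first derivative and produce `-f` in the second through the Wronskian. Because `f` has compact
support, `u` is a multiple of `f₋` on the left and of `f₊` on the right, both square integrable
there as `Im k > 0`. -/
theorem exists_resolvent (hV : MemL11 V) {k : ℂ} (hk : 0 < k.im) (hW : jostW V k ≠ 0) {f : ℝ → ℂ}
    (hf : MemLp f 2 volume) {N : ℝ} (hN : ∀ x ∉ Icc (-N) N, f x = 0) :
    ∃ hu : MemLp (fun x => ∫ y, green V k x y * f y) 2 volume,
      SchrodingerGraph V (hu.toLp _) (hf.toLp f + k ^ 2 • hu.toLp _) := by
  have hfi := integrable_of_memLp_two_of_support hf hN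
  have sF := isSol_jostF hV hk.le
  have sG := isSol_jostG hV hk.le
  have hF := integrable_mul_of_support hfi sF.continuous hN
  have hG := integrable_mul_of_support hfi sG.continuous hN
  set c := ∫ y, jostG V k y * f y with hc
  set P : ℝ → ℂ := fun x => c - ∫ y in Ioi x, jostG V k y * f y with hP
  set Q : ℝ → ℂ := fun x => ∫ y in Ioi x, jostF V k y * f y with hQ
  have pP : IsPrimitive P fun y => jostG V k y * f y := by
    obtain ⟨h1, h2⟩ := isPrimitive_neg_integral_Ioi (fun x => hG.integrableOn (s := Ioi x))
    exact ⟨h1, fun a b => by rw [← h2]; simp only [hP]; ring⟩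
  have pQ : IsPrimitive Q fun y => -1 * (jostF V k y * f y) := by
    have := (isPrimitive_neg_integral_Ioi (fun x => hF.integrableOn (s := Ioi x))).const_mul (-1)
    convert this using 2
    simp only [hQ]; ring
  set u : ℝ → ℂ := fun x => (jostW V k)⁻¹ * (jostF V k x * P x + jostG V k x * Q x) with hu
  set v : ℝ → ℂ := fun x => (jostW V k)⁻¹ * (jostFDeriv V k x * P x + jostGDeriv V k x * Q x)
    with hv
  have hueq : (fun x => ∫ y, green V k x y * f y) = u := by
    ext x
    exact integral_green_mul hV hk.le hfi hN x
  have hvc : Continuous v := continuous_const.mul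
    ((sF.prim.continuous.mul pP.continuous).add (sG.prim.continuous.mul pQ.continuous))
  have pu : IsPrimitive u v := by
    refine (((sF.isPrimitive.mul pP).add (sG.isPrimitive.mul pQ)).const_mul _).congr
      (Eventually.of_forall fun x => ?_)
    simp only [hv]; ring
  have pv : IsPrimitive v fun x => (V x : ℂ) * u x - (f x + k ^ 2 * u x) := by
    refine (((sF.prim.mul pP).add (sG.prim.mul pQ)).const_mul _).congr
      (Eventually.of_forall fun x => ?_)
    have h1 := wronskian_jostF_jostG hV hk.le x
    rw [wronskian] at h1
    simp only [hu]
    have h2 : (jostW V k)⁻¹ * jostW V k = 1 := inv_mul_cancel₀ hW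
    linear_combination (-(jostW V k)⁻¹ * f x) * h1 - f x * h2
  have hum : MemLp u 2 volume := by
    refine memLp_two_of_eq_mul_jost hV hk pu.continuous (a := -N - 1) (b := N)
      (c := (jostW V k)⁻¹ * ∫ y, jostF V k y * f y) (d := (jostW V k)⁻¹ * c)
      (fun x hx => ?_) fun x hx => ?_
    · have h1 : P x = 0 := by
        simp only [hP, hc, ← intervalIntegral.integral_Iic_add_Ioi (b := x) hG.integrableOn
          hG.integrableOn, add_sub_cancel_right]
        refine setIntegral_eq_zero_of_forall_eq_zero fun y hy => ?_
        rw [hN y, mul_zero]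
        intro h
        have := h.1
        have := mem_Iic.1 hy
        linarith
      have h2 : Q x = ∫ y, jostF V k y * f y := by
        refine setIntegral_eq_integral_of_forall_compl_eq_zero fun y hy => ?_
        rw [hN y, mul_zero]
        intro h
        have := h.1
        have := not_lt.1 (mt mem_Ioi.2 hy)
        linarith
      simp only [hu, h1, h2]; ring
    · have h3 : ∀ g : ℝ → ℂ, ∫ y in Ioi x, g y * f y = 0 := fun g => by
        refine setIntegral_eq_zero_of_forall_eq_zero fun y hy => ?_
        rw [hN y, mul_zero]
        intro h
        have := h.2
        have := mem_Ioi.1 hy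
        linarith
      simp only [hu, hP, hQ, h3]; ring
  rw [hueq]
  refine ⟨hum, schrodingerGraph_of_isPrimitive hum (pu.hasDerivAt hvc) pv ?_⟩
  filter_upwards [Lp.coeFn_add (hf.toLp f) (k ^ 2 • hum.toLp u), hf.coeFn_toLp,
    Lp.coeFn_smul (k ^ 2) (hum.toLp u), hum.coeFn_toLp] with x h1 h2 h3 h4
  rw [h1, Pi.add_apply, h2, h3, Pi.smul_apply, h4, smul_eq_mul]

end Resolvent

/-! ### The unitary group, its Laplace transform and the absence of bound states -/

section Group

open Complex

variable {V : ℝ → ℝ} {U : ℝ → (L2R ≃ₗᵢ[ℂ] L2R)}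

theorem IsSchrodingerGroup.map_zero (hU : IsSchrodingerGroup V U) (f : L2R) : U 0 f = f := by
  have h := hU.map_add 0 0 f
  rw [add_zero] at h
  exact ((U 0).injective h).symm

theorem IsSchrodingerGroup.hasDerivAt (hU : IsSchrodingerGroup V U) {f h : L2R}
    (hf : SchrodingerGraph V f h) (t : ℝ) :
    HasDerivAt (fun t => U t f) (I • U t h) t := by
  have h1 := (hU.generator f h).2 hf
  have h2 : HasDerivAt (fun s => U t (U s f)) (U t (I • h)) 0 :=
    ((U t).toContinuousLinearEquiv.toContinuousLinearMap.restrictScalars ℝ).hasFDerivAt.comp_hasDerivAt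
      0 h1
  have h3 : HasDerivAt (fun s => U t (U (s - t) f)) (U t (I • h)) t := by
    have := HasDerivAt.comp_sub_const (f := fun s => U t (U s f)) (f' := U t (I • h)) t t
      (by rwa [sub_self])
    exact this
  rw [map_smul] at h3
  refine h3.congr_of_eventuallyEq (Eventually.of_forall fun s => ?_)
  simp only
  rw [← hU.map_add]
  congr 2; ring

/-- For non-real `z`, the squared norm of `U t u` is constant by unitarity, while its derivative at
`0` is `-2 (Im z) ‖u‖²`. Symmetry of `L_V` is thus obtained from the group, with no integration by
parts at infinity. -/
theorem IsSchrodingerGroup.eq_zero_of_graph (hU : IsSchrodingerGroup V U)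
    (hE : HasNoBoundStates V) {u : L2R} {z : ℂ} (hu : SchrodingerGraph V u (z • u)) : u = 0 := by
  by_cases hz : z.im = 0
  · refine hE z.re u ?_
    rwa [show ((z.re : ℝ) : ℂ) = z from Complex.ext (by simp) (by simp [hz])]
  · have h1 := HasDerivAt.inner ℂ (hU.hasDerivAt hu 0) (hU.hasDerivAt hu 0)
    have h2 : (fun t => inner ℂ (U t u) (U t u)) = fun _ => inner ℂ u u := by
      ext t; rw [LinearIsometryEquiv.inner_map_map]
    rw [h2] at h1
    have h3 := h1.unique (hasDerivAt_const 0 (inner ℂ u u))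
    rw [hU.map_zero, hU.map_zero, smul_smul, inner_smul_left, inner_smul_right, ← add_mul] at h3
    rcases mul_eq_zero.1 h3 with h | h
    · refine absurd ?_ hz
      have := congrArg Complex.re h
      simp only [add_re, mul_re, conj_re, I_re, I_im, zero_re] at this
      linarith
    · exact inner_self_eq_zero.1 h

/-- A zero of `W` would make `f₊`, which decays at `+∞`, proportional near `-∞` to `f₋`, which
decays there. It would be an `L²` eigenfunction with eigenvalue `k²`, and it is nonzero because `m₊
→ 1`. -/
theorem jostW_ne_zero_of_im_pos (hV : MemL11 V) (hU : IsSchrodingerGroup V U)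
    (hE : HasNoBoundStates V) {k : ℂ} (hk : 0 < k.im) : jostW V k ≠ 0 := by
  intro h0
  have sF := isSol_jostF hV hk.le
  have sG := isSol_jostG hV hk.le
  have hne : ∀ {V : ℝ → ℝ}, MemL11 V → ∃ b, ∀ x ∈ Ici b, jostF V k x ≠ 0 := fun {V} hV => by
    obtain ⟨b, hb⟩ := eventually_atTop.1 ((tendsto_jostM hV hk.le).eventually_ne one_ne_zero)
    exact ⟨b, fun x hx => mul_ne_zero (Complex.exp_ne_zero _) (hb x hx)⟩
  obtain ⟨b, hb⟩ := hne hV.reflect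
  obtain ⟨b', hb'⟩ := hne hV
  obtain ⟨c, hc⟩ := exists_eq_const_mul sF.deriv sG.deriv
    (fun x => (wronskian_jostF_jostG hV hk.le x).trans h0) (b := -b) fun x hx =>
      hb (-x) (by simp only [mem_Ici, mem_Iic] at hx ⊢; linarith)
  have hm : MemLp (jostF V k) 2 volume := memLp_two_of_eq_mul_jost hV hk sF.continuous
    (a := -b) (b := 0) (c := c) (d := 1) (fun x hx => (hc x hx).1) fun x _ => (one_mul _).symm
  have hg : SchrodingerGraph V (hm.toLp _) (k ^ 2 • hm.toLp _) := by
    refine schrodingerGraph_of_isPrimitive hm sF.deriv (h := fun x => k ^ 2 * jostF V k x)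
      (sF.prim.congr (Eventually.of_forall fun x => ?_)) ?_
    · simp only; ring
    · filter_upwards [Lp.coeFn_smul (k ^ 2) (hm.toLp _), hm.coeFn_toLp] with x h1 h2
      rw [h1, Pi.smul_apply, h2, smul_eq_mul]
  have h1 := hU.eq_zero_of_graph hE hg
  have h2 : jostF V k =ᵐ[volume] fun _ => (0 : ℂ) := by
    have h3 := hm.coeFn_toLp
    rw [h1] at h3
    exact h3.symm.trans (Lp.coeFn_zero _ _ _)
  have h3 := (Continuous.ae_eq_iff_eq volume sF.continuous continuous_const).1 h2
  exact hb' b' self_mem_Ici (congrFun h3 b')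

theorem exists_le_norm_jostW_of_group (hV : MemL11 V) (hU : IsSchrodingerGroup V U)
    (hE : HasNoBoundStates V) : ∃ c > 0, ∀ k ∈ closedUHP, c * ‖k‖ ≤ ‖jostW V k‖ := by
  refine exists_le_norm_jostW hV (low_energy hV).1 fun k hk hk0 => ?_
  rcases (show 0 ≤ k.im from hk).lt_or_eq with h | h
  · exact jostW_ne_zero_of_im_pos hV hU hE h
  · have hk' : k = ((k.re : ℝ) : ℂ) := Complex.ext (by simp) (by simp [← h])
    rw [hk'] at hk0 ⊢
    exact (exists_scattering hV (by exact_mod_cast hk0)).1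

/-- The factor `e^{-izt}` cancels the term `z u`, so the integrand of the Laplace transform has an
explicit primitive in terms of the resolvent vector `u`. -/
theorem IsSchrodingerGroup.hasDerivAt_inner (hU : IsSchrodingerGroup V U) {f u : L2R} (h : L2R)
    {z : ℂ} (hu : SchrodingerGraph V u (f + z • u)) (t : ℝ) :
    HasDerivAt (fun t : ℝ => cexp (-I * z * t) * inner ℂ h (U t u))
      (I * (cexp (-I * z * t) * inner ℂ h (U t f))) t := by
  have h1 : HasDerivAt (fun t => inner ℂ h (U t u)) (inner ℂ h (I • U t (f + z • u))) t :=
    ((innerSL ℂ h).restrictScalars ℝ).hasFDerivAt.comp_hasDerivAt t (hU.hasDerivAt hu t)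
  refine ((hasDerivAt_cexp_mul (-I * z) t).mul h1).congr_deriv ?_
  rw [_root_.map_add, map_smul, inner_smul_right, inner_add_right, inner_smul_right]
  ring

theorem IsSchrodingerGroup.continuous_inner (hU : IsSchrodingerGroup V U) (h f : L2R) :
    Continuous fun t => inner ℂ h (U t f) :=
  continuous_const.inner (hU.continuous f)

theorem norm_cexp_neg_I_mul (z : ℂ) (t : ℝ) : ‖cexp (-I * z * t)‖ = Real.exp (z.im * t) := by
  rw [Complex.norm_exp]; simp

theorem norm_inner_group_le (U : ℝ → (L2R ≃ₗᵢ[ℂ] L2R)) (h f : L2R) (t : ℝ) :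
    ‖inner ℂ h (U t f)‖ ≤ ‖h‖ * ‖f‖ :=
  (norm_inner_le_norm _ _).trans_eq (by rw [LinearIsometryEquiv.norm_map])

theorem norm_cexp_mul_inner_le (U : ℝ → (L2R ≃ₗᵢ[ℂ] L2R)) (h f : L2R) (z : ℂ) (t : ℝ) :
    ‖cexp (-I * z * t) * inner ℂ h (U t f)‖ ≤ ‖h‖ * ‖f‖ * Real.exp (z.im * t) := by
  rw [norm_mul, norm_cexp_neg_I_mul, mul_comm]
  exact mul_le_mul_of_nonneg_right (norm_inner_group_le U h f t) (Real.exp_nonneg _)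

/-- The Laplace transform of the group over the positive half-line is the resolvent. -/
theorem IsSchrodingerGroup.integral_Ioi (hU : IsSchrodingerGroup V U) {f u : L2R} (h : L2R) {z : ℂ}
    (hz : z.im < 0) (hu : SchrodingerGraph V u (f + z • u)) :
    IntegrableOn (fun t : ℝ => cexp (-I * z * t) * inner ℂ h (U t f)) (Ioi 0) ∧
    ∫ t in Ioi (0 : ℝ), cexp (-I * z * t) * inner ℂ h (U t f) = I * inner ℂ h u := by
  have hi : IntegrableOn (fun t : ℝ => cexp (-I * z * t) * inner ℂ h (U t f)) (Ioi 0) := by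
    refine Integrable.mono' ((integrableOn_exp_mul_Ioi hz 0).const_mul (‖h‖ * ‖f‖))
      (Continuous.aestronglyMeasurable ((by fun_prop : Continuous fun t : ℝ =>
        cexp (-I * z * t)).mul (hU.continuous_inner h f)))
      (Eventually.of_forall fun t => norm_cexp_mul_inner_le U h f z t)
  refine ⟨hi, ?_⟩
  have hl : Tendsto (fun t : ℝ => cexp (-I * z * t) * inner ℂ h (U t u)) atTop (𝓝 0) := by
    refine squeeze_zero_norm (fun t => norm_cexp_mul_inner_le U h u z t) ?_
    have := (Real.tendsto_exp_atBot.comp (tendsto_id.const_mul_atTop_of_neg hz)).const_mul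
      (‖h‖ * ‖u‖)
    rwa [mul_zero] at this
  have := integral_Ioi_of_hasDerivAt_of_tendsto' (a := 0)
    (fun t _ => hU.hasDerivAt_inner h hu t) (hi.const_mul I) hl
  rw [integral_const_mul, hU.map_zero] at this
  simp only [ofReal_zero, mul_zero, Complex.exp_zero, one_mul, zero_sub] at this
  linear_combination (-I) * this + (∫ t in Ioi (0 : ℝ), cexp (-I * z * t) * inner ℂ h (U t f)) * I_sq

/-- The Laplace transform of the group over the negative half-line is the resolvent. -/
theorem IsSchrodingerGroup.integral_Iic (hU : IsSchrodingerGroup V U) {f u : L2R} (h : L2R) {z : ℂ}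
    (hz : 0 < z.im) (hu : SchrodingerGraph V u (f + z • u)) :
    IntegrableOn (fun t : ℝ => cexp (-I * z * t) * inner ℂ h (U t f)) (Iic 0) ∧
    ∫ t in Iic (0 : ℝ), cexp (-I * z * t) * inner ℂ h (U t f) = -(I * inner ℂ h u) := by
  have hi : IntegrableOn (fun t : ℝ => cexp (-I * z * t) * inner ℂ h (U t f)) (Iic 0) := by
    refine Integrable.mono' ((integrableOn_exp_mul_Iic hz 0).const_mul (‖h‖ * ‖f‖))
      (Continuous.aestronglyMeasurable ((by fun_prop : Continuous fun t : ℝ =>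
        cexp (-I * z * t)).mul (hU.continuous_inner h f)))
      (Eventually.of_forall fun t => norm_cexp_mul_inner_le U h f z t)
  refine ⟨hi, ?_⟩
  have hl : Tendsto (fun t : ℝ => cexp (-I * z * t) * inner ℂ h (U t u)) atBot (𝓝 0) := by
    refine squeeze_zero_norm (fun t => norm_cexp_mul_inner_le U h u z t) ?_
    have := (Real.tendsto_exp_atBot.comp (tendsto_id.const_mul_atBot hz)).const_mul
      (‖h‖ * ‖u‖)
    rwa [mul_zero] at this
  have := integral_Iic_of_hasDerivAt_of_tendsto' (a := 0)
    (fun t _ => hU.hasDerivAt_inner h hu t) (hi.const_mul I) hl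
  rw [integral_const_mul, hU.map_zero] at this
  simp only [ofReal_zero, mul_zero, Complex.exp_zero, one_mul, sub_zero] at this
  linear_combination (-I) * this + (∫ t in Iic (0 : ℝ), cexp (-I * z * t) * inner ℂ h (U t f)) * I_sq

end Group

/-! ### Boundary values of the resolvent kernel and the spectral density -/

section Green

open Complex

variable {V : ℝ → ℝ}

theorem neg_conj_mem_closedUHP {k : ℂ} (hk : k ∈ closedUHP) : -starRingEnd ℂ k ∈ closedUHP := by
  change 0 ≤ k.im at hk
  change 0 ≤ (-starRingEnd ℂ k).im
  simpa using hk

theorem jostW_neg_conj (hV : MemL11 V) {k : ℂ} (hk : k ∈ closedUHP) :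
    jostW V (-starRingEnd ℂ k) = starRingEnd ℂ (jostW V k) := by
  have hk' := neg_conj_mem_closedUHP hk
  have e1 : jostF V (-starRingEnd ℂ k) = fun x => starRingEnd ℂ (jostF V k x) :=
    funext (jostF_neg_conj hV hk)
  have e2 : jostG V (-starRingEnd ℂ k) = fun x => starRingEnd ℂ (jostG V k x) :=
    funext (jostG_neg_conj hV hk)
  have d1 : jostFDeriv V (-starRingEnd ℂ k) 0 = starRingEnd ℂ (jostFDeriv V k 0) := by
    have h1 := (isSol_jostF hV hk').deriv 0
    rw [e1] at h1
    exact h1.unique ((isSol_jostF hV hk).conj.deriv 0)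
  have d2 : jostGDeriv V (-starRingEnd ℂ k) 0 = starRingEnd ℂ (jostGDeriv V k 0) := by
    have h1 := (isSol_jostG hV hk').deriv 0
    rw [e2] at h1
    exact h1.unique ((isSol_jostG hV hk).conj.deriv 0)
  simp only [jostW, wronskian, e1, e2, d1, d2, map_sub, map_mul]

theorem green_neg_conj (hV : MemL11 V) {k : ℂ} (hk : k ∈ closedUHP) (x y : ℝ) :
    green V (-starRingEnd ℂ k) x y = starRingEnd ℂ (green V k x y) := by
  simp only [green, jostF_neg_conj hV hk, jostG_neg_conj hV hk, jostW_neg_conj hV hk, map_div₀,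
    map_mul]

theorem continuousOn_jostF (hV : MemL11 V) (x : ℝ) :
    ContinuousOn (fun k => jostF V k x) closedUHP :=
  (by fun_prop : Continuous fun k : ℂ => cexp (I * k * x)).continuousOn.mul (continuousOn_jostM hV x)

theorem continuousOn_jostG (hV : MemL11 V) (x : ℝ) :
    ContinuousOn (fun k => jostG V k x) closedUHP :=
  continuousOn_jostF hV.reflect (-x)

theorem continuous_green (hV : MemL11 V) {k : ℂ} (hk : k ∈ closedUHP) :
    Continuous fun p : ℝ × ℝ => green V k p.1 p.2 :=
  (((isSol_jostF hV hk).continuous.comp (continuous_fst.max continuous_snd)).mul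
    ((isSol_jostG hV hk).continuous.comp (continuous_fst.min continuous_snd))).div_const _

/-- `W(k) ≠ 0` in the closed upper half-plane, quantitatively. -/
def NonResonant (V : ℝ → ℝ) (c : ℝ) : Prop :=
  0 < c ∧ ∀ k ∈ closedUHP, c * ‖k‖ ≤ ‖jostW V k‖

theorem NonResonant.ne_zero {c : ℝ} (h : NonResonant V c) {k : ℂ} (hk : k ∈ closedUHP)
    (h0 : k ≠ 0) : jostW V k ≠ 0 :=
  norm_pos_iff.1 ((mul_pos h.1 (norm_pos_iff.2 h0)).trans_le (h.2 k hk))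

/-- The constant in the local bound of the resolvent kernel. -/
noncomputable def greenConst (V : ℝ → ℝ) (c N : ℝ) : ℝ :=
  (2 * volterraConst V * negWeight (-N)) * (2 * volterraConst (reflect V) * negWeight (-N)) / c

/-- The two exponentials combine to `e^{-Im k |x - y|} ≤ 1`, so the bound persists up to the real
axis. Only one variable need be bounded, since then the maximum is at least `-N` and the minimum at
most `N`. -/
theorem norm_green_le (hV : MemL11 V) {c : ℝ} (hc : NonResonant V c) {k : ℂ} (hk : k ∈ closedUHP)
    (h0 : k ≠ 0) {N x y : ℝ} (hx : x ∈ Icc (-N) N) :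
    ‖green V k x y‖ ≤ greenConst V c N / ‖k‖ := by
  have h1 := norm_jostF_le hV hk (b := -N) (x := max x y) (le_max_of_le_left hx.1)
  have h2 := norm_jostG_le hV hk (b := N) (x := min x y) (min_le_of_left_le hx.2)
  have h3 : Real.exp (-k.im * max x y) * Real.exp (k.im * min x y) ≤ 1 := by
    rw [← Real.exp_add, Real.exp_le_one_iff]
    have h4 : 0 ≤ k.im := hk
    have h5 : min x y ≤ max x y := min_le_max
    nlinarith
  have a1 := volterraConst_pos V
  have a2 := volterraConst_pos (reflect V)
  have a3 := negWeight_pos (-N)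
  have hk0 := norm_pos_iff.2 h0
  have hc0 := hc.1
  rw [green, norm_div, norm_mul, greenConst, div_div]
  refine div_le_div₀ (by positivity) ?_ (by positivity) (hc.2 k hk)
  refine (mul_le_mul h1 h2 (norm_nonneg _) (by positivity)).trans ?_
  calc _ = (2 * volterraConst V * negWeight (-N)) * (2 * volterraConst (reflect V) * negWeight (-N))
        * (Real.exp (-k.im * max x y) * Real.exp (k.im * min x y)) := by ring
    _ ≤ _ := mul_le_of_le_one_right (by positivity) h3

theorem continuousOn_green (hV : MemL11 V) {c : ℝ} (hc : NonResonant V c) (x y : ℝ) :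
    ContinuousOn (fun k => green V k x y) (closedUHP \ {0}) :=
  (((continuousOn_jostF hV _).mul (continuousOn_jostG hV _)).mono sdiff_subset).div
    ((continuousOn_jostW hV).mono sdiff_subset) fun _ hk => hc.ne_zero hk.1 hk.2

/-- The imaginary part of the resolvent kernel for real `k` is the spectral density. -/
theorem im_green_eq (hV : MemL11 V) {κ : ℝ} (hκ : 0 < κ) (x y : ℝ) :
    ((green V κ x y).im : ℂ) = (Real.pi / (2 * κ) : ℝ) *
      (psi V x κ * starRingEnd ℂ (psi V y κ) + psi V x (-κ) * starRingEnd ℂ (psi V y (-κ))) := by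
  obtain ⟨hW, -, R, hR, hTR⟩ := exists_scattering hV hκ.ne'
  have hπ : (Real.pi : ℂ) ≠ 0 := by exact_mod_cast Real.pi_ne_zero
  have hκ' : (κ : ℂ) ≠ 0 := by exact_mod_cast hκ.ne'
  set T := -2 * I * (κ : ℂ) / jostW V κ with hT
  have hT' : transCoeff V κ = T := rfl
  have hTR' : T * starRingEnd ℂ T + R * starRingEnd ℂ R = 1 := by
    rw [mul_conj, mul_conj, normSq_eq_norm_sq, normSq_eq_norm_sq]
    exact_mod_cast hTR
  -- This follows from the scattering relation at `x` and at `y` together with `|T|² + |R|² = 1`.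
  -- The right-hand side becomes its conjugate when `x` and `y` are exchanged, which removes the
  -- maximum and minimum from the kernel.
  have key : ∀ x y : ℝ, T * jostF V κ x * jostG V κ y + starRingEnd ℂ (T * jostF V κ x * jostG V κ y)
      = T * starRingEnd ℂ T * (jostF V κ x * starRingEnd ℂ (jostF V κ y) +
        jostG V κ x * starRingEnd ℂ (jostG V κ y)) := fun x y => by
    have h1 := hR x
    have h2 := congrArg (starRingEnd ℂ) (hR x)
    have h3 := congrArg (starRingEnd ℂ) (hR y)
    simp only [map_mul, map_add, conj_conj] at h2 h3 ⊢
    linear_combination (jostG V κ y - starRingEnd ℂ T * starRingEnd ℂ (jostF V κ y)) * h1 +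
      starRingEnd ℂ (jostG V κ y) * h2 -
      (starRingEnd ℂ (jostG V κ x) + R * jostG V κ x) * h3 -
      jostG V κ x * starRingEnd ℂ (jostG V κ y) * hTR'
  have key2 : T * jostF V κ (max x y) * jostG V κ (min x y) +
      starRingEnd ℂ (T * jostF V κ (max x y) * jostG V κ (min x y))
      = T * starRingEnd ℂ T * (jostF V κ x * starRingEnd ℂ (jostF V κ y) +
        jostG V κ x * starRingEnd ℂ (jostG V κ y)) := by
    rcases le_total y x with h | h
    · rw [max_eq_left h, min_eq_right h]; exact key x y
    · rw [max_eq_right h, min_eq_left h]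
      have := congrArg (starRingEnd ℂ) (key y x)
      simp only [map_mul, map_add, conj_conj] at this ⊢
      linear_combination this
  have hg : green V κ x y = T * jostF V κ (max x y) * jostG V κ (min x y) * (I / (2 * κ)) := by
    rw [green, hT]
    field_simp
    linear_combination (jostF V κ (max x y) * jostG V κ (min x y)) * I_sq
  have him : ∀ w : ℂ, (((w * (I / (2 * κ))).im : ℝ) : ℂ) =
      (w + starRingEnd ℂ w) * (1 / (4 * κ)) := fun w => by
    have : w * (I / (2 * κ)) = ((1 / (2 * κ) : ℝ) : ℂ) * (w * I) := by push_cast; ring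
    rw [this, im_ofReal_mul, add_conj]
    simp only [mul_I_im]
    push_cast
    field_simp
    ring
  have hs : ((Real.sqrt (2 * Real.pi) : ℝ) : ℂ)⁻¹ * ((Real.sqrt (2 * Real.pi) : ℝ) : ℂ)⁻¹ =
      1 / (2 * Real.pi) := by
    rw [← mul_inv, ← ofReal_mul, Real.mul_self_sqrt (by positivity)]
    push_cast; ring
  rw [hg, him, key2, psi_of_pos hV x hκ, psi_of_pos hV y hκ, psi_neg_of_pos hV x hκ,
    psi_neg_of_pos hV y hκ, hT']
  simp only [map_mul, map_inv₀, conj_ofReal]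
  set s := ((Real.sqrt (2 * Real.pi) : ℝ) : ℂ)⁻¹
  push_cast
  have e : (Real.pi / (2 * κ) : ℂ) * (s * s) = 1 / (4 * κ) := by
    rw [hs]; field_simp; norm_num
  linear_combination (-(T * starRingEnd ℂ T * (jostF V κ x * starRingEnd ℂ (jostF V κ y) +
        jostG V κ x * starRingEnd ℂ (jostG V κ y)))) * e

theorem continuous_psi (hV : MemL11 V) {k : ℝ} (hk : k ≠ 0) : Continuous fun x => psi V x k := by
  rcases lt_or_gt_of_ne hk with h | h
  · have e : (fun x => psi V x k) = fun x => ((Real.sqrt (2 * Real.pi) : ℝ) : ℂ)⁻¹ *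
        (transCoeff V (-k : ℝ) * jostG V (-k : ℝ) x) := by
      ext x
      rw [← psi_neg_of_pos hV x (neg_pos.2 h), neg_neg]
    rw [e]
    exact continuous_const.mul (continuous_const.mul
      (isSol_jostG hV (real_mem_closedUHP (-k))).continuous)
  · have e : (fun x => psi V x k) = fun x => ((Real.sqrt (2 * Real.pi) : ℝ) : ℂ)⁻¹ *
        (transCoeff V k * jostF V k x) := funext fun x => psi_of_pos hV x h
    rw [e]
    exact continuous_const.mul (continuous_const.mul
      (isSol_jostF hV (real_mem_closedUHP k)).continuous)

end Green

/-! ### The density as a sesquilinear form, and its relation to the group -/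

section SpectralDensity

open Complex

variable {V : ℝ → ℝ} {h f : ℝ → ℂ} {N : ℝ}

/-- The sesquilinear form of the imaginary part of the resolvent kernel. -/
noncomputable def imGreenForm (V : ℝ → ℝ) (h f : ℝ → ℂ) (k : ℂ) : ℂ :=
  ∫ p : ℝ × ℝ, ((green V k p.1 p.2).im : ℂ) * (starRingEnd ℂ (h p.1) * f p.2)

theorem integrable_conj_comp (hh : Integrable h) : Integrable fun x => starRingEnd ℂ (h x) :=
  (conjCLE.integrable_comp_iff (φ := h)).2 hh

theorem integrable_conj_mul_prod (hh : Integrable h) (hf : Integrable f) :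
    Integrable (fun p : ℝ × ℝ => starRingEnd ℂ (h p.1) * f p.2) :=
  Integrable.mul_prod (integrable_conj_comp hh) hf

theorem conj_mul_prod_eq_zero (hhN : ∀ x ∉ Icc (-N) N, h x = 0) (hfN : ∀ x ∉ Icc (-N) N, f x = 0)
    {p : ℝ × ℝ} (hp : ¬(p.1 ∈ Icc (-N) N ∧ p.2 ∈ Icc (-N) N)) :
    starRingEnd ℂ (h p.1) * f p.2 = 0 := by
  rcases not_and_or.1 hp with hp | hp
  · rw [hhN _ hp, map_zero, zero_mul]
  · rw [hfN _ hp, mul_zero]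

theorem norm_green_mul_le (hV : MemL11 V) {c : ℝ} (hc : NonResonant V c)
    (hhN : ∀ x ∉ Icc (-N) N, h x = 0) (hfN : ∀ x ∉ Icc (-N) N, f x = 0) {k : ℂ}
    (hk : k ∈ closedUHP) (h0 : k ≠ 0) (p : ℝ × ℝ) :
    ‖green V k p.1 p.2 * (starRingEnd ℂ (h p.1) * f p.2)‖ ≤
      greenConst V c N / ‖k‖ * ‖starRingEnd ℂ (h p.1) * f p.2‖ := by
  by_cases hp : p.1 ∈ Icc (-N) N ∧ p.2 ∈ Icc (-N) N
  · rw [norm_mul]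
    exact mul_le_mul_of_nonneg_right (norm_green_le hV hc hk h0 hp.1) (norm_nonneg _)
  · rw [conj_mul_prod_eq_zero hhN hfN hp]; simp

theorem norm_im_green_mul_le (hV : MemL11 V) {c : ℝ} (hc : NonResonant V c)
    (hhN : ∀ x ∉ Icc (-N) N, h x = 0) (hfN : ∀ x ∉ Icc (-N) N, f x = 0) {k : ℂ}
    (hk : k ∈ closedUHP) (h0 : k ≠ 0) (p : ℝ × ℝ) :
    ‖((green V k p.1 p.2).im : ℂ) * (starRingEnd ℂ (h p.1) * f p.2)‖ ≤
      greenConst V c N / ‖k‖ * ‖starRingEnd ℂ (h p.1) * f p.2‖ := by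
  refine le_trans ?_ (norm_green_mul_le hV hc hhN hfN hk h0 p)
  rw [norm_mul, norm_mul (green V k p.1 p.2)]
  refine mul_le_mul_of_nonneg_right ?_ (norm_nonneg _)
  rw [norm_real]
  exact abs_im_le_norm _

theorem integrable_green_mul (hV : MemL11 V) {c : ℝ} (hc : NonResonant V c)
    (hh : Integrable h) (hf : Integrable f)
    (hhN : ∀ x ∉ Icc (-N) N, h x = 0) (hfN : ∀ x ∉ Icc (-N) N, f x = 0) {k : ℂ}
    (hk : k ∈ closedUHP) (h0 : k ≠ 0) :
    Integrable fun p : ℝ × ℝ => green V k p.1 p.2 * (starRingEnd ℂ (h p.1) * f p.2) :=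
  Integrable.mono' ((integrable_conj_mul_prod hh hf).norm.const_mul _)
    ((continuous_green hV hk).aestronglyMeasurable.mul
      (integrable_conj_mul_prod hh hf).aestronglyMeasurable)
    (Eventually.of_forall (norm_green_mul_le hV hc hhN hfN hk h0))

theorem norm_imGreenForm_le (hV : MemL11 V) {c : ℝ} (hc : NonResonant V c)
    (hh : Integrable h) (hf : Integrable f)
    (hhN : ∀ x ∉ Icc (-N) N, h x = 0) (hfN : ∀ x ∉ Icc (-N) N, f x = 0) {k : ℂ}
    (hk : k ∈ closedUHP) (h0 : k ≠ 0) :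
    ‖imGreenForm V h f k‖ ≤
      greenConst V c N * (∫ p : ℝ × ℝ, ‖starRingEnd ℂ (h p.1) * f p.2‖) / ‖k‖ := by
  refine (norm_integral_le_of_norm_le ((integrable_conj_mul_prod hh hf).norm.const_mul _)
    (Eventually.of_forall (norm_im_green_mul_le hV hc hhN hfN hk h0))).trans_eq ?_
  rw [integral_const_mul]; ring

theorem tendsto_imGreenForm (hV : MemL11 V) {c : ℝ} (hc : NonResonant V c)
    (hh : Integrable h) (hf : Integrable f)
    (hhN : ∀ x ∉ Icc (-N) N, h x = 0) (hfN : ∀ x ∉ Icc (-N) N, f x = 0) {k₀ : ℂ}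
    (hk₀ : k₀ ∈ closedUHP) (h0 : k₀ ≠ 0) :
    Tendsto (imGreenForm V h f) (𝓝[closedUHP] k₀) (𝓝 (imGreenForm V h f k₀)) := by
  have hr : 0 < ‖k₀‖ / 2 := half_pos (norm_pos_iff.2 h0)
  have hev : ∀ᶠ k in 𝓝[closedUHP] k₀, k ∈ closedUHP ∧ ‖k₀‖ / 2 < ‖k‖ :=
    eventually_mem_nhdsWithin.and (eventually_nhdsWithin_of_eventually_nhds
      ((continuous_norm (E := ℂ)).continuousAt.eventually (lt_mem_nhds (half_lt_self (norm_pos_iff.2 h0)))))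
  have hgc : 0 ≤ greenConst V c N := by
    have a1 := volterraConst_pos V
    have a2 := volterraConst_pos (reflect V)
    have a3 := negWeight_pos (-N)
    have := hc.1
    rw [greenConst]; positivity
  refine tendsto_integral_filter_of_dominated_convergence
    (fun p => greenConst V c N / (‖k₀‖ / 2) * ‖starRingEnd ℂ (h p.1) * f p.2‖) ?_ ?_
    ((integrable_conj_mul_prod hh hf).norm.const_mul _) (Eventually.of_forall fun p => ?_)
  · filter_upwards [hev] with k hk
    exact ((continuous_ofReal.comp (continuous_im.comp
      (continuous_green hV hk.1))).aestronglyMeasurable.mul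
      (integrable_conj_mul_prod hh hf).aestronglyMeasurable)
  · filter_upwards [hev] with k hk
    refine Eventually.of_forall fun p => ?_
    refine (norm_im_green_mul_le hV hc hhN hfN hk.1 (norm_pos_iff.1 (hr.trans hk.2)) p).trans ?_
    refine mul_le_mul_of_nonneg_right ?_ (norm_nonneg _)
    exact div_le_div_of_nonneg_left hgc hr hk.2.le
  · refine Tendsto.mul_const _ ?_
    refine (continuous_ofReal.comp continuous_im).continuousAt.tendsto.comp ?_
    have h1 : ContinuousWithinAt (fun k => green V k p.1 p.2) (closedUHP \ {0}) k₀ :=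
      continuousOn_green hV hc p.1 p.2 k₀ ⟨hk₀, h0⟩
    refine h1.tendsto.mono_left (le_of_eq ?_)
    rw [sdiff_eq, nhdsWithin_inter_of_mem' (nhdsWithin_le_nhds (isOpen_compl_singleton.mem_nhds h0))]

/-- The spectral density in terms of the distorted Fourier transform. -/
theorem imGreenForm_eq (hV : MemL11 V) (hh : Integrable h) (hf : Integrable f)
    (hhN : ∀ x ∉ Icc (-N) N, h x = 0) (hfN : ∀ x ∉ Icc (-N) N, f x = 0) {κ : ℝ} (hκ : 0 < κ) :
    imGreenForm V h f κ = (Real.pi / (2 * κ) : ℝ) *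
      (starRingEnd ℂ (distortedFourierIntegral V h κ) * distortedFourierIntegral V f κ +
      starRingEnd ℂ (distortedFourierIntegral V h (-κ)) * distortedFourierIntegral V f (-κ)) := by
  have hint : ∀ k : ℝ, k ≠ 0 →
      Integrable (fun p : ℝ × ℝ => starRingEnd ℂ (starRingEnd ℂ (psi V p.1 k) * h p.1) *
        (starRingEnd ℂ (psi V p.2 k) * f p.2)) := fun k hk =>
    Integrable.mul_prod (integrable_conj_comp (integrable_mul_of_support hh
      (continuous_conj.comp (continuous_psi hV hk)) hhN)) (integrable_mul_of_support hf
      (continuous_conj.comp (continuous_psi hV hk)) hfN)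
  have hprod : ∀ k : ℝ, starRingEnd ℂ (distortedFourierIntegral V h k) *
      distortedFourierIntegral V f k = ∫ p : ℝ × ℝ, starRingEnd ℂ (starRingEnd ℂ (psi V p.1 k) *
        h p.1) * (starRingEnd ℂ (psi V p.2 k) * f p.2) := fun k => by
    rw [distortedFourierIntegral, distortedFourierIntegral, ← integral_conj, ← integral_prod_mul]
    rfl
  rw [hprod, hprod, ← integral_add (hint κ hκ.ne') (hint (-κ) (neg_ne_zero.2 hκ.ne')),
    ← integral_const_mul, imGreenForm]
  refine integral_congr_ae (Eventually.of_forall fun p => ?_)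
  simp only [im_green_eq hV hκ, map_mul, conj_conj]
  ring

theorem exists_inner_resolvent (hV : MemL11 V) {c : ℝ} (hc : NonResonant V c)
    (hh : MemLp h 2 volume) (hf : MemLp f 2 volume)
    (hhN : ∀ x ∉ Icc (-N) N, h x = 0) (hfN : ∀ x ∉ Icc (-N) N, f x = 0) {k : ℂ} (hk : 0 < k.im) :
    ∃ u : L2R, SchrodingerGraph V u (hf.toLp f + k ^ 2 • u) ∧ inner ℂ (hh.toLp h) u =
      ∫ p : ℝ × ℝ, green V k p.1 p.2 * (starRingEnd ℂ (h p.1) * f p.2) := by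
  have h0 : k ≠ 0 := fun h => by rw [h] at hk; simp at hk
  obtain ⟨hu, hg⟩ := exists_resolvent hV hk (hc.ne_zero hk.le h0) hf hfN
  refine ⟨_, hg, ?_⟩
  rw [Measure.volume_eq_prod, integral_prod _ (by
    rw [← Measure.volume_eq_prod]
    exact integrable_green_mul hV hc (integrable_of_memLp_two_of_support hh hhN)
      (integrable_of_memLp_two_of_support hf hfN) hhN hfN hk.le h0), L2.inner_def]
  refine integral_congr_ae ?_
  filter_upwards [hh.coeFn_toLp, hu.coeFn_toLp] with x h1 h2
  rw [h1, h2, RCLike.inner_apply, mul_comm, ← integral_const_mul]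
  refine integral_congr_ae (Eventually.of_forall fun y => ?_)
  simp only
  ring

/-- The half-line `t < 0` gives the resolvent at `k² = λ + iε`, and `t > 0` the one at the conjugate
energy, with square root `-conj k`. The two kernels are conjugate to each other, so their difference
is `2i` times the imaginary part. -/
theorem IsSchrodingerGroup.integral_exp_mul_inner {U : ℝ → (L2R ≃ₗᵢ[ℂ] L2R)}
    (hU : IsSchrodingerGroup V U) (hV : MemL11 V) {c : ℝ} (hc : NonResonant V c)
    (hh : MemLp h 2 volume) (hf : MemLp f 2 volume)
    (hhN : ∀ x ∉ Icc (-N) N, h x = 0) (hfN : ∀ x ∉ Icc (-N) N, f x = 0) {k : ℂ} (hk : 0 < k.im)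
    {lam ε : ℝ} (hε : 0 < ε) (hkl : k ^ 2 = lam + ε * I) :
    ∫ t : ℝ, cexp (-I * lam * t) * Real.exp (-ε * |t|) * inner ℂ (hh.toLp h) (U t (hf.toLp f)) =
      2 * imGreenForm V h f k := by
  have h0 : k ≠ 0 := fun h => by rw [h] at hk; simp at hk
  have hk' : 0 < (-starRingEnd ℂ k).im := by simpa using hk
  obtain ⟨u, hu, hui⟩ := exists_inner_resolvent hV hc hh hf hhN hfN hk
  obtain ⟨w, hw, hwi⟩ := exists_inner_resolvent hV hc hh hf hhN hfN hk'
  have hi := integrable_green_mul hV hc (integrable_of_memLp_two_of_support hh hhN)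
    (integrable_of_memLp_two_of_support hf hfN) hhN hfN hk.le h0
  have hi' := integrable_green_mul hV hc (integrable_of_memLp_two_of_support hh hhN)
    (integrable_of_memLp_two_of_support hf hfN) hhN hfN hk'.le
    (neg_ne_zero.2 ((map_ne_zero _).2 h0))
  have hkl' : (-starRingEnd ℂ k) ^ 2 = lam - ε * I := by
    rw [neg_sq, ← map_pow, hkl]; simp [sub_eq_add_neg]
  rw [hkl] at hu
  rw [hkl'] at hw
  obtain ⟨i1, e1⟩ := hU.integral_Iic (hh.toLp h) (by simpa using hε) hu
  obtain ⟨i2, e2⟩ := hU.integral_Ioi (hh.toLp h) (by simpa using hε) hw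
  have c1 : EqOn (fun t : ℝ => cexp (-I * (lam + ε * I) * t) * inner ℂ (hh.toLp h) (U t (hf.toLp f)))
      (fun t : ℝ => cexp (-I * lam * t) * Real.exp (-ε * |t|) *
        inner ℂ (hh.toLp h) (U t (hf.toLp f))) (Iic 0) := fun t ht => by
    simp only [abs_of_nonpos (mem_Iic.1 ht), ofReal_exp, ← Complex.exp_add]
    congr 2
    push_cast
    linear_combination (-ε * t : ℂ) * I_sq
  have c2 : EqOn (fun t : ℝ => cexp (-I * (lam - ε * I) * t) * inner ℂ (hh.toLp h) (U t (hf.toLp f)))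
      (fun t : ℝ => cexp (-I * lam * t) * Real.exp (-ε * |t|) *
        inner ℂ (hh.toLp h) (U t (hf.toLp f))) (Ioi 0) := fun t ht => by
    simp only [abs_of_pos (mem_Ioi.1 ht), ofReal_exp, ← Complex.exp_add]
    congr 2
    push_cast
    linear_combination (ε * t : ℂ) * I_sq
  rw [setIntegral_congr_fun measurableSet_Iic c1] at e1
  rw [setIntegral_congr_fun measurableSet_Ioi c2] at e2
  rw [← intervalIntegral.integral_Iic_add_Ioi (i1.congr_fun c1 measurableSet_Iic)
    (i2.congr_fun c2 measurableSet_Ioi), e1, e2, hui, hwi, imGreenForm]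
  have e3 : ∀ a b : ℂ, -(I * a) + I * b = -I * (a - b) := fun a b => by ring
  rw [e3, ← integral_sub hi hi', ← integral_const_mul, ← integral_const_mul]
  refine integral_congr_ae (Eventually.of_forall fun p => ?_)
  simp only
  rw [green_neg_conj hV hk.le, ← sub_mul, Complex.sub_conj]
  push_cast
  linear_combination (-2 * ((green V k p.1 p.2).im : ℂ) * (starRingEnd ℂ (h p.1) * f p.2)) * I_sq

end SpectralDensity

/-! ### The square root in the upper half-plane -/

section UpperSqrt

open Complex

/-- The square root with values in the closed upper half-plane. -/
noncomputable def sqrtUHP (w : ℂ) : ℂ := cexp (Complex.log w / 2)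

theorem sqrtUHP_sq {w : ℂ} (hw : w ≠ 0) : sqrtUHP w ^ 2 = w := by
  rw [sqrtUHP, ← Complex.exp_nat_mul]
  convert Complex.exp_log hw using 2
  push_cast; ring

theorem norm_sqrtUHP {w : ℂ} (hw : w ≠ 0) : ‖sqrtUHP w‖ = Real.sqrt ‖w‖ := by
  conv_rhs => rw [← sqrtUHP_sq hw, norm_pow, Real.sqrt_sq (norm_nonneg _)]

theorem sqrtUHP_im (w : ℂ) :
    (sqrtUHP w).im = Real.exp ((Complex.log w / 2).re) * Real.sin (arg w / 2) := by
  rw [sqrtUHP, Complex.exp_im]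
  congr 2
  rw [show Complex.log w / 2 = Complex.log w / (2 : ℝ) by norm_num, Complex.div_ofReal_im, log_im]

theorem sqrtUHP_mem_closedUHP {w : ℂ} (hw : 0 ≤ w.im) : sqrtUHP w ∈ closedUHP := by
  change 0 ≤ (sqrtUHP w).im
  rw [sqrtUHP_im]
  have h1 : 0 ≤ arg w := arg_nonneg_iff.2 hw
  have h2 := arg_le_pi w
  exact mul_nonneg (Real.exp_nonneg _)
    (Real.sin_nonneg_of_nonneg_of_le_pi (by linarith) (by linarith [Real.pi_pos]))

theorem sqrtUHP_im_pos {w : ℂ} (hw : 0 < w.im) : 0 < (sqrtUHP w).im := by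
  rw [sqrtUHP_im]
  have h1 : 0 < arg w := (arg_nonneg_iff.2 hw.le).lt_of_ne fun h => by
    have := arg_eq_zero_iff.1 h.symm
    rw [this.2] at hw
    exact lt_irrefl _ hw
  have h2 := arg_le_pi w
  exact mul_pos (Real.exp_pos _)
    (Real.sin_pos_of_pos_of_lt_pi (by linarith) (by linarith [Real.pi_pos]))

theorem sqrtUHP_ne_zero (w : ℂ) : sqrtUHP w ≠ 0 := Complex.exp_ne_zero _

/-- The principal logarithm jumps across the negative axis but is continuous there from above, which
is the side of approach. -/
theorem tendsto_sqrtUHP {x : ℝ} (hx : x ≠ 0) :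
    Tendsto (fun ε : ℝ => sqrtUHP (x + ε * I)) (𝓝[>] 0) (𝓝[closedUHP] (sqrtUHP x)) := by
  have h1 : Tendsto (fun ε : ℝ => (x + ε * I : ℂ)) (𝓝[>] 0) (𝓝[{z : ℂ | 0 ≤ z.im}] x) := by
    refine tendsto_nhdsWithin_iff.2 ⟨?_, ?_⟩
    · have : Continuous fun ε : ℝ => (x + ε * I : ℂ) := by fun_prop
      have h := this.tendsto 0
      simp only [ofReal_zero, zero_mul, add_zero] at h
      exact h.mono_left nhdsWithin_le_nhds
    · filter_upwards [self_mem_nhdsWithin] with ε hε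
      simpa using (mem_Ioi.1 hε).le
  have h2 : ContinuousWithinAt Complex.log {z : ℂ | 0 ≤ z.im} x := by
    rcases lt_or_gt_of_ne hx with h | h
    · exact continuousWithinAt_log_of_re_neg_of_im_zero (by simpa using h) (by simp)
    · exact (continuousAt_clog (ofReal_mem_slitPlane.2 h)).continuousWithinAt
  refine tendsto_nhdsWithin_iff.2 ⟨?_, ?_⟩
  · exact (Complex.continuous_exp.tendsto _).comp ((h2.tendsto.comp h1).div_const 2)
  · filter_upwards [self_mem_nhdsWithin] with ε hε
    exact sqrtUHP_mem_closedUHP (by simpa using (mem_Ioi.1 hε).le)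

theorem sqrtUHP_ofReal_sq {κ : ℝ} (hκ : 0 < κ) : sqrtUHP ((κ ^ 2 : ℝ) : ℂ) = κ := by
  rw [sqrtUHP, ← ofReal_log (by positivity), Real.log_pow]
  rw [show (((2 : ℕ) * Real.log κ : ℝ) : ℂ) / 2 = ((Real.log κ : ℝ) : ℂ) by push_cast; ring,
    ← ofReal_exp, Real.exp_log hκ]

theorem neg_conj_sqrtUHP_of_neg {x : ℝ} (hx : x < 0) :
    -starRingEnd ℂ (sqrtUHP x) = sqrtUHP x := by
  have h : sqrtUHP x = Real.exp (Real.log x / 2) * I := by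
    rw [sqrtUHP, Complex.log, arg_ofReal_of_neg hx, norm_real, Real.norm_eq_abs, Real.log_abs,
      add_div, Complex.exp_add, ofReal_exp]
    congr 1
    · push_cast; rfl
    · rw [mul_div_right_comm, exp_pi_div_two_mul_I]
  rw [h, map_mul, conj_ofReal, conj_I]
  ring

end UpperSqrt

/-! ### Continuity and boundedness of the distorted Fourier integral -/

section DistortedIntegral

open Complex

variable {V : ℝ → ℝ} {h f : ℝ → ℂ} {N : ℝ}

theorem continuousAt_psi (hV : MemL11 V) (x : ℝ) {k : ℝ} (hk : k ≠ 0) :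
    ContinuousAt (psi V x) k := by
  have hpos : ∀ {V : ℝ → ℝ}, MemL11 V → ∀ (x : ℝ) {k : ℝ}, 0 < k →
      ContinuousAt (fun k : ℝ => transCoeff V k * jostF V k x) k := fun {V} hV x {k} hk => by
    have hr : Continuous fun k : ℝ => (k : ℂ) := continuous_ofReal
    have c1 : ContinuousAt (fun k : ℝ => jostW V k) k :=
      ((continuousOn_jostW hV).comp_continuous hr real_mem_closedUHP).continuousAt
    have c2 : ContinuousAt (fun k : ℝ => jostF V k x) k :=
      ((continuousOn_jostF hV x).comp_continuous hr real_mem_closedUHP).continuousAt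
    exact ((continuousAt_const.mul hr.continuousAt).div c1 (exists_scattering hV hk.ne').1).mul c2
  rcases lt_or_gt_of_ne hk with h | h
  · have h1 := (hpos hV.reflect (-x) (neg_pos.2 h))
    have h2 : ContinuousAt (fun k : ℝ => ((Real.sqrt (2 * Real.pi) : ℝ) : ℂ)⁻¹ *
        (transCoeff (reflect V) (-k : ℝ) * jostF (reflect V) (-k : ℝ) (-x))) k :=
      continuousAt_const.mul (ContinuousAt.comp (f := fun k : ℝ => -k)
        (g := fun k : ℝ => transCoeff (reflect V) k * jostF (reflect V) k (-x)) h1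
        continuous_neg.continuousAt)
    refine h2.congr ?_
    filter_upwards [gt_mem_nhds h] with l hl
    have := psi_neg_of_pos hV x (neg_pos.2 hl)
    rw [neg_neg] at this
    rw [this, transCoeff_reflect, jostG]
  · have h2 : ContinuousAt (fun k : ℝ => ((Real.sqrt (2 * Real.pi) : ℝ) : ℂ)⁻¹ *
        (transCoeff V k * jostF V k x)) k := continuousAt_const.mul (hpos hV x h)
    refine h2.congr ?_
    filter_upwards [lt_mem_nhds h] with l hl
    exact (psi_of_pos hV x hl).symm

theorem exists_norm_psi_le (hV : MemL11 V) (N : ℝ) :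
    ∃ C, 0 ≤ C ∧ ∀ x ∈ Icc (-N) N, ∀ k ≠ 0, ‖psi V x k‖ ≤ C := by
  have hpos : ∀ {V : ℝ → ℝ}, MemL11 V → ∀ x ∈ Icc (-N) N, ∀ k : ℝ, 0 < k →
      ‖((Real.sqrt (2 * Real.pi) : ℝ) : ℂ)⁻¹ * (transCoeff V k * jostF V k x)‖ ≤
        ‖((Real.sqrt (2 * Real.pi) : ℝ) : ℂ)⁻¹‖ * (2 * volterraConst V * negWeight (-N)) :=
    fun {V} hV x hx k hk => by
      obtain ⟨-, -, R, -, hTR⟩ := exists_scattering hV hk.ne'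
      have hT : ‖transCoeff V k‖ ≤ 1 := by
        have : ‖transCoeff V k‖ ^ 2 ≤ 1 := by
          rw [transCoeff]; nlinarith [sq_nonneg ‖R‖]
        nlinarith [norm_nonneg (transCoeff V k)]
      have hF := norm_jostF_le hV (real_mem_closedUHP k) hx.1
      simp only [ofReal_im, neg_zero, zero_mul, Real.exp_zero, mul_one] at hF
      rw [norm_mul, norm_mul]
      refine mul_le_mul_of_nonneg_left ?_ (norm_nonneg _)
      exact (mul_le_mul hT hF (norm_nonneg _) zero_le_one).trans_eq (one_mul _)
  have hn : ∀ V, 0 ≤ ‖((Real.sqrt (2 * Real.pi) : ℝ) : ℂ)⁻¹‖ *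
      (2 * volterraConst V * negWeight (-N)) := fun V => by
    have := volterraConst_pos V
    have := negWeight_pos (-N)
    positivity
  refine ⟨_, add_nonneg (hn V) (hn (reflect V)), fun x hx k hk => ?_⟩
  rcases lt_or_gt_of_ne hk with h | h
  · have := psi_neg_of_pos hV x (neg_pos.2 h)
    rw [neg_neg] at this
    rw [this, jostG, ← transCoeff_reflect]
    exact (hpos hV.reflect (-x) ⟨neg_le_neg hx.2, by linarith [hx.1]⟩ (-k) (neg_pos.2 h)).trans
      (le_add_of_nonneg_left (hn V))
  · rw [psi_of_pos hV x h]
    exact (hpos hV x hx k h).trans (le_add_of_nonneg_right (hn (reflect V)))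

theorem norm_conj_psi_mul_le {C : ℝ} (hC : ∀ x ∈ Icc (-N) N, ∀ k ≠ 0, ‖psi V x k‖ ≤ C)
    (hfN : ∀ x ∉ Icc (-N) N, f x = 0) {k : ℝ} (hk : k ≠ 0) (x : ℝ) :
    ‖starRingEnd ℂ (psi V x k) * f x‖ ≤ C * ‖f x‖ := by
  by_cases hx : x ∈ Icc (-N) N
  · rw [norm_mul, RCLike.norm_conj]
    exact mul_le_mul_of_nonneg_right (hC x hx k hk) (norm_nonneg _)
  · rw [hfN x hx]; simp

theorem aestronglyMeasurable_conj_psi_mul (hV : MemL11 V) (hf : AEStronglyMeasurable f volume)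
    {k : ℝ} (hk : k ≠ 0) :
    AEStronglyMeasurable (fun x => starRingEnd ℂ (psi V x k) * f x) volume :=
  (continuous_conj.comp (continuous_psi hV hk)).aestronglyMeasurable.mul hf

theorem exists_norm_distortedFourierIntegral_le (hV : MemL11 V) (hf : Integrable f)
    (hfN : ∀ x ∉ Icc (-N) N, f x = 0) :
    ∃ C, ∀ k ≠ 0, ‖distortedFourierIntegral V f k‖ ≤ C := by
  obtain ⟨C, -, hC⟩ := exists_norm_psi_le hV N
  exact ⟨_, fun k hk => norm_integral_le_of_norm_le (hf.norm.const_mul C)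
    (Eventually.of_forall (norm_conj_psi_mul_le hC hfN hk))⟩

theorem continuousOn_distortedFourierIntegral (hV : MemL11 V) (hf : Integrable f)
    (hfN : ∀ x ∉ Icc (-N) N, f x = 0) :
    ContinuousOn (distortedFourierIntegral V f) {0}ᶜ := by
  obtain ⟨C, -, hC⟩ := exists_norm_psi_le hV N
  exact continuousOn_of_dominated
    (fun k hk => aestronglyMeasurable_conj_psi_mul hV hf.aestronglyMeasurable hk)
    (fun k hk => Eventually.of_forall (norm_conj_psi_mul_le hC hfN hk)) (hf.norm.const_mul C)
    (Eventually.of_forall fun x k hk => ((continuous_conj.continuousAt.comp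
      (continuousAt_psi hV x hk)).mul continuousAt_const).continuousWithinAt)

theorem ae_ne_zero : ∀ᵐ k : ℝ, k ≠ 0 := by
  simp [ae_iff]

theorem aestronglyMeasurable_of_continuousOn_compl {F : ℝ → ℂ} (h : ContinuousOn F {0}ᶜ) :
    AEStronglyMeasurable F volume := by
  have := h.aestronglyMeasurable (μ := volume) (measurableSet_singleton (0 : ℝ)).compl
  rwa [Measure.restrict_eq_self_of_ae_mem (s := {0}ᶜ) ae_ne_zero] at this

theorem integrable_comp_abs {φ : ℝ → ℝ} (h : IntegrableOn φ (Ioi 0)) :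
    Integrable fun x => φ |x| := by
  have h1 : IntegrableOn (fun x => φ |x|) (Ioi 0) :=
    h.congr_fun (fun x hx => by simp only [abs_of_pos (mem_Ioi.1 hx)]) measurableSet_Ioi
  rw [← integrableOn_univ, ← Iio_union_Ici (a := (0 : ℝ)), integrableOn_union,
    integrableOn_Ici_iff_integrableOn_Ioi]
  refine ⟨?_, h1⟩
  rw [← (Measure.measurePreserving_neg (volume : Measure ℝ)).integrableOn_comp_preimage
      (Homeomorph.neg ℝ).measurableEmbedding]
  simpa [Function.comp_def] using h1

end DistortedIntegral

/-! ### Stone's formula averaged against Gaussians -/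

section Stone

open Complex

variable {V : ℝ → ℝ} {h f : ℝ → ℂ} {N : ℝ} {U : ℝ → (L2R ≃ₗᵢ[ℂ] L2R)}

/-- A modulated Gaussian. -/
noncomputable def gaussMod (s δ lam : ℝ) : ℂ := cexp (I * s * lam) * cexp (-δ * lam ^ 2)

theorem norm_gaussMod (s δ lam : ℝ) : ‖gaussMod s δ lam‖ = Real.exp (-δ * lam ^ 2) := by
  rw [gaussMod, norm_mul, norm_cexp_I_mul_real, one_mul, ← ofReal_neg, ← ofReal_pow, ← ofReal_mul,
    ← ofReal_exp, norm_real, Real.norm_of_nonneg (Real.exp_nonneg _)]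

theorem continuous_gaussMod (s δ : ℝ) : Continuous (gaussMod s δ) := by
  unfold gaussMod; fun_prop

theorem integrable_gaussMod (s : ℝ) {δ : ℝ} (hδ : 0 < δ) : Integrable (gaussMod s δ) := by
  refine (integrable_exp_neg_mul_sq hδ).mono' (continuous_gaussMod s δ).aestronglyMeasurable
    (Eventually.of_forall fun lam => (norm_gaussMod s δ lam).le)

/-- The Fourier transform of `gaussMod`. -/
noncomputable def gaussHat (s δ t : ℝ) : ℝ :=
  Real.sqrt (Real.pi / δ) * Real.exp (-(1 / (4 * δ)) * (t - s) ^ 2)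

theorem integrable_gaussHat (s : ℝ) {δ : ℝ} (hδ : 0 < δ) : Integrable (gaussHat s δ) :=
  ((integrable_exp_neg_mul_sq (by positivity : 0 < 1 / (4 * δ))).comp_sub_right s).const_mul _

theorem integral_gaussMod_mul_exp (s t : ℝ) {δ : ℝ} (hδ : 0 < δ) :
    ∫ lam : ℝ, gaussMod s δ lam * cexp (-I * lam * t) = gaussHat s δ t := by
  have h1 := fourierIntegral_gaussian (b := (δ : ℂ)) (by simpa using hδ) ((s - t : ℝ) : ℂ)
  have h2 : ∀ lam : ℝ, gaussMod s δ lam * cexp (-I * lam * t) =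
      cexp (I * ((s - t : ℝ) : ℂ) * lam) * cexp (-(δ : ℂ) * lam ^ 2) := fun lam => by
    rw [gaussMod, mul_right_comm, ← Complex.exp_add]
    congr 2; push_cast; ring
  simp only [h2]
  rw [h1, gaussHat, Real.sqrt_eq_rpow, ofReal_mul, ofReal_cpow (by positivity), ofReal_exp]
  congr 2
  · push_cast; rfl
  · push_cast; ring
  · push_cast; field_simp; ring

/-- The damping `e^{-ε|t|}` makes the double integral in energy and time absolutely convergent, so
that Fubini is available before `ε → 0`. -/
theorem IsSchrodingerGroup.integrable_stone (hU : IsSchrodingerGroup V U) (h f : L2R) (s : ℝ)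
    {δ ε : ℝ} (hδ : 0 < δ) (hε : 0 < ε) :
    Integrable (fun p : ℝ × ℝ => gaussMod s δ p.1 *
      (cexp (-I * p.1 * p.2) * Real.exp (-ε * |p.2|) * inner ℂ h (U p.2 f)))
      (volume.prod volume) := by
  have he : Integrable fun t : ℝ => Real.exp (-ε * |t|) :=
    integrable_comp_abs (integrableOn_exp_mul_Ioi (neg_lt_zero.2 hε) 0)
  have hc := hU.continuous_inner h f
  have h1 : Integrable (fun t : ℝ => ((Real.exp (-ε * |t|) : ℝ) : ℂ) * inner ℂ h (U t f)) := by
    refine (he.const_mul (‖h‖ * ‖f‖)).mono' (Continuous.aestronglyMeasurable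
      ((by fun_prop : Continuous fun t : ℝ => ((Real.exp (-ε * |t|) : ℝ) : ℂ)).mul hc))
      (Eventually.of_forall fun t => ?_)
    rw [norm_mul, norm_real, Real.norm_of_nonneg (Real.exp_nonneg _), mul_comm]
    exact mul_le_mul_of_nonneg_right (norm_inner_group_le U h f t) (Real.exp_nonneg _)
  have h2 := (integrable_gaussMod s hδ).mul_prod h1
  refine h2.norm.mono' (Continuous.aestronglyMeasurable ?_) (Eventually.of_forall fun p => ?_)
  · exact ((continuous_gaussMod s δ).comp continuous_fst).mul
      ((by fun_prop : Continuous fun p : ℝ × ℝ => cexp (-I * p.1 * p.2) *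
        ((Real.exp (-ε * |p.2|) : ℝ) : ℂ)).mul (hc.comp continuous_snd))
  · have : ‖cexp (-I * p.1 * p.2)‖ = 1 := by
      rw [norm_cexp_neg_I_mul]; simp
    simp only [norm_mul, this, one_mul, le_refl]

theorem integrable_exp_neg_div_sqrt {δ : ℝ} (hδ : 0 < δ) (C : ℝ) :
    Integrable fun lam : ℝ => Real.exp (-δ * lam ^ 2) * (C / Real.sqrt |lam|) := by
  have := (integrable_comp_abs (integrableOn_rpow_mul_exp_neg_mul_sq hδ
    (by norm_num : (-1 : ℝ) < -(1 / 2)))).const_mul C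
  refine this.congr (Eventually.of_forall fun lam => ?_)
  simp only
  rw [sq_abs, Real.rpow_neg (abs_nonneg _), ← Real.sqrt_eq_rpow]
  ring

/-- A modulated Gaussian in the energy replaces a spectral projection. Fubini is applied for `ε >
0`, and then `ε → 0` on both sides: in energy the majorant is `e^{-δλ²} C / √|λ|`, integrable
because the resolvent is only `O(1/|k|)` with `|k| ≥ √|λ|`; in time the Gaussian itself dominates.
-/
theorem IsSchrodingerGroup.stone_gaussian (hU : IsSchrodingerGroup V U) (hV : MemL11 V) {c : ℝ}
    (hc : NonResonant V c) (hh : MemLp h 2 volume) (hf : MemLp f 2 volume)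
    (hhN : ∀ x ∉ Icc (-N) N, h x = 0) (hfN : ∀ x ∉ Icc (-N) N, f x = 0) (s : ℝ) {δ : ℝ}
    (hδ : 0 < δ) :
    ∫ lam : ℝ, gaussMod s δ lam * (2 * imGreenForm V h f (sqrtUHP lam)) =
      ∫ t : ℝ, gaussHat s δ t * inner ℂ (hh.toLp h) (U t (hf.toLp f)) := by
  set H := hh.toLp h
  set Φ := hf.toLp f
  have hhi := integrable_of_memLp_two_of_support hh hhN
  have hfi := integrable_of_memLp_two_of_support hf hfN
  have hcont := hU.continuous_inner H Φ
  have him : ∀ {ε : ℝ}, 0 < ε → ∀ lam : ℝ, 0 < ((lam : ℂ) + ε * I).im := fun hε lam => by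
    simpa using hε
  have hne : ∀ {ε : ℝ}, 0 < ε → ∀ lam : ℝ, (lam : ℂ) + ε * I ≠ 0 := fun hε lam h0 => by
    have := him hε lam
    rw [h0] at this
    simp at this
  have hLap : ∀ {ε : ℝ}, 0 < ε → ∀ lam : ℝ, ∫ t : ℝ, cexp (-I * lam * t) * Real.exp (-ε * |t|) *
      inner ℂ H (U t Φ) = 2 * imGreenForm V h f (sqrtUHP (lam + ε * I)) := fun hε lam =>
    hU.integral_exp_mul_inner hV hc hh hf hhN hfN (sqrtUHP_im_pos (him hε lam)) hε
      (sqrtUHP_sq (hne hε lam))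
  have hFub : ∀ {ε : ℝ}, 0 < ε →
      ∫ lam : ℝ, gaussMod s δ lam * (2 * imGreenForm V h f (sqrtUHP (lam + ε * I))) =
      ∫ t : ℝ, gaussHat s δ t * (Real.exp (-ε * |t|) * inner ℂ H (U t Φ)) := fun {ε} hε => by
    have := integral_integral_swap (f := fun lam t : ℝ => gaussMod s δ lam *
      (cexp (-I * lam * t) * Real.exp (-ε * |t|) * inner ℂ H (U t Φ)))
      (hU.integrable_stone H Φ s hδ hε)
    simp only [integral_const_mul, hLap hε] at this
    rw [this]
    refine integral_congr_ae (Eventually.of_forall fun t => ?_)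
    simp only
    rw [← integral_gaussMod_mul_exp s t hδ, ← integral_mul_const]
    refine integral_congr_ae (Eventually.of_forall fun lam => ?_)
    simp only
    ring
  have hR : Tendsto (fun ε : ℝ => ∫ t : ℝ, gaussHat s δ t * (Real.exp (-ε * |t|) *
      inner ℂ H (U t Φ))) (𝓝[>] 0) (𝓝 (∫ t : ℝ, gaussHat s δ t * inner ℂ H (U t Φ))) := by
    refine tendsto_integral_filter_of_dominated_convergence
      (fun t => ‖gaussHat s δ t‖ * (‖H‖ * ‖Φ‖)) ?_ ?_ ((integrable_gaussHat s hδ).norm.mul_const _)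
      (Eventually.of_forall fun t => ?_)
    · refine Eventually.of_forall fun ε => Continuous.aestronglyMeasurable ?_
      exact (by unfold gaussHat; fun_prop : Continuous fun t : ℝ => ((gaussHat s δ t : ℝ) : ℂ)).mul
        ((by fun_prop : Continuous fun t : ℝ => ((Real.exp (-ε * |t|) : ℝ) : ℂ)).mul hcont)
    · filter_upwards [self_mem_nhdsWithin] with ε hε
      refine Eventually.of_forall fun t => ?_
      rw [norm_mul, norm_mul, norm_real, norm_real, Real.norm_of_nonneg (Real.exp_nonneg _)]
      refine mul_le_mul_of_nonneg_left ?_ (norm_nonneg _)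
      refine (mul_le_of_le_one_left (norm_nonneg _) ?_).trans (norm_inner_group_le U H Φ t)
      rw [Real.exp_le_one_iff]
      have := mem_Ioi.1 hε
      have := abs_nonneg t
      nlinarith
    · have h1 : Continuous fun ε : ℝ => (gaussHat s δ t : ℂ) *
          (((Real.exp (-ε * |t|) : ℝ) : ℂ) * inner ℂ H (U t Φ)) := by fun_prop
      have h2 := h1.tendsto 0
      simp only [neg_zero, zero_mul, Real.exp_zero, ofReal_one, one_mul] at h2
      exact h2.mono_left nhdsWithin_le_nhds
  set C := greenConst V c N * ∫ p : ℝ × ℝ, ‖starRingEnd ℂ (h p.1) * f p.2‖ with hC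
  have hL : Tendsto (fun ε : ℝ => ∫ lam : ℝ, gaussMod s δ lam *
      (2 * imGreenForm V h f (sqrtUHP (lam + ε * I)))) (𝓝[>] 0)
      (𝓝 (∫ lam : ℝ, gaussMod s δ lam * (2 * imGreenForm V h f (sqrtUHP lam)))) := by
    refine tendsto_integral_filter_of_dominated_convergence
      (fun lam => Real.exp (-δ * lam ^ 2) * (2 * C / Real.sqrt |lam|)) ?_ ?_
      (integrable_exp_neg_div_sqrt hδ _) ?_
    · filter_upwards [self_mem_nhdsWithin] with ε hε
      have := (hU.integrable_stone H Φ s hδ hε).integral_prod_left.aestronglyMeasurable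
      simpa only [integral_const_mul, hLap hε] using this
    · filter_upwards [self_mem_nhdsWithin] with ε hε
      filter_upwards [ae_ne_zero] with lam hlam
      rw [norm_mul, norm_gaussMod, norm_mul, Complex.norm_ofNat]
      refine mul_le_mul_of_nonneg_left ?_ (Real.exp_nonneg _)
      have h1 := norm_imGreenForm_le hV hc hhi hfi hhN hfN
        (sqrtUHP_im_pos (him hε lam)).le (sqrtUHP_ne_zero _)
      rw [← hC, norm_sqrtUHP (hne hε lam)] at h1
      have h2 : |lam| ≤ ‖(lam : ℂ) + ε * I‖ := by
        have := abs_re_le_norm ((lam : ℂ) + ε * I)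
        simpa using this
      have hC0 : 0 ≤ C := by
        have := norm_imGreenForm_le hV hc hhi hfi hhN hfN (k := 1) (real_mem_closedUHP 1)
          one_ne_zero
        rw [norm_one, div_one] at this
        exact (norm_nonneg _).trans this
      have h3 := div_le_div_of_nonneg_left hC0 (Real.sqrt_pos.2 (abs_pos.2 hlam))
        (Real.sqrt_le_sqrt h2)
      rw [mul_div_assoc]
      exact mul_le_mul_of_nonneg_left (h1.trans h3) zero_le_two
    · filter_upwards [ae_ne_zero] with lam hlam
      have h1 := tendsto_imGreenForm hV hc hhi hfi hhN hfN
        (sqrtUHP_mem_closedUHP (w := (lam : ℂ)) (by simp)) (sqrtUHP_ne_zero _)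
      exact ((h1.comp (tendsto_sqrtUHP hlam)).const_mul 2).const_mul _
  refine tendsto_nhds_unique hL (hR.congr' ?_)
  filter_upwards [self_mem_nhdsWithin] with ε hε
  exact (hFub hε).symm

/-- The square root of a negative energy is purely imaginary, hence fixed by `k ↦ -conj k`, and the
resolvent kernel is real there. Negative energies carry no spectral density. -/
theorem imGreenForm_sqrtUHP_of_neg (hV : MemL11 V) (h f : ℝ → ℂ) {x : ℝ} (hx : x < 0) :
    imGreenForm V h f (sqrtUHP x) = 0 := by
  refine (integral_congr_ae (Eventually.of_forall fun p => ?_)).trans (integral_zero _ _)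
  have h1 := green_neg_conj hV (sqrtUHP_mem_closedUHP (w := (x : ℂ)) (by simp)) p.1 p.2
  rw [neg_conj_sqrtUHP_of_neg hx] at h1
  have h2 : (green V (sqrtUHP x) p.1 p.2).im = 0 := Complex.conj_eq_iff_im.1 h1.symm
  simp only [h2, ofReal_zero, zero_mul]

end Stone

/-! ### Bessel's inequality and the evolution formula for compactly supported data -/

section SpectralIdentity

open Complex

variable {V : ℝ → ℝ} {h f : ℝ → ℂ} {N : ℝ} {U : ℝ → (L2R ≃ₗᵢ[ℂ] L2R)}

theorem integrable_gaussMod_sq_mul (hV : MemL11 V) (hh : Integrable h) (hf : Integrable f)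
    (hhN : ∀ x ∉ Icc (-N) N, h x = 0) (hfN : ∀ x ∉ Icc (-N) N, f x = 0) (s : ℝ) {δ : ℝ}
    (hδ : 0 < δ) :
    Integrable fun k => gaussMod s δ (k ^ 2) *
      (starRingEnd ℂ (distortedFourierIntegral V h k) * distortedFourierIntegral V f k) := by
  obtain ⟨A, hA⟩ := exists_norm_distortedFourierIntegral_le hV hh hhN
  obtain ⟨B, hB⟩ := exists_norm_distortedFourierIntegral_le hV hf hfN
  have mh := aestronglyMeasurable_of_continuousOn_compl
    (continuousOn_distortedFourierIntegral hV hh hhN)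
  have mf := aestronglyMeasurable_of_continuousOn_compl
    (continuousOn_distortedFourierIntegral hV hf hfN)
  refine ((integrable_exp_neg_mul_sq (b := 2 * δ) (by positivity)).const_mul
    (Real.exp δ * (A * B))).mono' (((continuous_gaussMod s δ).comp
      (continuous_pow 2)).aestronglyMeasurable.mul
      ((continuous_conj.comp_aestronglyMeasurable mh).mul mf)) ?_
  filter_upwards [ae_ne_zero] with k hk
  have hA0 := (norm_nonneg _).trans (hA k hk)
  rw [norm_mul, norm_gaussMod, norm_mul, RCLike.norm_conj]
  have h1 := mul_le_mul (hA k hk) (hB k hk) (norm_nonneg _) hA0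
  -- From `k⁴ ≥ 2k² - 1`, which gives an ordinary Gaussian majorant in `k`.
  have h2 : Real.exp (-δ * (k ^ 2) ^ 2) ≤ Real.exp δ * Real.exp (-(2 * δ) * k ^ 2) := by
    rw [← Real.exp_add, Real.exp_le_exp]
    nlinarith [mul_nonneg hδ.le (sq_nonneg (k ^ 2 - 1))]
  refine (mul_le_mul h2 h1 (by positivity) (by positivity)).trans_eq ?_
  ring

/-- Stone's formula after the substitution `λ = κ²`: the Jacobian `2κ` cancels the factor `π / (2κ)`
of the spectral density, leaving `2π`, and the contributions of `κ` and `-κ` make up the whole line.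
-/
theorem IsSchrodingerGroup.spectral_gaussian (hU : IsSchrodingerGroup V U) (hV : MemL11 V) {c : ℝ}
    (hc : NonResonant V c) (hh : MemLp h 2 volume) (hf : MemLp f 2 volume)
    (hhN : ∀ x ∉ Icc (-N) N, h x = 0) (hfN : ∀ x ∉ Icc (-N) N, f x = 0) (s : ℝ) {δ : ℝ}
    (hδ : 0 < δ) :
    2 * Real.pi * ∫ k, gaussMod s δ (k ^ 2) *
      (starRingEnd ℂ (distortedFourierIntegral V h k) * distortedFourierIntegral V f k) =
      ∫ t : ℝ, gaussHat s δ t * inner ℂ (hh.toLp h) (U t (hf.toLp f)) := by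
  have hhi := integrable_of_memLp_two_of_support hh hhN
  have hfi := integrable_of_memLp_two_of_support hf hfN
  rw [← hU.stone_gaussian hV hc hh hf hhN hfN s hδ]
  set B : ℝ → ℂ := fun k => gaussMod s δ (k ^ 2) *
    (starRingEnd ℂ (distortedFourierIntegral V h k) * distortedFourierIntegral V f k) with hBdef
  have hB : Integrable B := integrable_gaussMod_sq_mul hV hhi hfi hhN hfN s hδ
  set L : ℝ → ℂ := fun lam => gaussMod s δ lam * (2 * imGreenForm V h f (sqrtUHP lam)) with hL
  have h1 : ∫ lam, L lam = ∫ lam in Ioi 0, L lam := by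
    refine (setIntegral_eq_integral_of_ae_compl_eq_zero ?_).symm
    filter_upwards [ae_ne_zero] with x hx0 hx
    simp only [hL, imGreenForm_sqrtUHP_of_neg hV h f ((not_lt.1 (mt mem_Ioi.2 hx)).lt_of_ne hx0),
      mul_zero]
  have hBn : Integrable fun k => B (-k) := hB.comp_neg
  have h2 : ∫ k in Iic (0 : ℝ), B k = ∫ k in Ioi (0 : ℝ), B (-k) := by
    rw [integral_comp_neg_Ioi, neg_zero]
  rw [h1, ← integral_comp_rpow_Ioi_of_pos two_pos,
    ← intervalIntegral.integral_Iic_add_Ioi (b := 0) hB.integrableOn hB.integrableOn, h2,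
    ← integral_add hBn.integrableOn hB.integrableOn, ← integral_const_mul]
  refine setIntegral_congr_fun measurableSet_Ioi fun κ hκ => ?_
  have hκ0 : 0 < κ := hκ
  simp only [hL, hBdef, Real.rpow_two]
  rw [sqrtUHP_ofReal_sq hκ0, imGreenForm_eq hV hhi hfi hhN hfN hκ0, neg_sq, real_smul,
    show (2 - 1 : ℝ) = 1 by norm_num, Real.rpow_one]
  have : (κ : ℂ) ≠ 0 := by exact_mod_cast hκ0.ne'
  push_cast
  field_simp
  ring

theorem integral_gaussHat (s : ℝ) {δ : ℝ} (hδ : 0 < δ) : ∫ t, gaussHat s δ t = 2 * Real.pi := by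
  have h1 : ∫ t, gaussHat s δ t = Real.sqrt (Real.pi / δ) *
      ∫ t, Real.exp (-(1 / (4 * δ)) * (t - s) ^ 2) := integral_const_mul _ _
  rw [h1, integral_sub_right_eq_self (fun t => Real.exp (-(1 / (4 * δ)) * t ^ 2)) s,
    integral_gaussian, ← Real.sqrt_mul (by positivity)]
  have : Real.pi / δ * (Real.pi / (1 / (4 * δ))) = (2 * Real.pi) ^ 2 := by field_simp; norm_num
  rw [this, Real.sqrt_sq (by positivity)]

theorem gaussHat_nonneg (s δ t : ℝ) : 0 ≤ gaussHat s δ t :=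
  mul_nonneg (Real.sqrt_nonneg _) (Real.exp_nonneg _)

theorem eLpNorm_two_eq {g : ℝ → ℂ} (hg : MemLp g 2 volume) :
    eLpNorm g 2 volume = ENNReal.ofReal (Real.sqrt (∫ k, ‖g k‖ ^ 2)) := by
  rw [hg.eLpNorm_eq_integral_rpow_norm two_ne_zero ENNReal.ofNat_ne_top, Real.sqrt_eq_rpow]
  simp

theorem gaussMod_zero (δ lam : ℝ) : gaussMod 0 δ lam = (Real.exp (-δ * lam ^ 2) : ℝ) := by
  rw [gaussMod]; push_cast; simp

/-- The case `h = f`, `s = 0`: the time side is an average, of total mass `2π`, of quantities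
bounded by `‖f‖²`. -/
theorem IsSchrodingerGroup.integral_exp_mul_sq_le (hU : IsSchrodingerGroup V U) (hV : MemL11 V)
    {c : ℝ} (hc : NonResonant V c) (hf : MemLp f 2 volume) (hfN : ∀ x ∉ Icc (-N) N, f x = 0)
    {δ : ℝ} (hδ : 0 < δ) :
    Integrable (fun k => Real.exp (-δ * (k ^ 2) ^ 2) * ‖distortedFourierIntegral V f k‖ ^ 2) ∧
    ∫ k, Real.exp (-δ * (k ^ 2) ^ 2) * ‖distortedFourierIntegral V f k‖ ^ 2 ≤
      ‖hf.toLp f‖ ^ 2 := by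
  have hfi := integrable_of_memLp_two_of_support hf hfN
  have h1 := hU.spectral_gaussian hV hc hf hf hfN hfN 0 hδ
  have h2 : ∀ k : ℝ, gaussMod 0 δ (k ^ 2) * (starRingEnd ℂ (distortedFourierIntegral V f k) *
      distortedFourierIntegral V f k) =
      ((Real.exp (-δ * (k ^ 2) ^ 2) * ‖distortedFourierIntegral V f k‖ ^ 2 : ℝ) : ℂ) := fun k => by
    rw [gaussMod_zero, conj_mul', ofReal_mul, ofReal_pow]
  have h3 := integrable_gaussMod_sq_mul hV hfi hfi hfN hfN 0 hδ
  simp only [h2] at h1 h3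
  refine ⟨h3.re, ?_⟩
  set J := ∫ k, Real.exp (-δ * (k ^ 2) ^ 2) * ‖distortedFourierIntegral V f k‖ ^ 2 with hJ
  rw [integral_complex_ofReal, ← hJ] at h1
  have h4 : ‖∫ t : ℝ, (gaussHat 0 δ t : ℂ) * inner ℂ (hf.toLp f) (U t (hf.toLp f))‖ ≤
      ∫ t, gaussHat 0 δ t * ‖hf.toLp f‖ ^ 2 := by
    refine norm_integral_le_of_norm_le ((integrable_gaussHat 0 hδ).mul_const _)
      (Eventually.of_forall fun t => ?_)
    rw [norm_mul, norm_real, Real.norm_of_nonneg (gaussHat_nonneg _ _ _), sq]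
    exact mul_le_mul_of_nonneg_left (norm_inner_group_le U _ _ t) (gaussHat_nonneg _ _ _)
  rw [integral_mul_const, integral_gaussHat 0 hδ, ← h1] at h4
  have h5 : (2 * Real.pi * J : ℂ) = ((2 * Real.pi * J : ℝ) : ℂ) := by push_cast; ring
  rw [h5, norm_real] at h4
  have h6 := (le_abs_self _).trans h4
  exact le_of_mul_le_mul_left h6 (by positivity)

/-- Bessel's inequality for the distorted Fourier transform. -/
theorem IsSchrodingerGroup.eLpNorm_distortedFourierIntegral_le (hU : IsSchrodingerGroup V U)
    (hV : MemL11 V) {c : ℝ} (hc : NonResonant V c) (hf : MemLp f 2 volume)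
    (hfN : ∀ x ∉ Icc (-N) N, f x = 0) :
    MemLp (distortedFourierIntegral V f) 2 volume ∧
      eLpNorm (distortedFourierIntegral V f) 2 volume ≤ eLpNorm f 2 volume := by
  have hfi := integrable_of_memLp_two_of_support hf hfN
  have mf := aestronglyMeasurable_of_continuousOn_compl
    (continuousOn_distortedFourierIntegral hV hfi hfN)
  set F : ℕ → ℝ → ℂ := fun n k => (Real.exp (-(1 / ((n : ℝ) + 1)) / 2 * (k ^ 2) ^ 2) : ℝ) *
    distortedFourierIntegral V f k with hF
  have hFm : ∀ n, AEStronglyMeasurable (F n) volume := fun n =>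
    (by fun_prop : Continuous fun k : ℝ =>
      ((Real.exp (-(1 / ((n : ℝ) + 1)) / 2 * (k ^ 2) ^ 2) : ℝ) : ℂ)).aestronglyMeasurable.mul mf
  have hFl : ∀ n, eLpNorm (F n) 2 volume ≤ eLpNorm f 2 volume := fun n => by
    have hδ : 0 < 1 / ((n : ℝ) + 1) := by positivity
    obtain ⟨h1, h2⟩ := hU.integral_exp_mul_sq_le hV hc hf hfN hδ
    have e1 : (fun k => ‖F n k‖ ^ 2) = fun k => Real.exp (-(1 / ((n : ℝ) + 1)) * (k ^ 2) ^ 2) *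
        ‖distortedFourierIntegral V f k‖ ^ 2 := by
      ext k
      simp only [hF]
      rw [norm_mul, mul_pow, norm_real, Real.norm_of_nonneg (Real.exp_nonneg _), ← Real.exp_nat_mul]
      congr 2; push_cast; ring
    have hm : MemLp (F n) 2 volume := by
      rw [memLp_two_iff_integrable_sq_norm (hFm n), e1]; exact h1
    rw [eLpNorm_two_eq hm, e1]
    refine (ENNReal.ofReal_le_ofReal (Real.sqrt_le_sqrt h2)).trans_eq ?_
    rw [Real.sqrt_sq (norm_nonneg _), Lp.norm_toLp, ENNReal.ofReal_toReal hf.2.ne]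
  have hle : eLpNorm (distortedFourierIntegral V f) 2 volume ≤ eLpNorm f 2 volume := by
    -- Fatou's lemma as the Gaussian cutoff is removed. This inequality suffices; unitarity of the
    -- transform is not required.
    refine (Lp.eLpNorm_lim_le_liminf_eLpNorm hFm _ (Eventually.of_forall fun k => ?_)).trans ?_
    · have h1 : Tendsto (fun n : ℕ => 1 / ((n : ℝ) + 1)) atTop (𝓝 0) :=
        tendsto_one_div_add_atTop_nhds_zero_nat
      have h2 : Continuous fun δ : ℝ => ((Real.exp (-δ / 2 * (k ^ 2) ^ 2) : ℝ) : ℂ) *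
          distortedFourierIntegral V f k := by fun_prop
      have h3 := h2.tendsto 0
      rw [neg_zero, zero_div, zero_mul, Real.exp_zero, ofReal_one, one_mul] at h3
      exact h3.comp h1
    · exact liminf_le_of_le (by isBoundedDefault) fun b hb => by
        obtain ⟨n, hn⟩ := hb.exists
        exact hn.trans (hFl n)
  exact ⟨⟨mf, hle.trans_lt hf.2⟩, hle⟩

/-- An approximate identity of mass `2π`. Taking `δ = η²` makes the width linear in `η`, so the
substitution `t = s + 2ηr` leaves a fixed Gaussian in `r`. -/
theorem tendsto_integral_gaussHat_mul {φ : ℝ → ℂ} (hφ : Continuous φ) {B : ℝ}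
    (hB : ∀ t, ‖φ t‖ ≤ B) (s : ℝ) :
    Tendsto (fun η : ℝ => ∫ t, gaussHat s (η ^ 2) t * φ t) (𝓝[>] 0) (𝓝 (2 * Real.pi * φ s)) := by
  have h1 : ∀ η ∈ Ioi (0 : ℝ), ∫ t, gaussHat s (η ^ 2) t * φ t =
      ∫ r, ((2 * Real.sqrt Real.pi * Real.exp (-1 * r ^ 2) : ℝ) : ℂ) * φ (s + 2 * η * r) :=
    fun η hη => by
      have hη0 : 0 < η := hη
      have e1 := Measure.integral_comp_mul_left
        (fun t => (gaussHat s (η ^ 2) (s + t) : ℂ) * φ (s + t)) (2 * η)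
      rw [integral_add_left_eq_self (fun t => (gaussHat s (η ^ 2) t : ℂ) * φ t) s,
        abs_of_pos (by positivity), real_smul] at e1
      have e2 : ∫ t, (gaussHat s (η ^ 2) t : ℂ) * φ t = ((2 * η : ℝ) : ℂ) *
          ∫ r, (gaussHat s (η ^ 2) (s + 2 * η * r) : ℂ) * φ (s + 2 * η * r) := by
        rw [e1, ← mul_assoc, ← ofReal_mul, mul_inv_cancel₀ (by positivity), ofReal_one, one_mul]
      rw [e2, ← integral_const_mul]
      refine integral_congr_ae (Eventually.of_forall fun r => ?_)
      simp only
      rw [← mul_assoc, ← ofReal_mul]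
      congr 2
      rw [gaussHat, Real.sqrt_div' _ (by positivity), Real.sqrt_sq hη0.le]
      have : -(1 / (4 * η ^ 2)) * (s + 2 * η * r - s) ^ 2 = -1 * r ^ 2 := by
        field_simp; ring
      rw [this]
      field_simp
  have h2 : Integrable fun r : ℝ => 2 * Real.sqrt Real.pi * Real.exp (-1 * r ^ 2) :=
    (integrable_exp_neg_mul_sq one_pos).const_mul _
  have h3 : ∫ r : ℝ, ((2 * Real.sqrt Real.pi * Real.exp (-1 * r ^ 2) : ℝ) : ℂ) * φ s =
      2 * Real.pi * φ s := by
    rw [integral_mul_const, integral_complex_ofReal, integral_const_mul, integral_gaussian, div_one,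
      mul_assoc, Real.mul_self_sqrt Real.pi_pos.le]
    push_cast; rfl
  rw [← h3]
  refine Tendsto.congr' (eventually_nhdsWithin_of_forall fun η hη => (h1 η hη).symm) ?_
  refine tendsto_integral_filter_of_dominated_convergence
    (fun r => 2 * Real.sqrt Real.pi * Real.exp (-1 * r ^ 2) * B) ?_ ?_ (h2.mul_const B) ?_
  · exact Eventually.of_forall fun η => Continuous.aestronglyMeasurable (by fun_prop)
  · refine Eventually.of_forall fun η => Eventually.of_forall fun r => ?_
    rw [norm_mul, norm_real, Real.norm_of_nonneg (by positivity)]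
    exact mul_le_mul_of_nonneg_left (hB _) (by positivity)
  · refine Eventually.of_forall fun r => Tendsto.const_mul _ ?_
    have h4 : Continuous fun η : ℝ => φ (s + 2 * η * r) := by fun_prop
    have h5 := h4.tendsto 0
    simp only [mul_zero, zero_mul, add_zero] at h5
    exact h5.mono_left nhdsWithin_le_nhds

/-- The evolution formula for compactly supported data. -/
theorem IsSchrodingerGroup.inner_eq_integral (hU : IsSchrodingerGroup V U) (hV : MemL11 V) {c : ℝ}
    (hc : NonResonant V c) (hh : MemLp h 2 volume) (hf : MemLp f 2 volume)
    (hhN : ∀ x ∉ Icc (-N) N, h x = 0) (hfN : ∀ x ∉ Icc (-N) N, f x = 0) (s : ℝ) :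
    inner ℂ (hh.toLp h) (U s (hf.toLp f)) = ∫ k : ℝ, cexp (I * (s * k ^ 2 : ℝ)) *
      (starRingEnd ℂ (distortedFourierIntegral V h k) * distortedFourierIntegral V f k) := by
  have mh := (hU.eLpNorm_distortedFourierIntegral_le hV hc hh hhN).1
  have mf := (hU.eLpNorm_distortedFourierIntegral_le hV hc hf hfN).1
  have mhc : MemLp (fun k => starRingEnd ℂ (distortedFourierIntegral V h k)) 2 volume := by
    exact mh.star
  have hi : Integrable fun k => starRingEnd ℂ (distortedFourierIntegral V h k) *
      distortedFourierIntegral V f k := mhc.integrable_mul mf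
  have h1 := tendsto_integral_gaussHat_mul (hU.continuous_inner (hh.toLp h) (hf.toLp f))
    (norm_inner_group_le U (hh.toLp h) (hf.toLp f)) s
  have h2 : Tendsto (fun η : ℝ => 2 * Real.pi * ∫ k, gaussMod s (η ^ 2) (k ^ 2) *
      (starRingEnd ℂ (distortedFourierIntegral V h k) * distortedFourierIntegral V f k)) (𝓝[>] 0)
      (𝓝 (2 * Real.pi * ∫ k : ℝ, cexp (I * (s * k ^ 2 : ℝ)) *
      (starRingEnd ℂ (distortedFourierIntegral V h k) * distortedFourierIntegral V f k))) := by
    refine Tendsto.const_mul _ ?_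
    refine tendsto_integral_filter_of_dominated_convergence
      (fun k => ‖starRingEnd ℂ (distortedFourierIntegral V h k) * distortedFourierIntegral V f k‖)
      ?_ ?_ hi.norm ?_
    · exact Eventually.of_forall fun η => ((continuous_gaussMod s _).comp
        (continuous_pow 2)).aestronglyMeasurable.mul hi.aestronglyMeasurable
    · refine Eventually.of_forall fun η => Eventually.of_forall fun k => ?_
      rw [norm_mul]
      refine mul_le_of_le_one_left (norm_nonneg _) ?_
      rw [norm_gaussMod, Real.exp_le_one_iff]
      nlinarith [mul_nonneg (sq_nonneg η) (sq_nonneg (k ^ 2))]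
    · refine Eventually.of_forall fun k => Tendsto.mul_const _ ?_
      have h3 : Continuous fun η : ℝ => gaussMod s (η ^ 2) (k ^ 2) := by unfold gaussMod; fun_prop
      have h4 := h3.tendsto 0
      have h5 : gaussMod s (0 ^ 2) (k ^ 2) = cexp (I * (s * k ^ 2 : ℝ)) := by
        rw [gaussMod]; simp [mul_assoc]
      rw [h5] at h4
      exact h4.mono_left nhdsWithin_le_nhds
  -- The two sides of `spectral_gaussian` at `δ = η²` converge separately: the time side
  -- concentrates at `s`, and the frequency side loses its Gaussian cutoff.
  have h3 := tendsto_nhds_unique (h1.congr' (eventually_nhdsWithin_of_forall fun η hη =>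
    (hU.spectral_gaussian hV hc hh hf hhN hfN s (pow_pos (mem_Ioi.1 hη) 2)).symm)) h2
  exact mul_left_cancel₀ (by simp [Real.pi_ne_zero]) h3

end SpectralIdentity

/-! ### Extension of the transform and of the evolution formula to `L²` -/

section DistortedFourier

open Complex

variable {V : ℝ → ℝ} {U : ℝ → (L2R ≃ₗᵢ[ℂ] L2R)}

theorem memLp_cut (f : L2R) (R : ℝ) : MemLp ((Icc (-R) R).indicator (f : ℝ → ℂ)) 2 volume :=
  (Lp.memLp f).indicator measurableSet_Icc

theorem tendsto_toLp_cut (f : L2R) :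
    Tendsto (fun R : ℝ => (memLp_cut f R).toLp _) atTop (𝓝 f) := by
  have hf := Lp.memLp f
  have h := Lp.tendsto_Lp_iff_tendsto_eLpNorm'' (fi := atTop)
    (fun R : ℝ => (Icc (-R) R).indicator (f : ℝ → ℂ)) (memLp_cut f) f hf
  rw [Lp.toLp_coeFn] at h
  rw [h]
  have hsq : Integrable fun x => ‖f x‖ ^ 2 :=
    (memLp_two_iff_integrable_sq_norm hf.1).1 hf
  have h1 : Tendsto (fun R : ℝ => ∫ x, ‖((Icc (-R) R).indicator (f : ℝ → ℂ) - f) x‖ ^ 2) atTop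
      (𝓝 (∫ _ : ℝ, (0 : ℝ))) := by
    refine tendsto_integral_filter_of_dominated_convergence (fun x => ‖f x‖ ^ 2)
      (Eventually.of_forall fun R => (((memLp_cut f R).1.sub hf.1).norm.pow 2))
      (Eventually.of_forall fun R => Eventually.of_forall fun x => ?_) hsq
      (Eventually.of_forall fun x => ?_)
    · rw [norm_pow, norm_norm, Pi.sub_apply]
      by_cases hx : x ∈ Icc (-R) R
      · rw [indicator_of_mem hx, sub_self, norm_zero, zero_pow two_ne_zero]
        exact sq_nonneg _
      · rw [indicator_of_notMem hx, zero_sub, norm_neg]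
    · refine tendsto_const_nhds.congr' ?_
      filter_upwards [eventually_ge_atTop |x|] with R hR
      have hx : x ∈ Icc (-R) R := abs_le.1 hR
      rw [Pi.sub_apply, indicator_of_mem hx, sub_self, norm_zero, zero_pow two_ne_zero]
  rw [integral_zero] at h1
  have h2 : Tendsto (fun R : ℝ => ENNReal.ofReal (Real.sqrt
      (∫ x, ‖((Icc (-R) R).indicator (f : ℝ → ℂ) - f) x‖ ^ 2))) atTop (𝓝 0) := by
    have := ENNReal.tendsto_ofReal ((Real.continuous_sqrt.tendsto 0).comp h1)
    simpa using this
  exact h2.congr fun R => (eLpNorm_two_eq ((memLp_cut f R).sub hf)).symm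

theorem distortedFourierIntegral_sub (hV : MemL11 V) {f g : ℝ → ℂ} {N : ℝ} (hf : Integrable f)
    (hg : Integrable g) (hfN : ∀ x ∉ Icc (-N) N, f x = 0) (hgN : ∀ x ∉ Icc (-N) N, g x = 0)
    {k : ℝ} (hk : k ≠ 0) : distortedFourierIntegral V (f - g) k =
      distortedFourierIntegral V f k - distortedFourierIntegral V g k := by
  have hc : Continuous fun x => starRingEnd ℂ (psi V x k) :=
    continuous_conj.comp (continuous_psi hV hk)
  rw [distortedFourierIntegral, distortedFourierIntegral, distortedFourierIntegral,
    ← integral_sub (integrable_mul_of_support hf hc hfN) (integrable_mul_of_support hg hc hgN)]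
  simp only [Pi.sub_apply, mul_sub]

theorem cut_eq_zero (f : L2R) {R N : ℝ} (h : R ≤ N) :
    ∀ x ∉ Icc (-N) N, (Icc (-R) R).indicator (f : ℝ → ℂ) x = 0 := fun x hx =>
  indicator_of_notMem (fun hx' => hx ⟨by linarith [hx'.1], by linarith [hx'.2]⟩) _

theorem IsSchrodingerGroup.memLp_distortedFourierIntegral_cut (hU : IsSchrodingerGroup V U)
    (hV : MemL11 V) {c : ℝ} (hc : NonResonant V c) (f : L2R) (R : ℝ) :
    MemLp (distortedFourierIntegral V ((Icc (-R) R).indicator f)) 2 volume :=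
  (hU.eLpNorm_distortedFourierIntegral_le hV hc (memLp_cut f R) (cut_eq_zero f le_rfl)).1

theorem IsSchrodingerGroup.tendsto_of_isDistortedFourier (hU : IsSchrodingerGroup V U)
    (hV : MemL11 V) {c : ℝ} (hc : NonResonant V c) {f g : L2R} : IsDistortedFourier V f g ↔
    Tendsto (fun R => (hU.memLp_distortedFourierIntegral_cut hV hc f R).toLp _) atTop (𝓝 g) := by
  have h := Lp.tendsto_Lp_iff_tendsto_eLpNorm'' (fi := atTop)
    (fun R : ℝ => distortedFourierIntegral V ((Icc (-R) R).indicator (f : ℝ → ℂ)))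
    (hU.memLp_distortedFourierIntegral_cut hV hc f) g (Lp.memLp g)
  rw [Lp.toLp_coeFn] at h
  exact h.symm

/-- Bessel's inequality turns the Cauchy property of the truncations of `f` into that of their
transforms, so a limit exists and the choice in `distortedFourier` is a genuine one. -/
theorem IsSchrodingerGroup.isDistortedFourier (hU : IsSchrodingerGroup V U)
    (hV : MemL11 V) {c : ℝ} (hc : NonResonant V c) (f : L2R) :
    IsDistortedFourier V f (distortedFourier V f) := by
  suffices h : ∃ g, IsDistortedFourier V f g from Classical.epsilon_spec h
  simp only [hU.tendsto_of_isDistortedFourier hV hc]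
  refine cauchySeq_tendsto_of_complete (Metric.cauchySeq_iff.2 fun ε hε => ?_)
  obtain ⟨R₀, hR₀⟩ := Metric.cauchySeq_iff.1 (tendsto_toLp_cut f).cauchySeq ε hε
  refine ⟨R₀, fun R hR S hS => lt_of_le_of_lt ?_ (hR₀ R hR S hS)⟩
  rw [dist_edist, dist_edist]
  refine ENNReal.toReal_mono (edist_ne_top _ _) ?_
  rw [Lp.edist_toLp_toLp, Lp.edist_toLp_toLp]
  have z1 := cut_eq_zero f (le_max_left R S)
  have z2 := cut_eq_zero f (le_max_right R S)
  refine le_trans (le_of_eq (eLpNorm_congr_ae ?_)) (hU.eLpNorm_distortedFourierIntegral_le hV hc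
    ((memLp_cut f R).sub (memLp_cut f S)) (N := max R S) fun x hx => by
      rw [Pi.sub_apply, z1 x hx, z2 x hx, sub_zero]).2
  filter_upwards [ae_ne_zero] with k hk
  exact (distortedFourierIntegral_sub hV (integrable_of_memLp_two_of_support (memLp_cut f R) z1)
    (integrable_of_memLp_two_of_support (memLp_cut f S) z2) z1 z2 hk).symm

/-- The evolution formula tested against compactly supported functions. -/
theorem IsSchrodingerGroup.inner_eq_integral_distortedFourier (hU : IsSchrodingerGroup V U)
    (hV : MemL11 V) {c : ℝ} (hc : NonResonant V c) {h : ℝ → ℂ} (hh : MemLp h 2 volume) {N : ℝ}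
    (hhN : ∀ x ∉ Icc (-N) N, h x = 0) (f : L2R) (s : ℝ) :
    inner ℂ (hh.toLp h) (U s f) = ∫ k : ℝ, cexp (I * (s * k ^ 2 : ℝ)) *
      (starRingEnd ℂ (distortedFourierIntegral V h k) * distortedFourier V f k) := by
  have mh := (hU.eLpNorm_distortedFourierIntegral_le hV hc hh hhN).1
  have he : ∀ k : ℝ, ‖cexp (-I * (s * k ^ 2 : ℝ))‖ = 1 := fun k => by
    rw [neg_mul, ← mul_neg, ← ofReal_neg, mul_comm, norm_exp_ofReal_mul_I]
  have mH : MemLp (fun k : ℝ => cexp (-I * (s * k ^ 2 : ℝ)) * distortedFourierIntegral V h k) 2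
      volume := by
    refine mh.of_le ((by fun_prop : Continuous fun k : ℝ =>
      cexp (-I * (s * k ^ 2 : ℝ))).aestronglyMeasurable.mul mh.1) (Eventually.of_forall fun k => ?_)
    rw [norm_mul, he, one_mul]
  have hconj : ∀ k : ℝ, starRingEnd ℂ (cexp (-I * (s * k ^ 2 : ℝ))) = cexp (I * (s * k ^ 2 : ℝ)) :=
    fun k => by rw [← exp_conj, map_mul, conj_ofReal, map_neg, conj_I, neg_neg]
  -- The integral is an inner product with a fixed `L²` vector that contains the oscillating factor,
  -- so `L²` convergence of the transforms is enough.
  have hinner : ∀ {φ : ℝ → ℂ} {g : L2R}, (g : ℝ → ℂ) =ᵐ[volume] φ → inner ℂ (mH.toLp _) g =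
      ∫ k : ℝ, cexp (I * (s * k ^ 2 : ℝ)) * (starRingEnd ℂ (distortedFourierIntegral V h k) * φ k) :=
    fun {φ g} hg => by
      rw [L2.inner_def]
      refine integral_congr_ae ?_
      filter_upwards [hg, mH.coeFn_toLp] with k h1 h2
      rw [h1, h2, RCLike.inner_apply, map_mul, hconj]
      ring
  rw [← hinner (g := distortedFourier V f) (ae_eq_refl _)]
  have h1 := (hU.tendsto_of_isDistortedFourier hV hc).1 (hU.isDistortedFourier hV hc f)
  have h2 := (continuous_const.inner (𝕜 := ℂ) continuous_id :
    Continuous fun g : L2R => inner ℂ (mH.toLp _) g).tendsto _ |>.comp h1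
  have h3 := ((continuous_const.inner (𝕜 := ℂ) (U s).continuous :
    Continuous fun g : L2R => inner ℂ (hh.toLp h) (U s g)).tendsto f).comp (tendsto_toLp_cut f)
  refine tendsto_nhds_unique h3 (h2.congr' ?_)
  filter_upwards [eventually_ge_atTop N] with R hR
  simp only [Function.comp_apply]
  rw [hinner (hU.memLp_distortedFourierIntegral_cut hV hc f R).coeFn_toLp,
    hU.inner_eq_integral hV hc hh (memLp_cut f R) (N := R) (fun x hx => hhN x fun hx' =>
      hx ⟨by linarith [hx'.1], by linarith [hx'.2]⟩) (cut_eq_zero f le_rfl)]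

end DistortedFourier

/-! ### Fubini and duality with compactly supported test functions -/

section Dispersive

open Complex

variable {V : ℝ → ℝ} {U : ℝ → (L2R ≃ₗᵢ[ℂ] L2R)}

/-- Joint measurability follows from continuity in `x` and measurability in `k`. The value at `k =
0`, about which nothing is known, is replaced by zero. -/
theorem stronglyMeasurable_psi (hV : MemL11 V) : StronglyMeasurable
    (Function.uncurry fun x k : ℝ => ({0}ᶜ : Set ℝ).indicator (psi V x) k) := by
  classical
  refine stronglyMeasurable_uncurry_of_continuous_of_stronglyMeasurable (fun k => ?_) fun x => ?_
  · by_cases hk : k = 0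
    · simp only [hk, mem_compl_iff, mem_singleton_iff, not_true_eq_false, not_false_eq_true,
        indicator_of_notMem]
      exact continuous_const
    · simp only [indicator_of_mem (show k ∈ ({0}ᶜ : Set ℝ) from hk)]
      exact continuous_psi hV hk
  · have h1 : ContinuousOn (psi V x) {0}ᶜ := fun k hk =>
      (continuousAt_psi hV x hk).continuousWithinAt
    have h2 := ContinuousOn.measurable_piecewise (g := fun _ : ℝ => (0 : ℂ)) h1
      continuousOn_const (measurableSet_singleton (0 : ℝ)).compl
    rw [← piecewise_eq_indicator]
    exact h2.stronglyMeasurable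

theorem integral_conj_distortedFourierIntegral_mul (hV : MemL11 V) {h : ℝ → ℂ}
    (hh : Integrable h) {N : ℝ} (hhN : ∀ x ∉ Icc (-N) N, h x = 0) {E : ℝ → ℂ} (hE : Continuous E)
    {n : ℝ} :
    ∫ k in Ioc (-n) n, starRingEnd ℂ (distortedFourierIntegral V h k) * E k =
      ∫ x, starRingEnd ℂ (h x) * ∫ k in Ioc (-n) n, psi V x k * E k := by
  obtain ⟨C, hC0, hC⟩ := exists_norm_psi_le hV N
  have hEi : IntegrableOn E (Ioc (-n) n) :=
    (hE.continuousOn.integrableOn_compact isCompact_Icc).mono_set Ioc_subset_Icc_self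
  set ψ : ℝ → ℝ → ℂ := fun x k => ({0}ᶜ : Set ℝ).indicator (psi V x) k
  have hψ : ∀ x, ∀ k ≠ 0, ψ x k = psi V x k := fun x k hk => indicator_of_mem hk _
  have hae : ∀ᵐ k ∂(volume.restrict (Ioc (-n) n)), k ≠ 0 := ae_restrict_of_ae ae_ne_zero
  have hint : Integrable (Function.uncurry fun x k : ℝ => starRingEnd ℂ (h x) * (ψ x k * E k))
      (volume.prod (volume.restrict (Ioc (-n) n))) := by
    refine ((hh.norm.const_mul C).mul_prod hEi.norm).mono' ?_ (Eventually.of_forall fun p => ?_)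
    · exact (integrable_conj_comp hh).aestronglyMeasurable.comp_fst.mul
        ((stronglyMeasurable_psi hV).aestronglyMeasurable.mul
          (hE.comp continuous_snd).aestronglyMeasurable)
    · simp only [Function.uncurry, norm_mul, RCLike.norm_conj]
      by_cases hp : p.1 ∈ Icc (-N) N
      · have : ‖ψ p.1 p.2‖ ≤ C := by
          by_cases hk : p.2 = 0
          · simp only [ψ]
            rw [hk, indicator_of_notMem (by simp), norm_zero]; exact hC0
          · rw [hψ _ _ hk]; exact hC _ hp _ hk
        calc _ = ‖ψ p.1 p.2‖ * (‖h p.1‖ * ‖E p.2‖) := by ring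
          _ ≤ C * (‖h p.1‖ * ‖E p.2‖) := mul_le_mul_of_nonneg_right this (by positivity)
          _ = _ := by ring
      · rw [hhN _ hp]; simp
  have h1 := integral_integral_swap hint
  rw [setIntegral_congr_ae₀ (g := fun k => ∫ x, starRingEnd ℂ (h x) * (ψ x k * E k))
    measurableSet_Ioc.nullMeasurableSet, ← h1]
  · refine integral_congr_ae (Eventually.of_forall fun x => ?_)
    simp only
    rw [integral_const_mul]
    congr 1
    refine integral_congr_ae ?_
    filter_upwards [hae] with k hk
    rw [hψ x k hk]
  · filter_upwards [ae_ne_zero] with k hk _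
    rw [distortedFourierIntegral, ← integral_conj, ← integral_mul_const]
    refine integral_congr_ae (Eventually.of_forall fun x => ?_)
    simp only [hψ x k hk, map_mul, conj_conj]
    ring

/-- Testing with the phase of `u` on a bounded measurable set `T` gives `∫_T ‖u‖ ≤ B |T|` for every
such `T`, which forces the pointwise bound. -/
theorem ae_norm_le_of_norm_inner_le {u : L2R} {B : ℝ} (hB : 0 ≤ B)
    (H : ∀ (h : ℝ → ℂ) (N : ℝ) (hh : MemLp h 2 volume), (∀ x ∉ Icc (-N) N, h x = 0) →
      ‖inner ℂ (hh.toLp h) u‖ ≤ B * ∫ x, ‖h x‖) : ∀ᵐ x, ‖u x‖ ≤ B := by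
  have hn : ∀ n : ℕ, ∀ᵐ x ∂(volume.restrict (Icc (-(n : ℝ)) n)), ‖u x‖ ≤ B := fun n => by
    have hu : IntegrableOn (u : ℝ → ℂ) (Icc (-(n : ℝ)) n) :=
      ((Lp.memLp u).restrict (Icc (-(n : ℝ)) n)).integrable (by norm_num)
    refine ae_le_of_forall_setIntegral_le hu.norm (integrable_const B) fun S hS _ => ?_
    rw [Measure.restrict_restrict hS]
    set T := S ∩ Icc (-(n : ℝ)) n
    have hT : MeasurableSet T := hS.inter measurableSet_Icc
    have hTf : volume T ≠ ⊤ := ((measure_mono inter_subset_right).trans_lt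
      isCompact_Icc.measure_lt_top).ne
    -- Where `u` vanishes the quotient is `0`, so `‖h‖ ≤ 1` holds throughout `T`.
    set h : ℝ → ℂ := T.indicator fun x => u x / (‖u x‖ : ℂ) with hdef
    have hle : ∀ x, ‖h x‖ ≤ ‖T.indicator (fun _ => (1 : ℂ)) x‖ := fun x => by
      by_cases hx : x ∈ T
      · simp only [hdef, indicator_of_mem hx, norm_div, norm_real, norm_norm, norm_one]
        exact div_self_le_one _
      · simp only [hdef, indicator_of_notMem hx, le_refl]
    have hone : MemLp (T.indicator fun _ => (1 : ℂ)) 2 volume :=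
      memLp_indicator_const 2 hT 1 (Or.inr hTf)
    have hh : MemLp h 2 volume := hone.mono
      ((((Lp.stronglyMeasurable u).measurable.div
        (Lp.stronglyMeasurable u).measurable.norm.complex_ofReal).indicator
          hT).aestronglyMeasurable) (Eventually.of_forall hle)
    have h1 := H h n hh fun x hx => indicator_of_notMem (fun hx' => hx hx'.2) _
    have h2 : inner ℂ (hh.toLp h) u = ((∫ x in T, ‖u x‖ : ℝ) : ℂ) := by
      rw [L2.inner_def, ← integral_complex_ofReal, ← integral_indicator hT]
      refine integral_congr_ae ?_
      filter_upwards [hh.coeFn_toLp] with x hx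
      rw [hx, RCLike.inner_apply]
      by_cases hxT : x ∈ T
      · simp only [hdef, indicator_of_mem hxT, map_div₀, conj_ofReal]
        rw [mul_div_assoc', mul_conj, normSq_eq_norm_sq, sq, ofReal_mul]
        by_cases h0 : (‖u x‖ : ℂ) = 0
        · rw [h0]; simp
        · field_simp
      · simp only [hdef, indicator_of_notMem hxT, map_zero, mul_zero]
    have h3 : ∫ x, ‖h x‖ ≤ volume.real T := by
      have h4 : Integrable (T.indicator fun _ => (1 : ℝ)) :=
        (integrable_indicator_iff hT).2 (integrableOn_const hTf)
      refine (integral_mono_of_nonneg (Eventually.of_forall fun x => norm_nonneg _) h4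
        (Eventually.of_forall fun x => (hle x).trans_eq ?_)).trans_eq ?_
      · rw [norm_indicator_eq_indicator_norm]; simp
      · rw [integral_indicator hT]; simp
    rw [h2, norm_real] at h1
    rw [setIntegral_const, smul_eq_mul, mul_comm]
    exact (le_abs_self _).trans (h1.trans (mul_le_mul_of_nonneg_left h3 hB))
  have h2 : ∀ᵐ x, ∀ n : ℕ, x ∈ Icc (-(n : ℝ)) n → ‖u x‖ ≤ B :=
    ae_all_iff.2 fun n => (ae_restrict_iff' measurableSet_Icc).1 (hn n)
  filter_upwards [h2] with x hx
  obtain ⟨n, hn⟩ := exists_nat_ge |x|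
  exact hx n (abs_le.1 hn)

end Dispersive

/-! ### The dispersive estimate for nonvanishing Wronskian -/

section DispersiveEstimate

open Complex

variable {V : ℝ → ℝ} {U : ℝ → (L2R ≃ₗᵢ[ℂ] L2R)}

/-- After Fubini the inner integral in `k` is the one of `norm_integral_psi_le`, bounded uniformly
in `x` and in the cutoff `n`, and `n → ∞` recovers the evolution formula. The constant is fixed
before `c` and `U` and so depends on `V` alone. -/
theorem exists_norm_inner_group_le (hV : MemL11 V) :
    ∃ C, 0 ≤ C ∧ ∀ (c : ℝ) (U : ℝ → (L2R ≃ₗᵢ[ℂ] L2R)), NonResonant V c → IsSchrodingerGroup V U →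
      ∀ (f : L2R) (G g' : ℝ → ℂ) (M D τ : ℝ), IsPrimitive G g' →
        (distortedFourier V f : ℝ → ℂ) =ᵐ[volume] G → (∀ k, ‖G k‖ ≤ M) → MemLp g' 2 volume →
        0 < D → ∫ k, ‖g' k‖ ^ 2 ≤ D ^ 2 → 0 < τ →
        ∀ (h : ℝ → ℂ) (N : ℝ) (hh : MemLp h 2 volume), (∀ x ∉ Icc (-N) N, h x = 0) →
          ‖inner ℂ (hh.toLp h) (U (1 / τ ^ 2) f)‖ ≤
            C * (M * τ + D * (τ * Real.sqrt τ)) * ∫ x, ‖h x‖ := by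
  obtain ⟨C, hC0, hC⟩ := norm_integral_psi_le hV
  refine ⟨C, hC0, fun c U hc hU f G g' M D τ hG hfG hM hg hD hgD hτ h N hh hhN => ?_⟩
  have hhi := integrable_of_memLp_two_of_support hh hhN
  have mh := (hU.eLpNorm_distortedFourierIntegral_le hV hc hh hhN).1
  have mhc : MemLp (fun k => starRingEnd ℂ (distortedFourierIntegral V h k)) 2 volume := mh.star
  have mG : MemLp G 2 volume := (Lp.memLp (distortedFourier V f)).ae_eq hfG
  set E : ℝ → ℂ := fun k => cexp (I * (k ^ 2 / τ ^ 2 : ℝ)) * G k with hE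
  have hEc : Continuous E :=
    (by fun_prop : Continuous fun k : ℝ => cexp (I * (k ^ 2 / τ ^ 2 : ℝ))).mul hG.continuous
  have hEn : ∀ k, ‖E k‖ = ‖G k‖ := fun k => by
    rw [hE]; simp only [norm_mul]
    rw [mul_comm I, norm_exp_ofReal_mul_I, one_mul]
  have mE : MemLp E 2 volume := mG.of_le hEc.aestronglyMeasurable
    (Eventually.of_forall fun k => (hEn k).le)
  have hint : Integrable fun k => starRingEnd ℂ (distortedFourierIntegral V h k) * E k :=
    mhc.integrable_mul mE
  have e1 : inner ℂ (hh.toLp h) (U (1 / τ ^ 2) f) =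
      ∫ k, starRingEnd ℂ (distortedFourierIntegral V h k) * E k := by
    rw [hU.inner_eq_integral_distortedFourier hV hc hh hhN]
    refine integral_congr_ae ?_
    filter_upwards [hfG] with k hk
    rw [hk, hE, one_div_mul_eq_div]
    ring
  rw [e1]
  have hlim := (intervalIntegral_tendsto_integral hint tendsto_neg_atTop_atBot tendsto_id).norm
  refine le_of_tendsto hlim ?_
  filter_upwards [eventually_gt_atTop 0] with n hn
  rw [id, intervalIntegral.integral_of_le (by linarith),
    integral_conj_distortedFourierIntegral_mul hV hhi hhN hEc, ← integral_const_mul]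
  refine norm_integral_le_of_norm_le (hhi.norm.const_mul _) (Eventually.of_forall fun x => ?_)
  rw [norm_mul, RCLike.norm_conj, mul_comm]
  refine mul_le_mul_of_nonneg_right ?_ (norm_nonneg _)
  rw [← intervalIntegral.integral_of_le (by linarith)]
  exact (hC G g' M D τ n x hG hM hg hD hgD hτ hn).2

/-- The dispersive estimate, assuming that the Wronskian does not vanish. -/
theorem exists_eLpNorm_group_le (hV : MemL11 V) :
    ∃ C : ℝ≥0, ∀ (c : ℝ) (U : ℝ → (L2R ≃ₗᵢ[ℂ] L2R)), NonResonant V c → IsSchrodingerGroup V U →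
      ∀ (f : L2R) (g' : ℝ → ℂ), HasWeakDeriv (distortedFourier V f) g' → ∀ t : ℝ, 0 ≤ t →
        eLpNorm (U t f) ⊤ volume ≤ C * dispersiveBound t (distortedFourier V f) g' := by
  obtain ⟨C, hC0, hC⟩ := exists_norm_inner_group_le hV
  -- The added `1` keeps the constant nonzero, so that the right-hand side is infinite whenever the
  -- dispersive bound is.
  refine ⟨Real.toNNReal (C + 1), fun c U hc hU f g' hw t ht => ?_⟩
  have hC1 : ((Real.toNNReal (C + 1) : ℝ≥0) : ℝ≥0∞) ≠ 0 := by
    rw [Ne, ENNReal.coe_eq_zero, Real.toNNReal_eq_zero, not_le]; linarith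
  set g := distortedFourier V f with hg
  -- If the transform vanishes, the first term on the right is zero even at `t = 0`, because `∞ * 0
  -- = 0`; so `U t f = 0` has to be shown. Otherwise the right-hand side is infinite at `t = 0`, and
  -- `t > 0` may be assumed.
  by_cases hg0 : eLpNorm g ⊤ volume = 0
  · have hz : (g : ℝ → ℂ) =ᵐ[volume] 0 :=
      (eLpNorm_eq_zero_iff (Lp.memLp g).1 (by simp)).1 hg0
    have h1 : ∀ᵐ x, ‖U t f x‖ ≤ 0 := ae_norm_le_of_norm_inner_le le_rfl fun h N hh hhN => by
      rw [hU.inner_eq_integral_distortedFourier hV hc hh hhN, zero_mul, ← hg]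
      refine (norm_eq_zero.2 ?_).le
      refine (integral_congr_ae ?_).trans (integral_zero ℝ ℂ)
      filter_upwards [hz] with k hk
      rw [hk, Pi.zero_apply, mul_zero, mul_zero]
    have h2 := eLpNormEssSup_le_of_ae_bound h1
    rw [← eLpNorm_exponent_top, ENNReal.ofReal_zero] at h2
    exact h2.trans zero_le
  by_cases htop : dispersiveBound t g g' = ⊤
  · rw [htop, ENNReal.mul_top hC1]; exact le_top
  have ht0 : 0 < t := by
    refine ht.lt_of_ne fun h => htop ?_
    rw [dispersiveBound, ← h, ENNReal.ofReal_zero, ENNReal.zero_rpow_of_neg (by norm_num),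
      ENNReal.top_mul hg0, top_add]
  have hpow : ∀ a : ℝ, ENNReal.ofReal t ^ a = ENNReal.ofReal (t ^ a) := fun a =>
    ENNReal.ofReal_rpow_of_pos ht0
  have hpow0 : ∀ a : ℝ, ENNReal.ofReal t ^ a ≠ 0 := fun a => by
    rw [hpow, Ne, ENNReal.ofReal_eq_zero, not_le]; positivity
  rw [dispersiveBound, ENNReal.add_eq_top, not_or] at htop
  have hM : eLpNorm g ⊤ volume ≠ ⊤ := fun h => htop.1 (by rw [h, ENNReal.mul_top (hpow0 _)])
  have hD : eLpNorm g' 2 volume ≠ ⊤ := fun h => htop.2 (by rw [h, ENNReal.mul_top (hpow0 _)])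
  have hg' : MemLp g' 2 volume := ⟨hw.2.1.aestronglyMeasurable, hD.lt_top⟩
  obtain ⟨G, hG, hgG⟩ := hw.exists_isPrimitive
  set M := (eLpNorm g ⊤ volume).toReal with hMdef
  set D := (eLpNorm g' 2 volume).toReal with hDdef
  -- The almost everywhere bound holds on a dense set, and that set is closed because the
  -- representative `G` is continuous.
  have hGM : ∀ k, ‖G k‖ ≤ M := by
    have h1 : ∀ᵐ k, ‖G k‖ ≤ M := by
      filter_upwards [hgG, ae_le_eLpNormEssSup (f := (g : ℝ → ℂ)) (μ := volume)] with k h1 h2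
      rw [← h1, ← toReal_enorm]
      rw [← eLpNorm_exponent_top] at h2
      exact ENNReal.toReal_mono hM h2
    have h2 : IsClosed {k | ‖G k‖ ≤ M} := isClosed_le hG.continuous.norm continuous_const
    have h3 : Dense {k | ‖G k‖ ≤ M} := Measure.dense_of_ae h1
    exact fun k => (h2.closure_eq ▸ h3 k : k ∈ {k | ‖G k‖ ≤ M})
  have hgD : ∫ k, ‖g' k‖ ^ 2 = D ^ 2 := by
    rw [hDdef, eLpNorm_two_eq hg', ENNReal.toReal_ofReal (Real.sqrt_nonneg _),
      Real.sq_sqrt (integral_nonneg fun k => sq_nonneg _)]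
  have hD0 : 0 ≤ D := ENNReal.toReal_nonneg
  have hM0 : 0 ≤ M := ENNReal.toReal_nonneg
  set τ := t ^ (-(1 / 2) : ℝ) with hτdef
  have hτ : 0 < τ := by positivity
  have htτ : 1 / τ ^ 2 = t := by
    rw [hτdef, ← Real.rpow_natCast, ← Real.rpow_mul ht0.le]
    norm_num [Real.rpow_neg_one]
  have hττ : τ * Real.sqrt τ = t ^ (-(3 / 4) : ℝ) := by
    rw [hτdef, Real.sqrt_eq_rpow, ← Real.rpow_mul ht0.le, ← Real.rpow_add ht0]
    norm_num
  have hB : 0 ≤ C * (M * τ + D * (τ * Real.sqrt τ)) := by positivity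
  have hae : ∀ᵐ x, ‖U t f x‖ ≤ C * (M * τ + D * (τ * Real.sqrt τ)) :=
    ae_norm_le_of_norm_inner_le hB fun h N hh hhN => by
      -- The oscillatory estimate requires a positive `D`, while the norm of `g'` may be zero; it is
      -- applied with `D + η`, and then `η → 0`.
      have h1 : ∀ η : ℝ, 0 < η → ‖inner ℂ (hh.toLp h) (U t f)‖ ≤
          C * (M * τ + (D + η) * (τ * Real.sqrt τ)) * ∫ x, ‖h x‖ := fun η hη => by
        have := hC c U hc hU f G g' M (D + η) τ hG hgG hGM hg' (by linarith)
          (by rw [hgD]; nlinarith) hτ h N hh hhN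
        rwa [htτ] at this
      have h2 : Continuous fun η : ℝ =>
          C * (M * τ + (D + η) * (τ * Real.sqrt τ)) * ∫ x, ‖h x‖ := by fun_prop
      have h3 := (h2.tendsto 0).mono_left (nhdsWithin_le_nhds (s := Ioi 0))
      rw [add_zero] at h3
      exact ge_of_tendsto h3 (eventually_nhdsWithin_of_forall fun η hη => h1 η hη)
  have h2 := eLpNormEssSup_le_of_ae_bound hae
  rw [← eLpNorm_exponent_top] at h2
  refine h2.trans ?_
  rw [dispersiveBound, hpow, hpow, ← ENNReal.ofReal_toReal hM, ← ENNReal.ofReal_toReal hD,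
    ← hMdef, ← hDdef, ← hττ, ← hτdef, ← ENNReal.ofReal_mul hτ.le, ← ENNReal.ofReal_mul (by positivity),
    ← ENNReal.ofReal_add (by positivity) (by positivity), ← ENNReal.ofReal, ← ENNReal.ofReal_mul (by positivity)]
  refine ENNReal.ofReal_le_ofReal ?_
  have : 0 ≤ M * τ + D * (τ * Real.sqrt τ) := by positivity
  nlinarith

end DispersiveEstimate

/-! ### The free case and comparison with the flat Fourier transform -/

section Free

open Complex

theorem memL11_zero : MemL11 fun _ => 0 := by
  simp [MemL11]

theorem jostM_zero {k : ℂ} (hk : k ∈ closedUHP) : jostM (fun _ => 0) k = fun _ => 1 := by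
  refine (volterra_solution_unique memL11_zero hk continuous_const (C := 1) (fun x => ?_)
    fun x => ?_).symm
  · rw [norm_one, one_mul]; exact one_le_negWeight x
  · simp

theorem jostW_zero {k : ℂ} (hk : k ∈ closedUHP) : jostW (fun _ => 0) k = -2 * I * k := by
  have hr : reflect (fun _ => 0) = fun _ => 0 := rfl
  have hd : jostMDeriv (fun _ => 0) k 0 = 0 := by simp [jostMDeriv]
  rw [jostW_eq, hr, hd, jostM_zero hk]
  ring

/-- The explicit Wronskian replaces the argument by absence of eigenvalues, so the free estimate
needs no discussion of bound states. -/
theorem nonResonant_zero : NonResonant (fun _ => 0) 2 := by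
  refine ⟨two_pos, fun k hk => le_of_eq ?_⟩
  rw [jostW_zero hk]; simp

theorem psi_zero (x : ℝ) {k : ℝ} (hk : k ≠ 0) :
    psi (fun _ => 0) x k = ((Real.sqrt (2 * Real.pi) : ℝ) : ℂ)⁻¹ * cexp (I * k * x) := by
  have hT : ∀ k : ℝ, k ≠ 0 → transCoeff (fun _ => 0) k = 1 := fun k hk => by
    rw [transCoeff, jostW_zero (real_mem_closedUHP k), div_self]
    simp [hk]
  rcases lt_or_gt_of_ne hk with h | h
  · have h1 := psi_neg_of_pos memL11_zero x (neg_pos.2 h)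
    rw [neg_neg] at h1
    have hr : reflect (fun _ => 0) = fun _ => 0 := rfl
    rw [h1, hT _ (neg_ne_zero.2 hk), jostG, hr, jostF, jostM_zero (real_mem_closedUHP (-k))]
    simp
  · rw [psi_of_pos memL11_zero x h, hT k hk, jostF, jostM_zero (real_mem_closedUHP k)]
    simp

theorem distortedFourierIntegral_zero (f : ℝ → ℂ) {k : ℝ} (hk : k ≠ 0) :
    distortedFourierIntegral (fun _ => 0) f k =
      ((Real.sqrt (2 * Real.pi) : ℝ) : ℂ)⁻¹ * 𝓕 f (k / (2 * Real.pi)) := by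
  rw [distortedFourierIntegral, Real.fourier_real_eq_integral_exp_smul, ← integral_const_mul]
  refine integral_congr_ae (Eventually.of_forall fun x => ?_)
  simp only [psi_zero x hk, map_mul, map_inv₀, conj_ofReal, smul_eq_mul, ← exp_conj, conj_I]
  rw [mul_assoc]
  congr 3
  push_cast
  field_simp

/-- The `L²` Fourier transform of an integrable function is given by the Fourier integral. -/
theorem fourier_ae_eq_of_integrable (f : L2R) (hf : Integrable (f : ℝ → ℂ)) :
    ((𝓕 f : L2R) : ℝ → ℂ) =ᵐ[volume] 𝓕 (f : ℝ → ℂ) := by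
  refine ae_eq_of_integral_contDiff_smul_eq
    ((Lp.memLp (𝓕 f : L2R)).locallyIntegrable (by norm_num)) ?_ fun φ hφ hφc => ?_
  · exact (VectorFourier.fourierIntegral_continuous Real.continuous_fourierChar
      (L := innerₗ ℝ) continuous_inner hf).locallyIntegrable
  · have hφ1 : HasCompactSupport fun x => (φ x : ℂ) := hφc.comp_left (g := ((↑) : ℝ → ℂ)) rfl
    have hφ2 : ContDiff ℝ ∞ fun x => (φ x : ℂ) := Complex.ofRealCLM.contDiff.comp hφ
    set g := hφ1.toSchwartzMap hφ2 with hg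
    have hgc : ∀ x, g x = φ x := fun x => rfl
    have h1 := congrArg (fun T => T g) (Lp.fourier_toTemperedDistribution_eq f)
    simp only [TemperedDistribution.fourier_apply, Lp.toTemperedDistribution_apply] at h1
    have h2 := VectorFourier.integral_fourierIntegral_smul_eq_flip (μ := volume) (ν := volume)
      (L := innerₗ ℝ) (f := (g : ℝ → ℂ)) (g := (f : ℝ → ℂ)) Real.continuous_fourierChar
      continuous_inner g.integrable hf
    have h3 : ∫ x, 𝓕 (g : ℝ → ℂ) x • f x = ∫ x, g x • 𝓕 (f : ℝ → ℂ) x := by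
      refine h2.trans ?_
      rw [flip_innerₗ]
      rfl
    have h4 : ∀ (u : ℝ → ℂ), ∫ x, φ x • u x = ∫ x, g x • u x := fun u => by
      simp only [hgc, Complex.real_smul, smul_eq_mul]
    rw [h4, h4, ← h3, ← h1]
    rfl

theorem ae_comp_div {P : ℝ → Prop} (h : ∀ᵐ x, P x) {a : ℝ} (ha : a ≠ 0) : ∀ᵐ x, P (x / a) := by
  rw [ae_iff] at h ⊢
  have h1 := Real.volume_preimage_mul_right (inv_ne_zero ha) {x | ¬P x}
  rw [h, mul_zero] at h1
  simp only [div_eq_mul_inv]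
  exact h1

/-- Both transforms are `L²` limits of the same truncated integrals, up to rescaling. Two successive
extractions give a common subsequence along which both converge almost everywhere. -/
theorem flatFourier_ae_eq {U : ℝ → (L2R ≃ₗᵢ[ℂ] L2R)} (hU : IsSchrodingerGroup (fun _ => 0) U)
    (f : L2R) : flatFourier f =ᵐ[volume] distortedFourier (fun _ => 0) f := by
  have hcont : Continuous fun g : L2R => (𝓕 g : L2R) := (Lp.fourierTransformₗᵢ ℝ ℂ).continuous
  have h1 : Tendsto (fun n : ℕ => (𝓕 ((memLp_cut f n).toLp _) : L2R)) atTop (𝓝 (𝓕 f)) :=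
    (hcont.tendsto f).comp ((tendsto_toLp_cut f).comp tendsto_natCast_atTop_atTop)
  obtain ⟨ns, hns, h2⟩ := (tendstoInMeasure_of_tendsto_Lp h1).exists_seq_tendsto_ae
  have h3 := ((hU.tendsto_of_isDistortedFourier memL11_zero nonResonant_zero).1
    (hU.isDistortedFourier memL11_zero nonResonant_zero f)).comp
    (tendsto_natCast_atTop_atTop.comp hns.tendsto_atTop)
  obtain ⟨ms, hms, h4⟩ := (tendstoInMeasure_of_tendsto_Lp h3).exists_seq_tendsto_ae
  have h5 : ∀ᵐ ξ, ∀ n : ℕ, (𝓕 ((memLp_cut f n).toLp _) : L2R) ξ =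
      𝓕 ((Icc (-(n : ℝ)) n).indicator (f : ℝ → ℂ)) ξ := by
    refine ae_all_iff.2 fun n => ?_
    have hi := integrable_of_memLp_two_of_support (memLp_cut f n) (cut_eq_zero f le_rfl)
    have hae := (memLp_cut f n).coeFn_toLp
    filter_upwards [fourier_ae_eq_of_integrable _ (hi.congr hae.symm)] with ξ hξ
    rw [hξ, Real.fourier_real_eq, Real.fourier_real_eq]
    refine integral_congr_ae ?_
    filter_upwards [hae] with x hx
    rw [hx]
  have h6 : ∀ᵐ k, ∀ n : ℕ, (hU.memLp_distortedFourierIntegral_cut memL11_zero nonResonant_zero f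
      n).toLp _ k = distortedFourierIntegral (fun _ => 0)
        ((Icc (-(n : ℝ)) n).indicator (f : ℝ → ℂ)) k :=
    ae_all_iff.2 fun n => MemLp.coeFn_toLp _
  have hπ : (2 * Real.pi) ≠ 0 := by positivity
  filter_upwards [ae_comp_div h2 hπ, ae_comp_div h5 hπ, h4, h6, ae_ne_zero] with k k2 k5 k4 k6 hk
  have k7 := (k2.comp hms.tendsto_atTop).const_mul ((Real.sqrt (2 * Real.pi) : ℝ) : ℂ)⁻¹
  refine tendsto_nhds_unique k7 (k4.congr fun i => ?_)
  simp only [Function.comp_apply]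
  rw [k6, k5, distortedFourierIntegral_zero _ hk]

end Free

/-! ### Conclusion -/

theorem HasWeakDeriv.congr {g₁ g₂ g' : ℝ → ℂ} (h : HasWeakDeriv g₁ g') (he : g₁ =ᵐ[volume] g₂) :
    HasWeakDeriv g₂ g' := by
  obtain ⟨h1, h2, h3⟩ := h
  refine ⟨fun x => ?_, h2, fun φ hφ hφc => ?_⟩
  · obtain ⟨s, hs, hi⟩ := h1 x
    exact ⟨s, hs, hi.congr (ae_restrict_of_ae he)⟩
  · rw [← h3 φ hφ hφc]
    refine integral_congr_ae ?_
    filter_upwards [he] with k hk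
    rw [hk]

theorem proposition3p1 :
    (∃ C : ℝ≥0, ∀ U : ℝ → (L2R ≃ₗᵢ[ℂ] L2R), IsSchrodingerGroup (fun _ => 0) U →
      ∀ (f : L2R) (g' : ℝ → ℂ), HasWeakDeriv (flatFourier f) g' → ∀ t : ℝ, 0 ≤ t →
        eLpNorm (U t f) ∞ volume ≤ C * dispersiveBound t (flatFourier f) g') ∧
    (∀ V : ℝ → ℝ, MemL11 V → HasNoBoundStates V →
      ∃ C : ℝ≥0, ∀ U : ℝ → (L2R ≃ₗᵢ[ℂ] L2R), IsSchrodingerGroup V U →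
        ∀ (f : L2R) (g' : ℝ → ℂ), HasWeakDeriv (distortedFourier V f) g' → ∀ t : ℝ, 0 ≤ t →
          eLpNorm (U t f) ∞ volume ≤ C * dispersiveBound t (distortedFourier V f) g') := by
  refine ⟨?_, fun V hV hE => ?_⟩
  -- For `V = 0` the group `e^{itL_0}` is `e^{-it∂ₓ²}`, and the statement transfers from the
  -- distorted to the flat transform by almost everywhere equality.
  · obtain ⟨C, hC⟩ := exists_eLpNorm_group_le memL11_zero
    refine ⟨C, fun U hU f g' hw t ht => ?_⟩
    have he := flatFourier_ae_eq hU f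
    have h := hC 2 U nonResonant_zero hU f g' (hw.congr he) t ht
    rwa [dispersiveBound, ← eLpNorm_congr_ae he] at h
  · obtain ⟨C, hC⟩ := exists_eLpNorm_group_le hV
    refine ⟨C, fun U hU => ?_⟩
    obtain ⟨c, hc, hcW⟩ := exists_le_norm_jostW_of_group hV hU hE
    exact hC c U ⟨hc, hcW⟩ hU
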